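/- **Theorem (Least singular value bound).** For $a,b,\sigma>0$ there exists a constant $C=C(a,b,\sigma)>0$, depending only on $a,b,\sigma$, such that the following holds for every integer $n\ge C$. Let $X=(X_{ij})$ be an $n\times n$ complex-valued random matrix such that (i) $\{(X_{ij},X_{ji}) : 1\le i<j\le n\}$ is a collection of independent random pairs; (ii) the family of diagonal entries $\{X_{ii}:1\le i\le n\}$ is independent of the family of off-diagonal entries (the diagonal entries may depend on each other); (iii) the events $\mathcal E_{ij}:=\{|X_{ij}|\le a,\ |X_{ji}|\le a\}$, $i\ne j$, satisfy $$\min_{i<j}\mathbb P(\mathcal E_{ij})\ge b,\qquad \min_{i\ne j}\operatorname{Var}(X_{ij}\mid\mathcal E_{ij})\ge\sigma^2,\qquad \max_{i<j}\left|\operatorname{Corr}(X_{ij},X_{ji}\mid\mathcal E_{ij})\right|\le\rho$$ for some $\rho<1$. Here conditioning on $\mathcal E_{ij}$ means taking expectations under the probability measure $\mathbb P(\,\cdot\mid\mathcal E_{ij})$, and for complex random variables $\operatorname{Var}(\xi)=\mathbb E|\xi-\mathbb E\xi|^2$ and $\operatorname{Corr}(\xi,\psi)=\mathbb E\big[(\xi-\mathbb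 E\xi)\overline{(\psi-\mathbb E\psi)}\big]/\sqrt{\operatorname{Var}(\xi)\operatorname{Var}(\psi)}$. Then for every deterministic $M\in\mathrm{Mat}_n(\mathbb C)$, every $s\ge1$ and every $0<t\le1$, $$\mathbb P\left(s_n(X+M)\le\frac{t}{\sqrt n},\ s_1(X+M)\le s\right)\le C\left(\frac{\log(Cns)}{\sqrt{1-\rho}}\left(\sqrt{s^5t}+\frac1{\sqrt n}\right)\right)^{1/4},$$ where $s_1(A)\ge\dots\ge s_n(A)$ denote the singular values of a matrix $A\in\mathrm{Mat}_n(\mathbb C)$. -/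

import Mathlib

open MeasureTheory ProbabilityTheory

noncomputable section

namespace EllipticLSV

/-- The `k`-th largest singular value `s_k(A)` of a square complex matrix, for `1 ≤ k ≤ n`
(Mathlib numbers the singular values, in decreasing order, from `0`). -/
def singVal {n : ℕ} (A : Matrix (Fin n) (Fin n) ℂ) (k : ℕ) : ℝ :=
  (Matrix.toEuclideanLin A).singularValues (k - 1)

variable {Ω : Type*} [MeasurableSpace Ω]

/-- Variance `E|ξ - Eξ|²` of a complex random variable. -/
def cvar (μ : Measure Ω) (ξ : Ω → ℂ) : ℝ :=
  ∫ ω, ‖ξ ω - ∫ ω', ξ ω' ∂μ‖ ^ 2 ∂μ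

/-- Covariance `E[(ξ - Eξ) conj(ψ - Eψ)]` of two complex random variables. -/
def ccov (μ : Measure Ω) (ξ ψ : Ω → ℂ) : ℂ :=
  ∫ ω, (ξ ω - ∫ ω', ξ ω' ∂μ) * (starRingEnd ℂ) (ψ ω - ∫ ω', ψ ω' ∂μ) ∂μ

/-- Correlation of two complex random variables. -/
def ccorr (μ : Measure Ω) (ξ ψ : Ω → ℂ) : ℂ :=
  ccov μ ξ ψ / (√(cvar μ ξ * cvar μ ψ) : ℝ)

/-- The truncation event `{|X_ij| ≤ a, |X_ji| ≤ a}`. -/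
def truncEvent {n : ℕ} (X : Ω → Matrix (Fin n) (Fin n) ℂ) (a : ℝ) (i j : Fin n) : Set Ω :=
  {ω | ‖X ω i j‖ ≤ a ∧ ‖X ω j i‖ ≤ a}

/-- Assumptions on the random matrix `X`. Conditioning on an event `E` of positive probability means
passing to the conditional measure `μ[|E]`. -/
structure IsEllipticTruncated {n : ℕ} (μ : Measure Ω) (X : Ω → Matrix (Fin n) (Fin n) ℂ)
    (a b σ ρ : ℝ) : Prop where
  /-- the entries are random variables -/
  measurable : ∀ i j, Measurable fun ω => X ω i j
  /-- the pairs `(X_ij, X_ji)`, `i < j`, are independent -/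
  indep_pairs : iIndepFun
    (fun (p : {p : Fin n × Fin n // p.1 < p.2}) ω => (X ω p.1.1 p.1.2, X ω p.1.2 p.1.1)) μ
  /-- the diagonal is independent of the off-diagonal entries -/
  indep_diag : IndepFun (fun ω (i : Fin n) => X ω i i)
    (fun ω (p : {p : Fin n × Fin n // p.1 ≠ p.2}) => X ω p.1.1 p.1.2) μ
  /-- the truncation events have probability at least `b` -/
  prob_ge : ∀ i j, i < j → b ≤ μ.real (truncEvent X a i j)
  /-- the conditional variances are at least `σ²` -/
  var_ge : ∀ i j, i ≠ j → σ ^ 2 ≤ cvar μ[|truncEvent X a i j] (fun ω => X ω i j)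
  /-- the conditional correlations are at most `ρ` in modulus -/
  corr_le : ∀ i j, i < j →
    ‖ccorr μ[|truncEvent X a i j] (fun ω => X ω i j) (fun ω => X ω j i)‖ ≤ ρ

end EllipticLSV

end

open MeasureTheory ProbabilityTheory
set_option linter.unusedSectionVars false

/-! The diagonal is independent of the rest, so it can be frozen and absorbed into `M`; what remains
is a matrix made of independent pairs. Truncation turns the hypotheses into `PairLaw`: two
independent copies of a pair differ, coordinate by coordinate, at a fixed scale with fixed
probability, and every combination αξ + βψ is spread at scale of order √(1-ρ) max(|α|, |β|) with
probability p₁ of order 1-ρ (`pairLaw_map`). Write A = X + M.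

Sparse vectors (`exists_pi_not_good_le`). Exchanging two copies of each pair by fair coins, when
both are truncated, writes the matrix as a deterministic matrix plus a bounded sign matrix. If x is
supported on T, the rows outside T act on x independently, and a Laplace transform makes a short
image exponentially unlikely. A net of such x and a union over T follow; the net is adapted to the
deterministic part, so no bound on that part is needed. Off an exponentially small event, A and its
transpose are thus bounded below by r₀√n on δn-sparse vectors, even after discarding the rows of the
support. Hence a unit vector with small image has a positive proportion of coordinates of size at
least θ, of order 1/s (`two_mul_le_card_spread`).

Spread vectors. A nearly null unit vector x has |x_k| ≥ θ for at least 2h indices k, with h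
proportional to n, so double counting over k costs only a constant factor (`pi_nullEvent_le`). For
fixed k, divide by x_k and condition on the minor B without row and column k. With Y and Z the row
and the column, near nullity forces |A_kk - Yᵀ B⁻¹ Z| to be small compared with 1 + s‖B⁻¹‖, or a
linear form in Z to be small if B is singular (`pi_border_le`). Resampling h coordinates twice and
subtracting turns the bilinear form into a linear form in the other pairs, with coefficients B⁻¹z
where z lives on the resampled set. This vector is itself spread, because B maps it to a vector with
small support. Littlewood-Offord estimates then apply (`pi_bilinear_smallBall_le`).

Littlewood-Offord gives order (n p₁)^(-1/2) and decoupling costs a square root. The outcome is of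
order (n(1-ρ))^(-1/4) as long as s⁵t ≤ c τ₁, with τ₁ of order √(1-ρ); otherwise the claimed bound
exceeds 1. The logarithm is used only through being at least 1. -/

namespace EllipticLSV


/-! ### Product measures: resampling, decoupling, Chernoff bound. -/

section PiMeasure

lemma measurable_piecewise {J 𝒳 : Type*} [DecidableEq J] [MeasurableSpace 𝒳] (I : Finset J) :
    Measurable fun p : (J → 𝒳) × (J → 𝒳) => I.piecewise p.1 p.2 := by
  refine measurable_pi_lambda _ fun j => ?_
  by_cases hj : j ∈ I
  · simp only [Finset.piecewise, hj, if_true]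
    exact (measurable_pi_apply j).comp measurable_fst
  · simp only [Finset.piecewise, hj, if_false]
    exact (measurable_pi_apply j).comp measurable_snd

variable {J 𝒳 : Type*} [Fintype J] [DecidableEq J] [MeasurableSpace 𝒳]
  (ν : J → Measure 𝒳) [∀ j, IsProbabilityMeasure (ν j)]

/-- Resampling some coordinates of a vector with independent coordinates preserves its law. -/
lemma map_piecewise_prod_pi (I : Finset J) :
    ((Measure.pi ν).prod (Measure.pi ν)).map (fun p => I.piecewise p.1 p.2) = Measure.pi ν := by
  refine (Measure.pi_eq fun s hs => ?_).symm
  rw [Measure.map_apply (measurable_piecewise I) (.univ_pi hs)]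
  have : (fun p : (J → 𝒳) × (J → 𝒳) => I.piecewise p.1 p.2) ⁻¹' (Set.univ.pi s) =
      (Set.univ.pi fun j => if j ∈ I then s j else Set.univ) ×ˢ
        (Set.univ.pi fun j => if j ∈ I then Set.univ else s j) := by
    ext p
    simp only [Set.mem_preimage, Set.mem_pi, Set.mem_univ, forall_true_left, Set.mem_prod,
      ← forall_and, Finset.piecewise]
    refine forall_congr' fun j => ?_
    by_cases hj : j ∈ I <;> simp [hj]
  rw [this, Measure.prod_prod, Measure.pi_pi, Measure.pi_pi, ← Finset.prod_mul_distrib]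
  refine Finset.prod_congr rfl fun j _ => ?_
  by_cases hj : j ∈ I <;> simp [hj]

/-- Under the mixture of two independent copies along `I`, the first factor sees only the first copy
and the second factor only the second. -/
lemma integral_pi_mul_of_dependsOn {f g : (J → 𝒳) → ℝ} (I : Finset J)
    (hf : Measurable f) (hg : Measurable g) (hfI : DependsOn f (I : Set J))
    (hgI : DependsOn g ((I : Set J)ᶜ)) :
    ∫ w, f w * g w ∂Measure.pi ν = (∫ w, f w ∂Measure.pi ν) * ∫ w, g w ∂Measure.pi ν := by
  conv_lhs => rw [← map_piecewise_prod_pi ν I]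
  rw [integral_map (f := fun w => f w * g w) (measurable_piecewise I).aemeasurable
    (hf.mul hg).aestronglyMeasurable,
    ← integral_prod_mul]
  refine integral_congr_ae (Filter.Eventually.of_forall fun p => ?_)
  have h1 : f (I.piecewise p.1 p.2) = f p.1 := hfI fun j hj => by simp [Finset.mem_coe.1 hj]
  have h2 : g (I.piecewise p.1 p.2) = g p.2 := hgI fun j hj => by
    have : j ∉ I := fun h => hj (Finset.mem_coe.2 h)
    simp [this]
  simp [h1, h2]

lemma integral_pi_prod_of_dependsOn {K : Type*} [DecidableEq K] (s : Finset K)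
    (S : K → Finset J) (hS : (s : Set K).PairwiseDisjoint S) (f : K → (J → 𝒳) → ℝ)
    (hf : ∀ k, Measurable (f k)) (hfS : ∀ k, DependsOn (f k) (S k : Set J)) :
    ∫ w, ∏ k ∈ s, f k w ∂Measure.pi ν = ∏ k ∈ s, ∫ w, f k w ∂Measure.pi ν := by
  induction s using Finset.induction_on with
  | empty => simp
  | insert k s hk ih =>
    simp only [Finset.prod_insert hk]
    rw [integral_pi_mul_of_dependsOn ν (S k) (hf k) (Finset.measurable_fun_prod _ fun k _ => hf k)
      (hfS k), ih (hS.subset (by simp))]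
    intro w w' h
    refine Finset.prod_congr rfl fun l hl => hfS l fun j hj => h j fun hjk => ?_
    have hne : k ≠ l := fun h => hk (h ▸ hl)
    exact Finset.disjoint_left.1 (hS (by simp) (by simp [hl]) hne) hjk hj

/-- To bound the probability of an event, it is enough to bound it conditionally on some of the
coordinates. -/
lemma pi_le_of_forall_piecewise (I : Finset J) {F : Set (J → 𝒳)} (hF : MeasurableSet F)
    {q : ENNReal} (h : ∀ w', Measure.pi ν {w | I.piecewise w w' ∈ F} ≤ q) :
    Measure.pi ν F ≤ q := by
  rw [← map_piecewise_prod_pi ν I, Measure.map_apply (measurable_piecewise I) hF,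
    Measure.prod_apply_symm (measurable_piecewise I hF)]
  exact (lintegral_mono h).trans (by simp)

/-- Decoupling: resample the coordinates outside `I` twice. -/
lemma sq_pi_le_of_decoupling (I : Finset J) {F : Set (J → 𝒳)} (hF : MeasurableSet F) :
    (Measure.pi ν F) ^ 2 ≤ ∫⁻ p, Measure.pi ν
      {w | I.piecewise w p.1 ∈ F ∧ I.piecewise w p.2 ∈ F} ∂(Measure.pi ν).prod (Measure.pi ν) := by
  set P := Measure.pi ν
  have hm := measurable_piecewise (𝒳 := 𝒳) I
  have hh : Measurable fun w => P {w' | I.piecewise w w' ∈ F} :=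
    measurable_measure_prodMk_left (hm hF)
  have h1 : P F = ∫⁻ w, P {w' | I.piecewise w w' ∈ F} ∂P := by
    conv_lhs => rw [show P = _ from (map_piecewise_prod_pi ν I).symm]
    rw [Measure.map_apply hm hF, Measure.prod_apply (hm hF)]
    rfl
  -- Cauchy-Schwarz for the conditional probability given the coordinates in `I`. Its square is the
  -- probability that two independent resamplings both land in `F`.
  have h2 : (∫⁻ w, P {w' | I.piecewise w w' ∈ F} ∂P) ^ 2 ≤
      ∫⁻ w, P {w' | I.piecewise w w' ∈ F} ^ 2 ∂P := by
    have := ENNReal.lintegral_mul_le_Lp_mul_Lq P Real.HolderConjugate.two_two hh.aemeasurable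
      (aemeasurable_const (b := (1 : ENNReal)))
    simp only [Pi.mul_apply, mul_one, ENNReal.one_rpow, lintegral_const, measure_univ] at this
    calc _ ≤ ((∫⁻ w, P {w' | I.piecewise w w' ∈ F} ^ (2 : ℝ) ∂P) ^ (1 / 2 : ℝ)) ^ 2 := by gcongr
      _ = _ := by
        rw [← ENNReal.rpow_natCast, ← ENNReal.rpow_mul]
        norm_num
  rw [h1]
  refine h2.trans ?_
  have hA : MeasurableSet {q : (J → 𝒳) × ((J → 𝒳) × (J → 𝒳)) |
      I.piecewise q.1 q.2.1 ∈ F ∧ I.piecewise q.1 q.2.2 ∈ F} :=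
    ((hm.comp (measurable_fst.prodMk (measurable_fst.comp measurable_snd))) hF).inter
      ((hm.comp (measurable_fst.prodMk (measurable_snd.comp measurable_snd))) hF)
  have h3 := Measure.prod_apply (μ := P) (ν := P.prod P) hA
  have h4 := Measure.prod_apply_symm (μ := P) (ν := P.prod P) hA
  refine le_of_eq ?_
  calc _ = ∫⁻ w, (P.prod P) ({w' | I.piecewise w w' ∈ F} ×ˢ {w' | I.piecewise w w' ∈ F}) ∂P := by
        simp [Measure.prod_prod, sq]
    _ = _ := h3.symm.trans h4

/-- Chernoff bound for the number of successes in independent trials. -/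
lemma pi_card_hits_le (K : Finset J) (S : J → Set 𝒳) (hS : ∀ j, MeasurableSet (S j))
    [∀ j, DecidablePred (· ∈ S j)] {p : ℝ} (hp : ∀ j ∈ K, p ≤ (ν j).real (S j)) :
    (Measure.pi ν).real {w | ((K.filter fun j => w j ∈ S j).card : ℝ) ≤ K.card * p / 4} ≤
      Real.exp (-(K.card * p / 4)) := by
  set P := Measure.pi ν
  -- The product of the `f j` is exp(-number of hits). Each factor has mean at most 1 - (1 - 1/e)p ≤
  -- exp(-p/2), and Markov at level exp(-|K|p/4) keeps half of the exponent.
  let f : J → 𝒳 → ℝ := fun j x => if j ∈ K ∧ x ∈ S j then Real.exp (-1) else 1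
  have hfm : ∀ j, Measurable (f j) := fun j => by
    by_cases hj : j ∈ K
    · simp only [f, hj, true_and]
      exact Measurable.ite (hS j) measurable_const measurable_const
    · simp [f, hj]
  have hfi : ∀ j ∈ K, ∫ x, f j x ∂ν j ≤ Real.exp (-(p / 2)) := by
    intro j hj
    have h1 : f j = fun x => 1 - (1 - Real.exp (-1)) * (S j).indicator 1 x := by
      funext x
      by_cases hx : x ∈ S j <;> simp [f, hj, hx]
    have hI : Integrable ((S j).indicator (1 : 𝒳 → ℝ)) (ν j) :=
      (integrable_indicator_iff (hS j)).2 (integrable_const (1 : ℝ)).integrableOn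
    rw [h1]
    rw [integral_sub (integrable_const _) (hI.const_mul _),
      integral_const_mul, integral_indicator_one (hS j)]
    have h2 : Real.exp (-1) ≤ 1 / 2 := by
      rw [Real.exp_neg, inv_le_comm₀ (Real.exp_pos _) (by norm_num)]
      have := Real.add_one_le_exp 1
      norm_num at this ⊢
      linarith
    have h3 := hp j hj
    have h4 := Real.add_one_le_exp (-(p / 2))
    have h5 : 0 ≤ (ν j).real (S j) := measureReal_nonneg
    simp only [integral_const, probReal_univ, smul_eq_mul, one_mul]
    nlinarith
  have hfi' : ∀ j ∉ K, ∫ x, f j x ∂ν j = 1 := by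
    intro j hj
    simp [f, hj]
  have hprod : ∀ w : J → 𝒳, ∏ j, f j (w j) =
      Real.exp (-((K.filter fun j => w j ∈ S j).card : ℝ)) := by
    intro w
    have : ∀ j, f j (w j) = if j ∈ K.filter fun j => w j ∈ S j then Real.exp (-1) else 1 :=
      fun j => by simp [f]
    simp only [this]
    rw [Finset.prod_ite_mem, Finset.univ_inter, Finset.prod_const, ← Real.exp_nat_mul]
    simp
  have hmean : ∫ w, ∏ j, f j (w j) ∂P ≤ Real.exp (-(K.card * p / 2)) := by
    rw [integral_fintype_prod_eq_prod]
    have : ∀ j, ∫ x, f j x ∂ν j ≤ if j ∈ K then Real.exp (-(p / 2)) else 1 := by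
      intro j
      split_ifs with hj
      · exact hfi j hj
      · exact (hfi' j hj).le
    refine (Finset.prod_le_prod (fun j _ => integral_nonneg fun x => ?_)
      fun j _ => this j).trans ?_
    · simp only [f]; split_ifs <;> positivity
    · rw [Finset.prod_ite_mem, Finset.univ_inter, Finset.prod_const, ← Real.exp_nat_mul]
      exact le_of_eq (by ring_nf)
  have hintegrable : Integrable (fun w => ∏ j, f j (w j)) P := by
    refine Integrable.of_bound (C := 1) (Finset.measurable_fun_prod _ fun j _ =>
      (hfm j).comp (measurable_pi_apply j)).aestronglyMeasurable
      (Filter.Eventually.of_forall fun w => ?_)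
    rw [hprod, Real.norm_eq_abs, abs_of_pos (Real.exp_pos _)]
    exact Real.exp_le_one_iff.2 (by simp)
  have hmk := mul_meas_ge_le_integral_of_nonneg (μ := P) (f := fun w => ∏ j, f j (w j))
    (Filter.Eventually.of_forall fun w => by simp only [hprod]; positivity) hintegrable
    (Real.exp (-(K.card * p / 4)))
  have hset : {w : J → 𝒳 | ((K.filter fun j => w j ∈ S j).card : ℝ) ≤ K.card * p / 4} ⊆
      {w | Real.exp (-(K.card * p / 4)) ≤ ∏ j, f j (w j)} := by
    intro w hw
    simp only [Set.mem_ofPred_eq, hprod] at hw ⊢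
    exact Real.exp_le_exp.2 (neg_le_neg hw)
  refine (measureReal_mono hset).trans ?_
  rw [← mul_le_mul_iff_right₀ (Real.exp_pos (-(K.card * p / 4)))]
  refine (hmk.trans hmean).trans (le_of_eq ?_)
  rw [← Real.exp_add]
  ring_nf

end PiMeasure


/-! ### Fair coins and random signs. -/

section Signs

/-- The law of a fair coin. -/
noncomputable def coin : Measure Bool := (2⁻¹ : ENNReal) • (Measure.dirac true + Measure.dirac false)

instance : IsProbabilityMeasure coin := ⟨by
  simp only [coin, Measure.smul_apply, Measure.add_apply, measure_univ, smul_eq_mul]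
  rw [one_add_one_eq_two]
  exact ENNReal.inv_mul_cancel (by simp) (by simp)⟩

lemma coin_singleton (b : Bool) : coin {b} = 2⁻¹ := by
  cases b <;> simp [coin]

lemma integral_coin (f : Bool → ℝ) : ∫ b, f b ∂coin = (f true + f false) / 2 := by
  rw [coin, integral_smul_measure, integral_add_measure (by simp) (by simp)]
  simp
  ring

lemma coin_map_not : coin.map not = coin := by
  refine Measure.ext_of_singleton fun b => ?_
  rw [Measure.map_apply (by fun_prop) (by simp)]
  have : not ⁻¹' {b} = {!b} := by ext c; cases b <;> cases c <;> simp
  rw [this, coin_singleton, coin_singleton]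

/-- The sign `±1` attached to a Boolean. -/
def sg (b : Bool) : ℝ := if b then 1 else -1

@[simp] lemma sg_true : sg true = 1 := rfl
@[simp] lemma sg_false : sg false = -1 := rfl

lemma sg_not (b : Bool) : sg (!b) = -sg b := by cases b <;> simp

lemma abs_sg (b : Bool) : |sg b| = 1 := by cases b <;> simp

/-- The law of independent fair coins. -/
noncomputable abbrev coins (J : Type*) [Fintype J] : Measure (J → Bool) := Measure.pi fun _ => coin

lemma coins_real_apply {J : Type*} [Fintype J] [DecidableEq J] (S : Set (J → Bool))
    [DecidablePred (· ∈ S)] :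
    (coins J).real S = (Finset.univ.filter (· ∈ S)).card / 2 ^ Fintype.card J := by
  have h : ∀ ε : J → Bool, (coins J).real {ε} = (2 ^ Fintype.card J)⁻¹ := fun ε => by
    rw [measureReal_def, coins, Measure.pi_singleton]
    simp [coin_singleton, ENNReal.toReal_pow]
  have hS : S = ((Finset.univ.filter (· ∈ S) : Finset (J → Bool)) : Set (J → Bool)) := by
    ext; simp
  conv_lhs => rw [hS]
  rw [← sum_measureReal_singleton]
  simp [h, div_eq_mul_inv]

end Signs

/-! ### Symmetrization by exchanging two independent copies. -/

section Symmetrization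

/-- Exchange the two points if the coin says so and both of them lie in `E`. -/
def exch {𝒳 : Type*} (E : Set 𝒳) [DecidablePred (· ∈ E)] (b : Bool) (x : 𝒳 × 𝒳) : 𝒳 :=
  if b = true ∧ x.1 ∈ E ∧ x.2 ∈ E then x.2 else x.1

variable {𝒳 : Type*} [MeasurableSpace 𝒳]

lemma measurable_exch {E : Set 𝒳} [DecidablePred (· ∈ E)] (hE : MeasurableSet E) (b : Bool) :
    Measurable (exch E b) := by
  refine Measurable.ite ?_ measurable_snd measurable_fst
  exact (MeasurableSet.const _).inter ((measurable_fst hE).inter (measurable_snd hE))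

/-- On `E ×ˢ E` the exchange is the swap, which preserves both this set and the product measure;
elsewhere it is the first projection. -/
lemma map_exch {E : Set 𝒳} [DecidablePred (· ∈ E)] (hE : MeasurableSet E) (b : Bool)
    (ν : Measure 𝒳) [IsProbabilityMeasure ν] : (ν.prod ν).map (exch E b) = ν := by
  cases b
  · have : exch E false = Prod.fst := by funext x; simp [exch]
    rw [this, Measure.map_fst_prod]
    simp
  ext A hA
  rw [Measure.map_apply (measurable_exch hE _) hA]
  set Q : Set (𝒳 × 𝒳) := E ×ˢ E
  have hQ : MeasurableSet Q := hE.prod hE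
  have h1 : exch E true ⁻¹' A ∩ Q = Prod.swap ⁻¹' (Prod.fst ⁻¹' A ∩ Q) := by
    ext x
    simp only [exch, Set.mem_inter_iff, Set.mem_preimage, Q, Set.mem_prod, Prod.fst_swap,
      Prod.snd_swap]
    constructor
    · rintro ⟨h, h1, h2⟩
      simp [h1, h2] at h
      exact ⟨h, h2, h1⟩
    · rintro ⟨h, h1, h2⟩
      simp [h1, h2, h]
  have h2 : exch E true ⁻¹' A \ Q = Prod.fst ⁻¹' A \ Q := by
    ext x
    simp only [exch, Set.mem_sdiff, Set.mem_preimage, Q, Set.mem_prod]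
    refine and_congr_left fun h => ?_
    simp [h]
  have h3 : (ν.prod ν) (Prod.swap ⁻¹' (Prod.fst ⁻¹' A ∩ Q)) = (ν.prod ν) (Prod.fst ⁻¹' A ∩ Q) := by
    conv_rhs => rw [← Measure.prod_swap]
    rw [Measure.map_apply measurable_swap ((measurable_fst hA).inter hQ)]
  rw [← measure_inter_add_sdiff _ hQ, h1, h2, h3, measure_inter_add_sdiff _ hQ,
    ← Measure.map_apply measurable_fst hA, Measure.map_fst_prod]
  simp

variable {J : Type*} [Fintype J] (ν : J → Measure 𝒳)
  [∀ j, IsProbabilityMeasure (ν j)]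

/-- Symmetrization: a vector with independent coordinates has the law of a random mixture of
two independent copies. -/
lemma pi_apply_eq_lintegral_coins (E : J → Set 𝒳) [∀ j, DecidablePred (· ∈ E j)]
    (hE : ∀ j, MeasurableSet (E j)) {F : Set (J → 𝒳)} (hF : MeasurableSet F) :
    Measure.pi ν F = ∫⁻ w, coins J {ε | (fun j => exch (E j) (ε j) (w j)) ∈ F}
      ∂Measure.pi fun j => (ν j).prod (ν j) := by
  have hmap : ∀ ε : J → Bool, (Measure.pi fun j => (ν j).prod (ν j)).map
      (fun w j => exch (E j) (ε j) (w j)) = Measure.pi ν := by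
    intro ε
    have : ∀ j, ((ν j).prod (ν j)).map (exch (E j) (ε j)) = ν j := fun j => map_exch (hE j) _ _
    have hs : ∀ j, SigmaFinite (((ν j).prod (ν j)).map (exch (E j) (ε j))) := fun j => by
      rw [this]; infer_instance
    rw [Measure.pi_map_pi fun j => (measurable_exch (hE j) _).aemeasurable]
    simp only [this]
  have hm : ∀ ε : J → Bool, Measurable fun (w : J → 𝒳 × 𝒳) j => exch (E j) (ε j) (w j) :=
    fun ε => measurable_pi_lambda _ fun j =>
      (measurable_exch (hE j) _).comp (measurable_pi_apply j)
  have hA : MeasurableSet {q : (J → 𝒳 × 𝒳) × (J → Bool) |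
      (fun j => exch (E j) (q.2 j) (q.1 j)) ∈ F} := by
    have : Measurable fun q : (J → 𝒳 × 𝒳) × (J → Bool) => fun j => exch (E j) (q.2 j) (q.1 j) :=
      measurable_from_prod_countable_left fun ε => hm ε
    exact this hF
  have h1 := Measure.prod_apply (μ := Measure.pi fun j => (ν j).prod (ν j)) (ν := coins J) hA
  have h2 := Measure.prod_apply_symm (μ := Measure.pi fun j => (ν j).prod (ν j)) (ν := coins J) hA
  refine Eq.trans ?_ (h2.symm.trans h1)
  have : ∀ ε : J → Bool, (Measure.pi fun j => (ν j).prod (ν j))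
      ((fun w => (w, ε)) ⁻¹' {q : (J → 𝒳 × 𝒳) × (J → Bool) |
        (fun j => exch (E j) (q.2 j) (q.1 j)) ∈ F}) = Measure.pi ν F := fun ε => by
    conv_rhs => rw [← hmap ε]
    rw [Measure.map_apply (hm ε) hF]
    rfl
  simp only [this]
  simp

lemma map_pi_comp_injective {K : Type*} [Fintype K] (e : K → J) (he : e.Injective) :
    (Measure.pi ν).map (fun w k => w (e k)) = Measure.pi fun k => ν (e k) := by
  have h := (iIndepFun_pi (μ := ν) (X := fun _ x => x) fun _ => aemeasurable_id).precomp he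
  rw [h.map_fun_eq_pi_map fun k => (measurable_pi_apply _).aemeasurable]
  congr with k : 1
  exact (measurePreserving_eval ν (e k)).map_eq

end Symmetrization


/-! ### Littlewood-Offord inequalities and small ball probabilities. -/

section LittlewoodOfford

/-- Induction along the recursion for central binomial coefficients; the step is (2j+1)(2j+3) ≤
4(j+1)². -/
lemma sq_centralBinom_mul_le (j : ℕ) : j.centralBinom ^ 2 * (2 * j + 1) ≤ 16 ^ j := by
  induction j with
  | zero => simp
  | succ j ih =>
    have h := Nat.succ_mul_centralBinom_succ j
    have h2 : (j + 1) ^ 2 * ((j + 1).centralBinom ^ 2 * (2 * (j + 1) + 1)) ≤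
        (j + 1) ^ 2 * 16 ^ (j + 1) := by
      calc (j + 1) ^ 2 * ((j + 1).centralBinom ^ 2 * (2 * (j + 1) + 1))
          = ((j + 1) * (j + 1).centralBinom) ^ 2 * (2 * j + 3) := by ring
        _ = (2 * (2 * j + 1) * j.centralBinom) ^ 2 * (2 * j + 3) := by rw [h]
        _ = (4 * ((2 * j + 1) * (2 * j + 3))) * (j.centralBinom ^ 2 * (2 * j + 1)) := by ring
        _ ≤ (16 * (j + 1) ^ 2) * 16 ^ j := by
            refine Nat.mul_le_mul ?_ ih
            nlinarith
        _ = _ := by ring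
    exact Nat.le_of_mul_le_mul_left h2 (by positivity)

lemma sq_choose_half_mul_le (k : ℕ) : k.choose (k / 2) ^ 2 * (k + 1) ≤ 4 ^ k := by
  rcases Nat.even_or_odd' k with ⟨j, rfl | rfl⟩
  · have := sq_centralBinom_mul_le j
    rw [Nat.mul_div_cancel_left _ (by norm_num), ← Nat.centralBinom_eq_two_mul_choose, pow_mul]
    simpa using this
  · have h := sq_centralBinom_mul_le (j + 1)
    have h1 : (j + 1).centralBinom = 2 * (2 * j + 1).choose j := by
      rw [Nat.centralBinom_eq_two_mul_choose, show 2 * (j + 1) = 2 * j + 1 + 1 by ring,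
        Nat.choose_succ_succ, Nat.succ_eq_add_one, Nat.choose_symm_half]
      ring
    have h2 : (2 * j + 1) / 2 = j := by omega
    have h3 : (4 : ℕ) ^ (2 * j + 1) * 4 = 16 ^ (j + 1) := by
      rw [← pow_succ, show 2 * j + 1 + 1 = 2 * (j + 1) by ring, pow_mul]; norm_num
    rw [h1] at h
    rw [h2]
    nlinarith [sq_nonneg ((2 * j + 1).choose j)]

/-- The Erdős form of the Littlewood-Offord inequality. -/
lemma coins_littlewoodOfford_univ {J : Type*} [Fintype J] (c : J → ℝ)
    {τ : ℝ} (hc : ∀ j, τ ≤ |c j|) (x : ℝ) :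
    (coins J).real {ε | |∑ j, sg (ε j) * c j - x| < τ} ≤ 1 / √(Fintype.card J + 1) := by
  classical
  rcases le_or_gt τ 0 with hτ | hτ
  · have : {ε : J → Bool | |∑ j, sg (ε j) * c j - x| < τ} = ∅ := by
      ext ε
      simpa using hτ.trans (abs_nonneg _)
    rw [this]
    simp
  -- A sign pattern is encoded by the set of indices where its sign agrees with that of `c j`.
  -- Adding an index raises `S` by 2|c i| ≥ 2τ, so the sets with `S` within τ of `x` form an
  -- antichain, and Sperner's theorem counts them.
  let S : Finset J → ℝ := fun A => ∑ j, if j ∈ A then |c j| else -|c j|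
  let 𝒜 : Finset (Finset J) := Finset.univ.filter fun A => |S A - x| < τ
  have hanti : IsAntichain (· ⊆ ·) (SetLike.coe 𝒜) := by
    intro A hA B hB hne hAB
    have hA' : |S A - x| < τ := by simpa [𝒜] using hA
    have hB' : |S B - x| < τ := by simpa [𝒜] using hB
    obtain ⟨i, hiB, hiA⟩ := Finset.exists_of_ssubset (hAB.ssubset_of_ne hne)
    have hd : 2 * |c i| ≤ S B - S A := by
      simp only [S, ← Finset.sum_sub_distrib]
      refine le_trans (le_of_eq ?_) (Finset.single_le_sum (f := fun j =>
        (if j ∈ B then |c j| else -|c j|) - if j ∈ A then |c j| else -|c j|) ?_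
        (Finset.mem_univ i))
      · simp [hiB, hiA]; ring
      · intro j _
        by_cases hjA : j ∈ A
        · simp [hjA, hAB hjA]
        · by_cases hjB : j ∈ B <;> simp [hjA, hjB]
    have := hc i
    rw [abs_lt] at hA' hB'
    linarith [hA'.1, hB'.2]
  have hcard := hanti.sperner
  have hle : (Finset.univ.filter (· ∈ {ε : J → Bool | |∑ j, sg (ε j) * c j - x| < τ})).card ≤
      𝒜.card := by
    refine Finset.card_le_card_of_injOn
      (fun ε => Finset.univ.filter fun j => ε j = decide (0 < c j)) ?_ ?_
    · intro ε hε
      have hε' : |∑ j, sg (ε j) * c j - x| < τ := by simpa using hε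
      have : S (Finset.univ.filter fun j => ε j = decide (0 < c j)) = ∑ j, sg (ε j) * c j := by
        refine Finset.sum_congr rfl fun j _ => ?_
        by_cases hj : 0 < c j
        · cases h : ε j <;> simp [h, hj, abs_of_pos hj]
        · cases h : ε j <;> simp [h, hj, abs_of_nonpos (not_lt.1 hj)]
      simpa [𝒜, this] using hε'
    · intro ε _ ε' _ h
      funext j
      have := Finset.ext_iff.1 h j
      simp only [Finset.mem_filter, Finset.mem_univ, true_and] at this
      cases h1 : ε j <;> cases h2 : ε' j <;> cases h3 : decide (0 < c j) <;> simp_all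
  rw [coins_real_apply, le_div_iff₀ (by positivity), div_mul_eq_mul_div, div_le_one (by positivity)]
  have h1 : ((Finset.univ.filter
      (· ∈ {ε : J → Bool | |∑ j, sg (ε j) * c j - x| < τ})).card : ℝ) ≤
      (Fintype.card J).choose (Fintype.card J / 2) := by exact_mod_cast hle.trans hcard
  refine (mul_le_mul_of_nonneg_right h1 (by positivity)).trans ?_
  refine abs_le_of_sq_le_sq' ?_ (by positivity) |>.2
  rw [mul_pow, Real.sq_sqrt (by positivity), ← pow_mul, mul_comm _ 2, pow_mul]
  have := sq_choose_half_mul_le (Fintype.card J)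
  norm_num
  exact_mod_cast this

lemma coins_littlewoodOfford {J : Type*} [Fintype J] (c : J → ℝ) (K : Finset J)
    {τ : ℝ} (hc : ∀ j ∈ K, τ ≤ |c j|) (x : ℝ) :
    (coins J).real {ε | |∑ j, sg (ε j) * c j - x| < τ} ≤ 1 / √(K.card + 1) := by
  classical
  refine ENNReal.toReal_le_of_le_ofReal (by positivity)
    (pi_le_of_forall_piecewise _ K (Set.Finite.measurableSet (Set.toFinite _)) fun ε' => ?_)
  have hset : {ε | K.piecewise ε ε' ∈ {ε : J → Bool | |∑ j, sg (ε j) * c j - x| < τ}} =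
      (fun ε (k : K) => ε k) ⁻¹' {η : K → Bool | |∑ k, sg (η k) * c k -
        (x - ∑ j ∈ Kᶜ, sg (ε' j) * c j)| < τ} := by
    ext ε
    have : ∑ j, sg (K.piecewise ε ε' j) * c j =
        ∑ k : K, sg (ε k) * c k + ∑ j ∈ Kᶜ, sg (ε' j) * c j := by
      rw [← Finset.sum_add_sum_compl K, ← Finset.sum_coe_sort K]
      congr 1
      · exact Finset.sum_congr rfl fun k _ => by simp
      · refine Finset.sum_congr rfl fun j hj => ?_
        simp [Finset.mem_compl.1 hj]
    simp only [Set.mem_ofPred_eq, Set.mem_preimage, this]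
    ring_nf
  rw [hset, ← Measure.map_apply (by fun_prop) (Set.Finite.measurableSet (Set.toFinite _)),
    map_pi_comp_injective (fun _ => coin) _ Subtype.val_injective]
  have h := coins_littlewoodOfford_univ (fun k : K => c k) (fun k => hc k k.2)
    (x - ∑ j ∈ Kᶜ, sg (ε' j) * c j)
  rw [Fintype.card_coe] at h
  rw [← ofReal_measureReal]
  exact ENNReal.ofReal_le_ofReal h

/-- Each coefficient has a real or an imaginary part of size τ/2, so one of the two alternatives
holds for at least half of `K`. -/
lemma coins_littlewoodOfford_complex {J : Type*} [Fintype J] (c : J → ℂ) (K : Finset J)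
    {τ : ℝ} (hc : ∀ j ∈ K, τ ≤ ‖c j‖) (x : ℂ) :
    (coins J).real {ε | ‖∑ j, (sg (ε j) : ℂ) * c j - x‖ < τ / 2} ≤ 1 / √(K.card / 2 + 1) := by
  classical
  let Kr := K.filter fun j => τ / 2 ≤ |(c j).re|
  let Ki := K.filter fun j => τ / 2 ≤ |(c j).im|
  have hcov : K ⊆ Kr ∪ Ki := by
    intro j hj
    by_contra h
    simp only [Kr, Ki, Finset.mem_union, Finset.mem_filter, hj, true_and, not_or, not_le] at h
    have := hc j hj
    have := Complex.norm_le_abs_re_add_abs_im (c j)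
    linarith
  have hcard : (K.card : ℝ) ≤ Kr.card + Ki.card := by
    exact_mod_cast (Finset.card_le_card hcov).trans (Finset.card_union_le _ _)
  rcases le_total (Ki.card : ℝ) Kr.card with h | h
  · refine le_trans (measureReal_mono ?_) ((coins_littlewoodOfford (fun j => (c j).re) Kr
      (τ := τ / 2) (fun j hj => (Finset.mem_filter.1 hj).2) x.re).trans ?_)
    · intro ε hε
      simp only [Set.mem_ofPred_eq] at hε ⊢
      refine lt_of_le_of_lt (le_of_eq ?_) ((Complex.abs_re_le_norm _).trans_lt hε)
      simp
    · gcongr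
      linarith
  · refine le_trans (measureReal_mono ?_) ((coins_littlewoodOfford (fun j => (c j).im) Ki
      (τ := τ / 2) (fun j hj => (Finset.mem_filter.1 hj).2) x.im).trans ?_)
    · intro ε hε
      simp only [Set.mem_ofPred_eq] at hε ⊢
      refine lt_of_le_of_lt (le_of_eq ?_) ((Complex.abs_im_le_norm _).trans_lt hε)
      simp
    · gcongr
      linarith

/-- Anti-concentration of sums of independent complex random variables: a form of the
Kolmogorov-Rogozin inequality. -/
lemma pi_smallBall_le {J 𝒳 : Type*} [Fintype J] [MeasurableSpace 𝒳]
    (ν : J → Measure 𝒳) [∀ j, IsProbabilityMeasure (ν j)] (f : J → 𝒳 → ℂ)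
    (hf : ∀ j, Measurable (f j)) (K : Finset J) {τ p : ℝ} (hp : 0 < p) (hK : K.Nonempty)
    (h : ∀ j ∈ K, p ≤ ((ν j).prod (ν j)).real {x | 2 * τ ≤ ‖f j x.1 - f j x.2‖}) (x : ℂ) :
    (Measure.pi ν).real {w | ‖∑ j, f j (w j) - x‖ < τ / 2} ≤ 5 / √(K.card * p) := by
  classical
  have hu : 0 < K.card * p := mul_pos (by exact_mod_cast hK.card_pos) hp
  set u := K.card * p with hu_def
  set F : Set (J → 𝒳) := {w | ‖∑ j, f j (w j) - x‖ < τ / 2}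
  have hF : MeasurableSet F := measurableSet_lt
    ((Finset.measurable_fun_sum _ fun j _ => (hf j).comp (measurable_pi_apply j)).sub_const x).norm
    measurable_const
  let S : J → Set (𝒳 × 𝒳) := fun j => {x | 2 * τ ≤ ‖f j x.1 - f j x.2‖}
  have hS : ∀ j, MeasurableSet (S j) := fun j => measurableSet_le measurable_const
    (((hf j).comp measurable_fst).sub ((hf j).comp measurable_snd)).norm
  have hch := pi_card_hits_le (fun j => (ν j).prod (ν j)) K S hS h
  rw [← hu_def] at hch
  set T : Set (J → 𝒳 × 𝒳) := {w | ((K.filter fun j => w j ∈ S j).card : ℝ) ≤ u / 4}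
  -- Given the two copies, the sum is a constant plus signs times half differences. Off `T`, more
  -- than u/4 half differences have modulus at least τ, so the sign inequality applies; `T` itself
  -- is rare by Chernoff.
  have key : ∀ w ∉ T, coins J {ε | (fun j => exch Set.univ (ε j) (w j)) ∈ F} ≤
      ENNReal.ofReal (1 / √(u / 8)) := by
    intro w hw
    have hw' : u / 4 < (K.filter fun j => w j ∈ S j).card := by simpa [T] using hw
    have hlo := coins_littlewoodOfford_complex (fun j => (f j (w j).2 - f j (w j).1) / 2)
      (K.filter fun j => w j ∈ S j) (τ := τ) (fun j hj => ?_)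
      (x - ∑ j, (f j (w j).1 + f j (w j).2) / 2)
    · rw [← ofReal_measureReal]
      refine ENNReal.ofReal_le_ofReal (le_trans (le_of_eq ?_) (hlo.trans ?_))
      · congr 1
        ext ε
        have : ∀ j, f j (exch Set.univ (ε j) (w j)) = (sg (ε j) : ℂ) *
            ((f j (w j).2 - f j (w j).1) / 2) + (f j (w j).1 + f j (w j).2) / 2 := by
          intro j
          cases ε j <;> simp [exch] <;> ring
        simp only [Set.mem_ofPred_eq, F, this, Finset.sum_add_distrib]
        ring_nf
      · apply one_div_le_one_div_of_le (by positivity)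
        apply Real.sqrt_le_sqrt
        linarith
    · have : 2 * τ ≤ ‖f j (w j).1 - f j (w j).2‖ := (Finset.mem_filter.1 hj).2
      rw [norm_div, norm_sub_rev]
      norm_num
      linarith
  have hmain : Measure.pi ν F ≤ ENNReal.ofReal (Real.exp (-(u / 4)) + 1 / √(u / 8)) := by
    rw [pi_apply_eq_lintegral_coins ν (fun _ => Set.univ) (fun _ => MeasurableSet.univ) hF]
    calc _ ≤ ∫⁻ w, (T.indicator 1 w + ENNReal.ofReal (1 / √(u / 8)))
          ∂Measure.pi fun j => (ν j).prod (ν j) := by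
          refine lintegral_mono fun w => ?_
          by_cases hw : w ∈ T
          · simp only [hw, Set.indicator_of_mem, Pi.one_apply]
            exact prob_le_one.trans le_self_add
          · exact (key w hw).trans le_add_self
      _ ≤ _ := by
          rw [lintegral_add_right _ measurable_const, ENNReal.ofReal_add (by positivity)
            (by positivity)]
          gcongr
          · refine (lintegral_indicator_one_le T).trans ?_
            rw [← ofReal_measureReal]
            exact ENNReal.ofReal_le_ofReal hch
          · simp
  refine (ENNReal.toReal_le_of_le_ofReal (by positivity) hmain).trans ?_
  have h1 : Real.exp (-(u / 4)) ≤ 2 / √u := by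
    rw [le_div_iff₀ (by positivity)]
    refine abs_le_of_sq_le_sq' ?_ (by norm_num) |>.2
    rw [mul_pow, Real.sq_sqrt hu.le, ← Real.exp_nat_mul]
    have h2 := Real.add_one_le_exp (u / 2)
    have h3 : Real.exp ((2 : ℕ) * -(u / 4)) * Real.exp (u / 2) = 1 := by
      rw [← Real.exp_add]; norm_num; ring
    nlinarith [Real.exp_pos ((2 : ℕ) * -(u / 4))]
  have h2 : 1 / √(u / 8) ≤ 3 / √u := by
    rw [div_le_div_iff₀ (by positivity) (by positivity)]
    refine abs_le_of_sq_le_sq' ?_ (by positivity) |>.2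
    rw [mul_pow, mul_pow, Real.sq_sqrt hu.le, Real.sq_sqrt (by positivity)]
    linarith
  calc _ ≤ 2 / √u + 3 / √u := add_le_add h1 h2
    _ = 5 / √u := by ring

end LittlewoodOfford


/-! ### Euclidean norms of vectors and of their restrictions. -/

section Norm

variable {ι : Type*} [Fintype ι]

/-- The Euclidean norm of a vector. -/
noncomputable def nrm (x : ι → ℂ) : ℝ := ‖(WithLp.toLp 2 x : EuclideanSpace ℂ ι)‖

lemma nrm_sq (x : ι → ℂ) : nrm x ^ 2 = ∑ i, ‖x i‖ ^ 2 := by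
  simp [nrm, EuclideanSpace.norm_sq_eq]

lemma nrm_nonneg (x : ι → ℂ) : 0 ≤ nrm x := norm_nonneg _

lemma nrm_add_le (x y : ι → ℂ) : nrm (x + y) ≤ nrm x + nrm y := by
  simpa [nrm] using norm_add_le (WithLp.toLp 2 x : EuclideanSpace ℂ ι) (WithLp.toLp 2 y)

lemma nrm_sub_le (x y : ι → ℂ) : nrm (x - y) ≤ nrm x + nrm y := by
  simpa [nrm] using norm_sub_le (WithLp.toLp 2 x : EuclideanSpace ℂ ι) (WithLp.toLp 2 y)

lemma nrm_smul (c : ℂ) (x : ι → ℂ) : nrm (c • x) = ‖c‖ * nrm x := by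
  simp [nrm, norm_smul]

@[simp] lemma nrm_zero : nrm (0 : ι → ℂ) = 0 := by simp [nrm]

lemma nrm_eq_zero {x : ι → ℂ} : nrm x = 0 ↔ x = 0 := by simp [nrm]

lemma norm_le_nrm (x : ι → ℂ) (i : ι) : ‖x i‖ ≤ nrm x := by
  refine abs_le_of_sq_le_sq' ?_ (nrm_nonneg x) |>.2
  rw [nrm_sq]
  exact Finset.single_le_sum (f := fun i => ‖x i‖ ^ 2) (fun _ _ => by positivity)
    (Finset.mem_univ i)

lemma continuous_nrm : Continuous (nrm : (ι → ℂ) → ℝ) :=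
  (PiLp.continuous_toLp 2 _).norm

/-- The product is bilinear, without conjugation, so Cauchy-Schwarz is applied to the conjugate of
`x`. -/
lemma norm_dotProduct_le (x y : ι → ℂ) : ‖x ⬝ᵥ y‖ ≤ nrm x * nrm y := by
  have h := norm_inner_le_norm (𝕜 := ℂ) (WithLp.toLp 2 (star x) : EuclideanSpace ℂ ι)
    (WithLp.toLp 2 y)
  have h1 : nrm (star x) = nrm x := by
    rw [← abs_of_nonneg (nrm_nonneg (star x)), ← abs_of_nonneg (nrm_nonneg x), ← sq_eq_sq_iff_abs_eq_abs]
    simp [nrm_sq]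
  rw [EuclideanSpace.inner_eq_star_dotProduct] at h
  simp only [star_star] at h
  rw [dotProduct_comm]
  exact h.trans (le_of_eq (by rw [← h1]; rfl))

variable [DecidableEq ι]

/-- The Euclidean norm of the restriction of a vector to a set of coordinates. -/
noncomputable def nrmOn (S : Finset ι) (x : ι → ℂ) : ℝ := nrm (S.piecewise x 0)

lemma nrmOn_sq (S : Finset ι) (x : ι → ℂ) : nrmOn S x ^ 2 = ∑ i ∈ S, ‖x i‖ ^ 2 := by
  rw [nrmOn, nrm_sq, ← Finset.sum_subset (Finset.subset_univ S)]
  · exact Finset.sum_congr rfl fun i hi => by simp [hi]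
  · intro i _ hi
    simp [hi]

lemma nrmOn_nonneg (S : Finset ι) (x : ι → ℂ) : 0 ≤ nrmOn S x := nrm_nonneg _

lemma nrmOn_le_nrm (S : Finset ι) (x : ι → ℂ) : nrmOn S x ≤ nrm x := by
  refine abs_le_of_sq_le_sq' ?_ (nrm_nonneg x) |>.2
  rw [nrm_sq, nrmOn_sq]
  exact Finset.sum_le_sum_of_subset_of_nonneg (Finset.subset_univ _) fun _ _ _ => by positivity

lemma nrmOn_mono {S T : Finset ι} (h : S ⊆ T) (x : ι → ℂ) : nrmOn S x ≤ nrmOn T x := by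
  refine abs_le_of_sq_le_sq' ?_ (nrmOn_nonneg T x) |>.2
  rw [nrmOn_sq, nrmOn_sq]
  exact Finset.sum_le_sum_of_subset_of_nonneg h fun _ _ _ => by positivity

lemma nrmOn_sub_le (S : Finset ι) (x y : ι → ℂ) : nrmOn S (x - y) ≤ nrmOn S x + nrmOn S y := by
  refine le_trans (le_of_eq ?_) (nrm_sub_le _ _)
  rw [nrmOn]
  congr 1
  funext i
  by_cases hi : i ∈ S <;> simp [hi]

/-- `s` bounds the operator norm of `A`. -/
def OpLe (A : Matrix ι ι ℂ) (s : ℝ) : Prop := ∀ x, nrm (A.mulVec x) ≤ s * nrm x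

end Norm

/-! ### Nets by volume comparison. -/

section Net

open Module

/-- A separated set in a ball of a finite-dimensional space has few points. -/
lemma card_le_of_separated_ball {E : Type*} [NormedAddCommGroup E] [NormedSpace ℝ E]
    [FiniteDimensional ℝ E] {R ε : ℝ} (hR : 0 ≤ R) (hε : 0 < ε) (s : Finset E)
    (hs : ∀ c ∈ s, ‖c‖ ≤ R) (h : ∀ c ∈ s, ∀ d ∈ s, c ≠ d → ε ≤ ‖c - d‖) :
    (s.card : ℝ) ≤ (1 + 2 * R / ε) ^ finrank ℝ E := by
  borelize E
  let μ : Measure E := Measure.addHaar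
  let δ : ℝ := ε / 2
  let ρ : ℝ := R + ε / 2
  have ρpos : 0 < ρ := by positivity
  have δpos : 0 < δ := by positivity
  set A := ⋃ c ∈ s, Metric.ball (c : E) δ with hA
  have D : Set.Pairwise (s : Set E) (Function.onFun Disjoint fun c => Metric.ball (c : E) δ) := by
    rintro c hc d hd hcd
    apply Metric.ball_disjoint_ball
    rw [dist_eq_norm]
    have := h c hc d hd hcd
    simp only [δ]
    linarith
  have A_subset : A ⊆ Metric.ball (0 : E) ρ := by
    refine Set.iUnion₂_subset fun x hx => ?_
    apply Metric.ball_subset_ball'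
    rw [dist_zero_right]
    have := hs x hx
    simp only [δ, ρ]
    linarith
  have I : (s.card : ENNReal) * ENNReal.ofReal (δ ^ finrank ℝ E) * μ (Metric.ball 0 1) ≤
      ENNReal.ofReal (ρ ^ finrank ℝ E) * μ (Metric.ball 0 1) :=
    calc
      (s.card : ENNReal) * ENNReal.ofReal (δ ^ finrank ℝ E) * μ (Metric.ball 0 1) = μ A := by
        rw [hA, measure_biUnion_finset D fun c _ => measurableSet_ball]
        simp only [μ.addHaar_ball_of_pos _ δpos]
        simp only [Finset.sum_const, nsmul_eq_mul, mul_assoc]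
      _ ≤ μ (Metric.ball (0 : E) ρ) := measure_mono A_subset
      _ = ENNReal.ofReal (ρ ^ finrank ℝ E) * μ (Metric.ball 0 1) := by
        simp only [μ.addHaar_ball_of_pos _ ρpos]
  have K : (s.card : ENNReal) * ENNReal.ofReal (δ ^ finrank ℝ E) ≤ ENNReal.ofReal (ρ ^ finrank ℝ E) :=
    (ENNReal.mul_le_mul_iff_left (Metric.measure_ball_pos _ _ zero_lt_one).ne'
      measure_ball_lt_top.ne).1 I
  have := ENNReal.toReal_le_of_le_ofReal (pow_nonneg ρpos.le _) K
  rw [ENNReal.toReal_mul, ENNReal.toReal_natCast, ENNReal.toReal_ofReal (by positivity),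
    ← le_div_iff₀ (by positivity), ← div_pow] at this
  have e : ρ / δ = 1 + 2 * R / ε := by
    simp only [ρ, δ]
    field_simp
    ring
  rwa [e] at this

/-- Nets for the preimage of a ball under a linear map. -/
lemma exists_net {E F : Type*} [AddCommGroup E] [Module ℝ E] [FiniteDimensional ℝ E]
    [NormedAddCommGroup F] [NormedSpace ℝ F] (L : E →ₗ[ℝ] F) {R ε : ℝ} (hR : 0 ≤ R) (hε : 0 < ε) :
    ∃ N : Finset E, (N.card : ℝ) ≤ (1 + 2 * R / ε) ^ finrank ℝ E ∧ (∀ y ∈ N, ‖L y‖ ≤ R) ∧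
      ∀ x, ‖L x‖ ≤ R → ∃ y ∈ N, ‖L (x - y)‖ ≤ ε := by
  classical
  -- Sets separated through `L`. On them `L` is injective, and the volume bound is applied in the
  -- range of `L`. Only the dimension of `E` enters the count, never the size of `L`.
  let P : Finset E → Prop := fun N => (∀ y ∈ N, ‖L y‖ ≤ R) ∧
    ∀ y ∈ N, ∀ z ∈ N, y ≠ z → ε ≤ ‖L (y - z)‖
  have hcard : ∀ N, P N → (N.card : ℝ) ≤ (1 + 2 * R / ε) ^ finrank ℝ E := by
    rintro N ⟨h1, h2⟩
    have hinj : Set.InjOn L.rangeRestrict (N : Set E) := by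
      intro y hy z hz hyz
      by_contra hne
      have h3 := h2 y hy z hz hne
      have h4 : L y = L z := congrArg Subtype.val hyz
      rw [map_sub, h4, sub_self, norm_zero] at h3
      linarith
    have h3 := card_le_of_separated_ball hR hε (N.image L.rangeRestrict) (fun c hc => ?_)
      (fun c hc d hd hcd => ?_)
    · rw [Finset.card_image_of_injOn hinj] at h3
      refine h3.trans (pow_le_pow_right₀ ?_ (LinearMap.finrank_range_le L))
      have : 0 ≤ 2 * R / ε := by positivity
      linarith
    · obtain ⟨y, hy, rfl⟩ := Finset.mem_image.1 hc
      exact h1 y hy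
    · obtain ⟨y, hy, rfl⟩ := Finset.mem_image.1 hc
      obtain ⟨z, hz, rfl⟩ := Finset.mem_image.1 hd
      have h4 := h2 y hy z hz (fun h => hcd (h ▸ rfl))
      rw [← map_sub]
      exact h4
  -- The cardinalities of separated sets are bounded, so a largest one exists; by maximality it is a
  -- net.
  let Q : ℕ → Prop := fun k => ∃ N, P N ∧ N.card = k
  have hQ0 : Q 0 := ⟨∅, by simp [P], by simp⟩
  have hQb : ∀ k, Q k → k ≤ ⌊(1 + 2 * R / ε) ^ finrank ℝ E⌋₊ := by
    rintro k ⟨N, hN, rfl⟩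
    exact Nat.le_floor (hcard N hN)
  obtain ⟨N, hN, hNk⟩ := Nat.findGreatest_spec (P := Q) (hQb 0 hQ0) hQ0
  refine ⟨N, hcard N hN, hN.1, fun x hx => ?_⟩
  by_contra! hfar
  have hxN : x ∉ N := fun h => by
    have := hfar x h
    simp at this
    linarith
  have hP : P (insert x N) := by
    refine ⟨fun y hy => ?_, fun y hy z hz hyz => ?_⟩
    · rcases Finset.mem_insert.1 hy with rfl | hy
      · exact hx
      · exact hN.1 y hy
    · rcases Finset.mem_insert.1 hy with hy' | hy' <;> rcases Finset.mem_insert.1 hz with hz' | hz'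
      · exact absurd (hy'.trans hz'.symm) hyz
      · exact hy' ▸ (hfar z hz').le
      · rw [← neg_sub, map_neg, norm_neg, hz']
        exact (hfar y hy').le
      · exact hN.2 y hy' z hz' hyz
  have h1 : Q (N.card + 1) := ⟨insert x N, hP, Finset.card_insert_of_notMem hxN⟩
  have h2 := Nat.le_findGreatest (P := Q) (hQb _ h1) h1
  omega

end Net


/-! ### Moments and Laplace transforms of sign sums. -/

section SignSums

variable {J : Type*} [Fintype J] [DecidableEq J]

/-- Averaging both sides replaces `F` by its even part in the coin `p`, which removes the cross
terms in the moment induction. -/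
lemma integral_coins_flip (p : J) (F : (J → Bool) → ℝ) :
    ∫ e, F e ∂coins J = ∫ e, F (Function.update e p (!e p)) ∂coins J := by
  have hs : ∀ q, coin.map (if q = p then not else id) = coin := fun q => by
    split_ifs
    · exact coin_map_not
    · exact Measure.map_id
  have : ∀ q, SigmaFinite (coin.map (if q = p then not else id)) := fun q => by
    rw [hs]; infer_instance
  have hmap := Measure.pi_map_pi (μ := fun _ : J => coin)
    (f := fun q => if q = p then not else id) fun q => (by fun_prop)
  simp only [hs] at hmap
  conv_lhs => rw [show coins J = _ from hmap.symm]
  rw [integral_map (measurable_of_finite _).aemeasurable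
    (measurable_of_finite _).aestronglyMeasurable]
  congr 1
  funext e
  congr 1
  funext q
  by_cases hq : q = p
  · subst hq; simp
  · simp [hq]

lemma sq_norm_add_add_sq_norm_sub (g z : ℂ) :
    ‖g + z‖ ^ 2 + ‖g - z‖ ^ 2 = 2 * (‖g‖ ^ 2 + ‖z‖ ^ 2) := by
  have := parallelogram_law_with_norm ℝ g z
  nlinarith

/-- The two squared norms have a fixed sum and neither exceeds (‖g‖ + ‖z‖)², so the sum of their
squares is largest when `g` and `z` are aligned. -/
lemma norm_pow_four_add_le (g z : ℂ) :
    ‖g + z‖ ^ 4 + ‖g - z‖ ^ 4 ≤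
      2 * (‖g‖ ^ 4 + 6 * (‖g‖ ^ 2 * ‖z‖ ^ 2) + ‖z‖ ^ 4) := by
  have h1 := sq_norm_add_add_sq_norm_sub g z
  have ha : ‖g + z‖ ≤ ‖g‖ + ‖z‖ := norm_add_le g z
  have hb : ‖g - z‖ ≤ ‖g‖ + ‖z‖ := norm_sub_le g z
  have ha2 : ‖g + z‖ ^ 2 ≤ (‖g‖ + ‖z‖) ^ 2 := by gcongr
  have hb2 : ‖g - z‖ ^ 2 ≤ (‖g‖ + ‖z‖) ^ 2 := by gcongr
  set A := ‖g + z‖ ^ 2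
  set B := ‖g - z‖ ^ 2
  have h4 : ‖g + z‖ ^ 4 + ‖g - z‖ ^ 4 = A ^ 2 + B ^ 2 := by simp only [A, B]; ring
  rw [h4]
  nlinarith [mul_nonneg (sub_nonneg.2 ha2) (sub_nonneg.2 hb2)]

/-- Induction on `T`, averaging over the flip of the new sign. The second moment grows by the
parallelogram law, and the fourth closes because 3V² + 6V|c|² + |c|⁴ ≤ 3(V + |c|²)². -/
lemma integral_sign_sum_moments {κ : Type*} [DecidableEq κ] (T : Finset κ) (k : κ → J)
    (hk : Set.InjOn k T) (c : κ → ℂ) (w : ℂ) :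
    ∫ e, ‖w + ∑ j ∈ T, (sg (e (k j)) : ℂ) * c j‖ ^ 2 ∂coins J = ‖w‖ ^ 2 + ∑ j ∈ T, ‖c j‖ ^ 2 ∧
    ∫ e, ‖w + ∑ j ∈ T, (sg (e (k j)) : ℂ) * c j‖ ^ 4 ∂coins J ≤
      3 * (‖w‖ ^ 2 + ∑ j ∈ T, ‖c j‖ ^ 2) ^ 2 := by
  induction T using Finset.induction_on with
  | empty =>
    simp
    nlinarith [sq_nonneg (‖w‖ ^ 2)]
  | insert i T hi ih =>
    obtain ⟨ih2, ih4⟩ := ih (hk.mono (by simp))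
    let g : (J → Bool) → ℂ := fun e => w + ∑ j ∈ T, (sg (e (k j)) : ℂ) * c j
    let z : (J → Bool) → ℂ := fun e => (sg (e (k i)) : ℂ) * c i
    have hz : ∀ e, ‖z e‖ = ‖c i‖ := fun e => by
      simp only [z, norm_mul, Complex.norm_real, Real.norm_eq_abs, abs_sg, one_mul]
    have hsum : ∀ e : J → Bool, w + ∑ j ∈ insert i T, (sg (e (k j)) : ℂ) * c j = g e + z e := by
      intro e
      rw [Finset.sum_insert hi]
      simp only [g, z]
      ring
    have hflip : ∀ e : J → Bool, w + ∑ j ∈ insert i T,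
        (sg (Function.update e (k i) (!e (k i)) (k j)) : ℂ) * c j = g e - z e := by
      intro e
      rw [Finset.sum_insert hi]
      have : ∑ j ∈ T, (sg (Function.update e (k i) (!e (k i)) (k j)) : ℂ) * c j =
          ∑ j ∈ T, (sg (e (k j)) : ℂ) * c j := by
        refine Finset.sum_congr rfl fun j hj => ?_
        have hne : k j ≠ k i := fun h => hi (hk (by simp [hj]) (by simp) h ▸ hj)
        rw [Function.update_of_ne hne]
      rw [this, Function.update_self, sg_not]
      simp only [g, z]
      push_cast
      ring
    have hI : ∀ F : (J → Bool) → ℝ, Integrable F (coins J) := fun F => .of_finite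
    have half : ∀ m : ℕ, ∫ e, ‖w + ∑ j ∈ insert i T, (sg (e (k j)) : ℂ) * c j‖ ^ m ∂coins J =
        (∫ e, (‖g e + z e‖ ^ m + ‖g e - z e‖ ^ m) ∂coins J) / 2 := by
      intro m
      have h1 := integral_coins_flip (k i)
        (fun e => ‖w + ∑ j ∈ insert i T, (sg (e (k j)) : ℂ) * c j‖ ^ m)
      simp only [hflip] at h1
      rw [integral_add (hI _) (hI _), ← h1]
      simp only [hsum]
      ring
    rw [half, half, Finset.sum_insert hi]
    constructor
    · simp only [sq_norm_add_add_sq_norm_sub, hz]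
      rw [integral_const_mul, integral_add (hI _) (hI _), ih2]
      simp
      ring
    · have h1 : ∫ e, (‖g e + z e‖ ^ 4 + ‖g e - z e‖ ^ 4) ∂coins J ≤
          ∫ e, 2 * (‖g e‖ ^ 4 + 6 * (‖g e‖ ^ 2 * ‖c i‖ ^ 2) + ‖c i‖ ^ 4) ∂coins J := by
        refine integral_mono (hI _) (hI _) fun e => ?_
        have := norm_pow_four_add_le (g e) (z e)
        simpa only [hz] using this
      have h1' : ∫ e, 2 * (‖g e‖ ^ 4 + 6 * (‖g e‖ ^ 2 * ‖c i‖ ^ 2) + ‖c i‖ ^ 4) ∂coins J =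
          2 * (∫ e, ‖g e‖ ^ 4 ∂coins J + 6 * ((‖w‖ ^ 2 + ∑ j ∈ T, ‖c j‖ ^ 2) * ‖c i‖ ^ 2) +
            ‖c i‖ ^ 4) := by
        rw [integral_const_mul, integral_add (hI _) (hI _), integral_add (hI _) (hI _),
          integral_const_mul, integral_mul_const, ih2]
        simp
      rw [h1'] at h1
      have h2 : (0 : ℝ) ≤ ‖c i‖ ^ 2 := by positivity
      have h3 : ‖c i‖ ^ 4 = (‖c i‖ ^ 2) ^ 2 := by ring
      rw [h3] at h1
      nlinarith

lemma exp_neg_le_quadratic {x : ℝ} (hx : 0 ≤ x) : Real.exp (-x) ≤ 1 - x + x ^ 2 / 2 := by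
  have h := Real.quadratic_le_exp_of_nonneg hx
  have h1 : Real.exp (-x) * Real.exp x = 1 := by rw [← Real.exp_add]; simp
  have h2 := Real.exp_pos (-x)
  have h3 : (1 - x + x ^ 2 / 2) * (1 + x + x ^ 2 / 2) = 1 + x ^ 4 / 4 := by ring
  have h4 : 0 < 1 - x + x ^ 2 / 2 := by nlinarith [sq_nonneg (x - 1)]
  by_contra! h5
  have h6 : (1 - x + x ^ 2 / 2) * Real.exp x < 1 := by
    have := mul_lt_mul_of_pos_right h5 (Real.exp_pos x)
    linarith
  have h7 : (1 - x + x ^ 2 / 2) * (1 + x + x ^ 2 / 2) ≤ (1 - x + x ^ 2 / 2) * Real.exp x :=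
    mul_le_mul_of_nonneg_left h h4.le
  nlinarith [pow_nonneg hx 4]

/-- Laplace transform bound for the squared modulus of a shifted sign sum. -/
lemma integral_exp_neg_sq_sign_sum_le {κ : Type*} [DecidableEq κ] (T : Finset κ) (k : κ → J)
    (hk : Set.InjOn k T) (c : κ → ℂ) (w : ℂ) {l : ℝ} (hl : 0 < l)
    (hlc : l * ∑ j ∈ T, ‖c j‖ ^ 2 ≤ 1 / 3) :
    ∫ e, Real.exp (-(l * ‖w + ∑ j ∈ T, (sg (e (k j)) : ℂ) * c j‖ ^ 2)) ∂coins J ≤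
      Real.exp (-(l * (∑ j ∈ T, ‖c j‖ ^ 2) / 2)) := by
  obtain ⟨h2, h4⟩ := integral_sign_sum_moments T k hk c w
  set f : (J → Bool) → ℂ := fun e => w + ∑ j ∈ T, (sg (e (k j)) : ℂ) * c j
  set V := ‖w‖ ^ 2 + ∑ j ∈ T, ‖c j‖ ^ 2 with hV
  set S := ∑ j ∈ T, ‖c j‖ ^ 2
  have hS : 0 ≤ S := Finset.sum_nonneg fun _ _ => by positivity
  have hSV : S ≤ V := by rw [hV]; nlinarith [sq_nonneg ‖w‖]
  have hI : ∀ F : (J → Bool) → ℝ, Integrable F (coins J) := fun F => .of_finite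
  -- The quadratic expansion is useful only if mV ≤ 1/3, which a large shift `w` may violate for m =
  -- l. Decreasing the parameter to m = 1/(3V) then gives 1 - 1/6, and this suffices since lS ≤ 1/3.
  have key : ∀ m : ℝ, 0 ≤ m → m ≤ l → m * V ≤ 1 / 3 →
      ∫ e, Real.exp (-(l * ‖f e‖ ^ 2)) ∂coins J ≤ 1 - m * V / 2 := by
    intro m hm hml hmV
    calc ∫ e, Real.exp (-(l * ‖f e‖ ^ 2)) ∂coins J
        ≤ ∫ e, (1 - m * ‖f e‖ ^ 2 + m ^ 2 / 2 * ‖f e‖ ^ 4) ∂coins J := by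
          refine integral_mono (hI _) (hI _) fun e => ?_
          refine (Real.exp_le_exp.2 (neg_le_neg (mul_le_mul_of_nonneg_right hml
            (by positivity)))).trans ((exp_neg_le_quadratic (by positivity)).trans (le_of_eq ?_))
          ring
      _ ≤ 1 - m * V + m ^ 2 / 2 * (3 * V ^ 2) := by
          rw [integral_add (hI _) (hI _), integral_sub (hI _) (hI _), integral_const_mul,
            integral_const_mul, h2]
          simp only [integral_const, probReal_univ, smul_eq_mul, one_mul]
          gcongr
      _ ≤ 1 - m * V / 2 := by
          have : 0 ≤ m * V := mul_nonneg hm (hS.trans hSV)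
          nlinarith
  have hfin : ∫ e, Real.exp (-(l * ‖f e‖ ^ 2)) ∂coins J ≤ 1 - l * S / 2 := by
    rcases le_or_gt (l * V) (1 / 3) with h | h
    · refine (key l hl.le le_rfl h).trans ?_
      nlinarith
    · have hVpos : 0 < V := by
        by_contra! h'
        nlinarith
      refine (key (1 / (3 * V)) (by positivity) ?_ (le_of_eq (by field_simp))).trans ?_
      · rw [div_le_iff₀ (by positivity)]
        linarith
      · have : 1 / (3 * V) * V = 1 / 3 := by field_simp
        rw [this]
        linarith
  refine hfin.trans ?_
  have := Real.add_one_le_exp (-(l * S / 2))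
  linarith

end SignSums

/-! ### Sign matrices acting on a fixed sparse vector. -/

section SignMatrix

variable {ι J : Type*} [Fintype ι] [DecidableEq ι] [Fintype J] [DecidableEq J]

/-- `idx i j` labels the unordered pair `{i, j}`. -/
def IsPairIndex (idx : ι → ι → J) : Prop :=
  ∀ i j k l, i ≠ j → k ≠ l → idx i j = idx k l → (i = k ∧ j = l) ∨ (i = l ∧ j = k)

/-- A matrix with a random sign for each pair of symmetric entries. -/
noncomputable def signMat (idx : ι → ι → J) (d : ι → ι → ℂ) (e : J → Bool) : Matrix ι ι ℂ :=
  Matrix.of fun i j => (sg (e (idx i j)) : ℂ) * d i j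

/-- Rows outside `T` meet columns in `T` only through pairs with one index on each side. Different
rows therefore use disjoint families of signs, and the Laplace transform factorizes in spite of the
dependence between symmetric entries. -/
lemma integral_exp_neg_signMat_le {idx : ι → ι → J} (hidx : IsPairIndex idx) (d : ι → ι → ℂ)
    (T : Finset ι) (x : ι → ℂ) (hx : ∀ i ∉ T, x i = 0) (w : ι → ℂ) {l : ℝ} (hl : 0 < l)
    (hlc : ∀ i, l * ∑ j ∈ T, ‖d i j * x j‖ ^ 2 ≤ 1 / 3) :
    ∫ e, Real.exp (-(l * nrmOn Tᶜ ((signMat idx d e).mulVec x + w) ^ 2)) ∂coins J ≤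
      Real.exp (-(l * (∑ i ∈ Tᶜ, ∑ j ∈ T, ‖d i j * x j‖ ^ 2) / 2)) := by
  let f : ι → (J → Bool) → ℝ := fun i e =>
    Real.exp (-(l * ‖w i + ∑ j ∈ T, (sg (e (idx i j)) : ℂ) * (d i j * x j)‖ ^ 2))
  have hprod : ∀ e, Real.exp (-(l * nrmOn Tᶜ ((signMat idx d e).mulVec x + w) ^ 2)) =
      ∏ i ∈ Tᶜ, f i e := by
    intro e
    rw [nrmOn_sq, Finset.mul_sum, ← Finset.sum_neg_distrib, Real.exp_sum]
    refine Finset.prod_congr rfl fun i _ => ?_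
    have : ((signMat idx d e).mulVec x + w) i =
        w i + ∑ j ∈ T, (sg (e (idx i j)) : ℂ) * (d i j * x j) := by
      rw [Pi.add_apply, add_comm, Matrix.mulVec, dotProduct]
      congr 1
      rw [← Finset.sum_subset (Finset.subset_univ T)]
      · exact Finset.sum_congr rfl fun j _ => by simp [signMat, mul_assoc]
      · intro j _ hj
        simp [hx j hj]
    rw [this]
  simp only [hprod]
  rw [integral_pi_prod_of_dependsOn (fun _ => coin) Tᶜ (fun i => T.image (idx i)) ?_ f
    (fun i => measurable_of_finite _) ?_]
  · rw [Finset.mul_sum, Finset.sum_div, ← Finset.sum_neg_distrib, Real.exp_sum]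
    refine Finset.prod_le_prod (fun i _ => integral_nonneg fun e => by positivity) fun i hi => ?_
    refine integral_exp_neg_sq_sign_sum_le T (idx i) (fun j hj j' hj' h => ?_) _ _ hl (hlc i)
    have hiT := Finset.mem_compl.1 hi
    have h1 : i ≠ j := fun h => hiT (h ▸ hj)
    have h2 : i ≠ j' := fun h => hiT (h ▸ hj')
    rcases hidx i j i j' h1 h2 h with h | h
    · exact h.2
    · exact absurd h.1 h2
  · intro i hi i' hi' hne
    refine Finset.disjoint_left.2 fun p hp hp' => ?_
    obtain ⟨j, hj, rfl⟩ := Finset.mem_image.1 hp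
    obtain ⟨j', hj', h⟩ := Finset.mem_image.1 hp'
    have hiT := Finset.mem_compl.1 hi
    have hiT' := Finset.mem_compl.1 hi'
    have h1 : i ≠ j := fun h => hiT (h ▸ hj)
    have h2 : i' ≠ j' := fun h => hiT' (h ▸ hj')
    rcases hidx i' j' i j h2 h1 h with h | h
    · exact hne h.1.symm
    · exact hiT' (h.1 ▸ hj)
  · intro i e e' h
    have : ∑ j ∈ T, (sg (e (idx i j)) : ℂ) * (d i j * x j) =
        ∑ j ∈ T, (sg (e' (idx i j)) : ℂ) * (d i j * x j) := by
      refine Finset.sum_congr rfl fun j hj => ?_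
      rw [h (idx i j) (Finset.mem_coe.2 (Finset.mem_image_of_mem _ hj))]
    simp only [f, this]

/-- A fixed vector supported on `T` is not shrunk by a random sign matrix. -/
lemma coins_nrmOn_signMat_le {idx : ι → ι → J} (hidx : IsPairIndex idx) (d : ι → ι → ℂ)
    {a c₀ N : ℝ} (ha : 0 < a) (hd : ∀ i j, ‖d i j‖ ≤ a)
    (T : Finset ι) (hcol : ∀ j, c₀ * N ≤ ∑ i ∈ Tᶜ, ‖d i j‖ ^ 2)
    (hcN : 0 ≤ c₀ * N) (x : ι → ℂ) (hx : ∀ i ∉ T, x i = 0) (hx1 : 1 / 2 ≤ nrm x) (hx2 : nrm x ≤ 2)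
    (w : ι → ℂ) :
    (coins J).real {e | nrmOn Tᶜ ((signMat idx d e).mulVec x + w) ^ 2 ≤ c₀ * N / 16} ≤
      Real.exp (-(c₀ * N / (192 * a ^ 2))) := by
  -- The largest parameter allowed by the Laplace bound, given |d| ≤ a and ‖x‖ ≤ 2. Markov then
  -- leaves the exponent l c₀N/8 - l c₀N/16 = c₀N/(192a²).
  set l : ℝ := 1 / (12 * a ^ 2) with hl_def
  have hl : 0 < l := by positivity
  have hxT : ∑ j ∈ T, ‖x j‖ ^ 2 = nrm x ^ 2 := by
    rw [nrm_sq]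
    exact Finset.sum_subset (Finset.subset_univ _) fun i _ hi => by simp [hx i hi]
  have hlc : ∀ i, l * ∑ j ∈ T, ‖d i j * x j‖ ^ 2 ≤ 1 / 3 := by
    intro i
    have : ∑ j ∈ T, ‖d i j * x j‖ ^ 2 ≤ a ^ 2 * 4 := by
      calc ∑ j ∈ T, ‖d i j * x j‖ ^ 2 ≤ ∑ j ∈ T, a ^ 2 * ‖x j‖ ^ 2 := by
            refine Finset.sum_le_sum fun j _ => ?_
            rw [norm_mul, mul_pow]
            gcongr
            exact hd i j
        _ ≤ _ := by
            rw [← Finset.mul_sum, hxT]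
            gcongr
            nlinarith [nrm_nonneg x]
    calc l * ∑ j ∈ T, ‖d i j * x j‖ ^ 2 ≤ l * (a ^ 2 * 4) := by gcongr
      _ = 1 / 3 := by rw [hl_def]; field_simp; norm_num
  have hmean := integral_exp_neg_signMat_le hidx d T x hx w hl hlc
  have hsum : c₀ * N / 4 ≤ ∑ i ∈ Tᶜ, ∑ j ∈ T, ‖d i j * x j‖ ^ 2 := by
    rw [Finset.sum_comm]
    have hx4 : 1 / 4 ≤ nrm x ^ 2 := by nlinarith
    calc c₀ * N / 4 ≤ c₀ * N * nrm x ^ 2 := by nlinarith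
      _ = ∑ j ∈ T, c₀ * N * ‖x j‖ ^ 2 := by rw [← hxT, Finset.mul_sum]
      _ ≤ _ := by
        refine Finset.sum_le_sum fun j _ => ?_
        simp only [norm_mul, mul_pow]
        rw [← Finset.sum_mul]
        gcongr
        exact hcol j
  have hmk := mul_meas_ge_le_integral_of_nonneg (μ := coins J)
    (f := fun e => Real.exp (-(l * nrmOn Tᶜ ((signMat idx d e).mulVec x + w) ^ 2)))
    (Filter.Eventually.of_forall fun w => by positivity) .of_finite
    (Real.exp (-(l * (c₀ * N / 16))))
  have hset : {e | nrmOn Tᶜ ((signMat idx d e).mulVec x + w) ^ 2 ≤ c₀ * N / 16} ⊆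
      {e | Real.exp (-(l * (c₀ * N / 16))) ≤
        Real.exp (-(l * nrmOn Tᶜ ((signMat idx d e).mulVec x + w) ^ 2))} := by
    intro e he
    simp only [Set.mem_ofPred_eq] at he ⊢
    exact Real.exp_le_exp.2 (neg_le_neg (mul_le_mul_of_nonneg_left he hl.le))
  refine (measureReal_mono hset).trans ?_
  rw [← mul_le_mul_iff_right₀ (Real.exp_pos (-(l * (c₀ * N / 16))))]
  refine (hmk.trans hmean).trans ?_
  rw [← Real.exp_add]
  refine Real.exp_le_exp.2 ?_
  have h1 : c₀ * N / (192 * a ^ 2) = l * (c₀ * N / 16) := by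
    rw [hl_def]; field_simp; ring
  rw [h1]
  nlinarith

end SignMatrix


/-! ### Operator norm of a sign matrix. -/

section OperatorNorm

variable {ι J : Type*} [Fintype ι] [DecidableEq ι] [Fintype J] [DecidableEq J]

lemma integral_exp_sign_sum_le (b : J → ℝ) (l : ℝ) :
    ∫ e, Real.exp (l * ∑ p, sg (e p) * b p) ∂coins J ≤ Real.exp (l ^ 2 * (∑ p, b p ^ 2) / 2) := by
  have h1 : ∀ e : J → Bool, Real.exp (l * ∑ p, sg (e p) * b p) =
      ∏ p, Real.exp (l * (sg (e p) * b p)) := fun e => by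
    rw [Finset.mul_sum, Real.exp_sum]
  simp only [h1]
  rw [integral_fintype_prod_eq_prod (fun p (c : Bool) => Real.exp (l * (sg c * b p))),
    Finset.mul_sum, Finset.sum_div, Real.exp_sum]
  refine Finset.prod_le_prod (fun p _ => integral_nonneg fun c => by positivity) fun p _ => ?_
  rw [integral_coin]
  have := Real.cosh_le_exp_half_sq (l * b p)
  rw [Real.cosh_eq] at this
  simp only [sg_true, sg_false, one_mul, neg_one_mul, mul_neg]
  rwa [mul_pow] at this

/-- Each sign multiplies at most two symmetric entries, so after grouping the form is a sign sum
whose squared coefficients add up to at most 2a²; the exponential Markov inequality concludes. -/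
lemma coins_re_bilin_signMat_ge {idx : ι → ι → J} (hidx : IsPairIndex idx) (d : ι → ι → ℂ)
    {a : ℝ} (ha : 0 < a) (hd : ∀ i j, ‖d i j‖ ≤ a) (hdiag : ∀ i, d i i = 0) (u v : ι → ℂ)
    (hu : nrm u ≤ 1) (hv : nrm v ≤ 1) {l t : ℝ} (hl : 0 ≤ l) :
    (coins J).real {e | t ≤ (u ⬝ᵥ (signMat idx d e).mulVec v).re} ≤
      Real.exp (l ^ 2 * a ^ 2 - l * t) := by
  let r : ι × ι → ℝ := fun q => (u q.1 * d q.1 q.2 * v q.2).re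
  let O : Finset (ι × ι) := Finset.univ.filter fun q => q.1 ≠ q.2
  let fib : J → Finset (ι × ι) := fun p => O.filter fun q => idx q.1 q.2 = p
  let b : J → ℝ := fun p => ∑ q ∈ fib p, r q
  have hb : ∀ e, (u ⬝ᵥ (signMat idx d e).mulVec v).re = ∑ p, sg (e p) * b p := by
    intro e
    have h1 : (u ⬝ᵥ (signMat idx d e).mulVec v).re =
        ∑ q : ι × ι, sg (e (idx q.1 q.2)) * r q := by
      rw [Fintype.sum_prod_type]
      simp only [dotProduct, Matrix.mulVec, signMat, Matrix.of_apply, Finset.mul_sum,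
        Complex.re_sum, r]
      refine Finset.sum_congr rfl fun i _ => Finset.sum_congr rfl fun j _ => ?_
      rw [← Complex.re_ofReal_mul]
      congr 1
      ring
    have h2 : ∑ q : ι × ι, sg (e (idx q.1 q.2)) * r q =
        ∑ q ∈ O, sg (e (idx q.1 q.2)) * r q := by
      refine (Finset.sum_subset (Finset.subset_univ _) fun q _ hq => ?_).symm
      have : q.1 = q.2 := by simpa [O] using hq
      simp [r, this, hdiag]
    rw [h1, h2, ← Finset.sum_fiberwise O (fun q => idx q.1 q.2)]
    refine Finset.sum_congr rfl fun p _ => ?_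
    simp only [b, Finset.mul_sum]
    refine Finset.sum_congr rfl fun q hq => ?_
    rw [(Finset.mem_filter.1 hq).2]
  have hcard : ∀ p, (fib p).card ≤ 2 := by
    intro p
    rcases (fib p).eq_empty_or_nonempty with h | ⟨⟨i, j⟩, hq⟩
    · simp [h]
    · have hq' : i ≠ j ∧ idx i j = p := by simpa [fib, O] using hq
      have : fib p ⊆ {(i, j), (j, i)} := by
        rintro ⟨k, l⟩ hkl
        have hkl' : k ≠ l ∧ idx k l = p := by simpa [fib, O] using hkl
        rcases hidx k l i j hkl'.1 hq'.1 (hkl'.2.trans hq'.2.symm) with h | h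
        · simp [h.1, h.2]
        · simp [h.1, h.2]
      exact (Finset.card_le_card this).trans Finset.card_le_two
  have hb2 : ∑ p, b p ^ 2 ≤ 2 * a ^ 2 := by
    calc ∑ p, b p ^ 2 ≤ ∑ p, 2 * ∑ q ∈ fib p, r q ^ 2 := by
          refine Finset.sum_le_sum fun p _ => ?_
          refine sq_sum_le_card_mul_sum_sq.trans ?_
          gcongr
          exact_mod_cast hcard p
      _ = 2 * ∑ q ∈ O, r q ^ 2 := by
          rw [← Finset.mul_sum, Finset.sum_fiberwise O (fun q => idx q.1 q.2) (fun q => r q ^ 2)]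
      _ ≤ 2 * ∑ q : ι × ι, r q ^ 2 := by
          gcongr
          exact Finset.subset_univ _
      _ ≤ 2 * ∑ q : ι × ι, a ^ 2 * (‖u q.1‖ ^ 2 * ‖v q.2‖ ^ 2) := by
          gcongr with q
          have h1 : |r q| ≤ ‖u q.1‖ * ‖d q.1 q.2‖ * ‖v q.2‖ := by
            rw [← norm_mul, ← norm_mul]
            exact Complex.abs_re_le_norm _
          have h2 : |r q| ≤ a * (‖u q.1‖ * ‖v q.2‖) := by
            refine h1.trans ?_
            have := mul_le_mul_of_nonneg_left (hd q.1 q.2)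
              (mul_nonneg (norm_nonneg (u q.1)) (norm_nonneg (v q.2)))
            nlinarith
          rw [← sq_abs, ← mul_pow, ← mul_pow]
          gcongr
      _ = 2 * a ^ 2 * (nrm u ^ 2 * nrm v ^ 2) := by
          rw [nrm_sq, nrm_sq, Finset.sum_mul_sum, Fintype.sum_prod_type]
          simp only [Finset.mul_sum, mul_assoc]
      _ ≤ 2 * a ^ 2 * (1 ^ 2 * 1 ^ 2) := by
          gcongr
          · exact nrm_nonneg u
          · exact nrm_nonneg v
      _ = _ := by ring
  have hmean := integral_exp_sign_sum_le b l
  have hmk := mul_meas_ge_le_integral_of_nonneg (μ := coins J)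
    (f := fun e => Real.exp (l * ∑ p, sg (e p) * b p))
    (Filter.Eventually.of_forall fun w => by positivity) .of_finite (Real.exp (l * t))
  have hset : {e | t ≤ (u ⬝ᵥ (signMat idx d e).mulVec v).re} ⊆
      {e | Real.exp (l * t) ≤ Real.exp (l * ∑ p, sg (e p) * b p)} := by
    intro e he
    simp only [Set.mem_ofPred_eq, hb] at he ⊢
    exact Real.exp_le_exp.2 (mul_le_mul_of_nonneg_left he hl)
  refine (measureReal_mono hset).trans ?_
  rw [← mul_le_mul_iff_right₀ (Real.exp_pos (l * t))]
  refine (hmk.trans hmean).trans ?_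
  rw [← Real.exp_add]
  refine Real.exp_le_exp.2 ?_
  nlinarith [mul_le_mul_of_nonneg_left hb2 (sq_nonneg l)]

/-- A net of the unit ball of `ℂ^ι`. -/
lemma exists_net_unit_ball {ε : ℝ} (hε : 0 < ε) :
    ∃ N : Finset (ι → ℂ), (N.card : ℝ) ≤ (1 + 2 / ε) ^ (2 * Fintype.card ι) ∧
      (∀ y ∈ N, nrm y ≤ 1) ∧ ∀ x : ι → ℂ, nrm x ≤ 1 → ∃ y ∈ N, nrm (x - y) ≤ ε := by
  let L : (ι → ℂ) →ₗ[ℝ] EuclideanSpace ℂ ι :=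
    (WithLp.linearEquiv 2 ℝ (ι → ℂ)).symm.toLinearMap
  obtain ⟨N, h1, h2, h3⟩ := exists_net L zero_le_one hε
  refine ⟨N, ?_, h2, h3⟩
  have : Module.finrank ℝ (ι → ℂ) = 2 * Fintype.card ι := by
    rw [Module.finrank_pi_fintype]
    simp [Complex.finrank_real_complex, mul_comm]
  rw [this, mul_one] at h1
  exact h1

lemma exists_nrm_eq_one_maximizer [Nonempty ι] (A : Matrix ι ι ℂ) :
    ∃ v : ι → ℂ, nrm v = 1 ∧ OpLe A (nrm (A.mulVec v)) := by
  have hcomp : IsCompact {x : ι → ℂ | nrm x = 1} := by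
    have h := (isCompact_sphere (0 : EuclideanSpace ℂ ι) 1).image
      (PiLp.continuous_ofLp 2 (fun _ : ι => ℂ))
    convert h using 1
    ext x
    constructor
    · intro hx
      exact ⟨WithLp.toLp 2 x, by simpa [nrm] using hx, rfl⟩
    · rintro ⟨y, hy, rfl⟩
      simpa [nrm] using hy
  have hne : {x : ι → ℂ | nrm x = 1}.Nonempty := by
    obtain ⟨i⟩ := ‹Nonempty ι›
    refine ⟨Pi.single i 1, ?_⟩
    have : nrm (Pi.single i (1 : ℂ)) ^ 2 = 1 := by
      rw [nrm_sq, Finset.sum_eq_single i] <;> simp +contextual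
    have h0 := nrm_nonneg (Pi.single i (1 : ℂ) : ι → ℂ)
    simp only [Set.mem_ofPred_eq]
    nlinarith
  have hcont : Continuous fun x : ι → ℂ => nrm (A.mulVec x) :=
    continuous_nrm.comp (continuous_const.matrix_mulVec continuous_id)
  obtain ⟨v, hv, hmax⟩ := hcomp.exists_isMaxOn hne hcont.continuousOn
  refine ⟨v, hv, fun x => ?_⟩
  rcases eq_or_ne x 0 with rfl | hx
  · simp
  · have hx' : 0 < nrm x := lt_of_le_of_ne (nrm_nonneg x) fun h => hx (nrm_eq_zero.1 h.symm)
    have h1 : nrm (((nrm x)⁻¹ : ℂ) • x) = 1 := by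
      rw [nrm_smul, norm_inv, Complex.norm_real, Real.norm_eq_abs, abs_of_pos hx',
        inv_mul_cancel₀ hx'.ne']
    have h2 : nrm (A.mulVec (((nrm x)⁻¹ : ℂ) • x)) ≤ nrm (A.mulVec v) := hmax h1
    rw [Matrix.mulVec_smul, nrm_smul, norm_inv, Complex.norm_real, Real.norm_eq_abs,
      abs_of_pos hx', inv_mul_le_iff₀ hx'] at h2
    linarith

lemma exists_dotProduct_eq_nrm (y : ι → ℂ) :
    ∃ u : ι → ℂ, nrm u ≤ 1 ∧ (u ⬝ᵥ y).re = nrm y := by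
  rcases eq_or_ne y 0 with rfl | hy
  · exact ⟨0, by simp⟩
  · have hy' : 0 < nrm y := lt_of_le_of_ne (nrm_nonneg y) fun h => hy (nrm_eq_zero.1 h.symm)
    refine ⟨((nrm y)⁻¹ : ℂ) • star y, ?_, ?_⟩
    · have h1 : nrm (star y) = nrm y := by
        rw [← abs_of_nonneg (nrm_nonneg (star y)), ← abs_of_nonneg (nrm_nonneg y),
          ← sq_eq_sq_iff_abs_eq_abs]
        simp [nrm_sq]
      rw [nrm_smul, h1, norm_inv, Complex.norm_real, Real.norm_eq_abs, abs_of_pos hy',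
        inv_mul_cancel₀ hy'.ne']
    · have h2 : star y ⬝ᵥ y = ((nrm y ^ 2 : ℝ) : ℂ) := by
        rw [nrm_sq, dotProduct]
        push_cast
        refine Finset.sum_congr rfl fun i _ => ?_
        rw [Pi.star_apply, Complex.star_def, Complex.conj_mul']
      rw [smul_dotProduct, h2, smul_eq_mul, ← Complex.ofReal_inv, ← Complex.ofReal_mul,
        Complex.ofReal_re]
      field_simp

/-- The operator norm of a random sign matrix is of order `√n` with overwhelming probability. -/
lemma coins_not_opLe_signMat_le [Nonempty ι] {idx : ι → ι → J} (hidx : IsPairIndex idx)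
    (d : ι → ι → ℂ) {a : ℝ} (ha : 0 < a) (hd : ∀ i j, ‖d i j‖ ≤ a) (hdiag : ∀ i, d i i = 0) :
    (coins J).real {e | ¬ OpLe (signMat idx d e) (24 * a * √(Fintype.card ι))} ≤
      Real.exp (-(Fintype.card ι : ℝ)) := by
  set n : ℝ := (Fintype.card ι : ℝ) with hn
  have hnpos : 0 < n := by rw [hn]; exact_mod_cast Fintype.card_pos
  -- Approximating both vectors within 1/4 loses at most half of the norm, which is why 24 becomes
  -- 12 on the net.
  obtain ⟨N, hNc, hN1, hN⟩ := exists_net_unit_ball (ι := ι) (ε := 1 / 4) (by norm_num)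
  have hsub : {e | ¬ OpLe (signMat idx d e) (24 * a * √n)} ⊆
      ⋃ q ∈ N ×ˢ N, {e | 12 * a * √n ≤ (q.1 ⬝ᵥ (signMat idx d e).mulVec q.2).re} := by
    intro e he
    obtain ⟨v, hv, hop⟩ := exists_nrm_eq_one_maximizer (signMat idx d e)
    set A := signMat idx d e
    set g := nrm (A.mulVec v)
    have hg : 24 * a * √n < g := by
      by_contra! h
      exact he fun x => (hop x).trans (mul_le_mul_of_nonneg_right h (nrm_nonneg x))
    obtain ⟨u, hu, hug⟩ := exists_dotProduct_eq_nrm (A.mulVec v)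
    obtain ⟨v', hv'N, hv'⟩ := hN v hv.le
    obtain ⟨u', hu'N, hu'⟩ := hN u hu
    simp only [Set.mem_iUnion]
    refine ⟨(u', v'), by simp [hu'N, hv'N], ?_⟩
    have e1 : u ⬝ᵥ A.mulVec v = u' ⬝ᵥ A.mulVec v' + (u - u') ⬝ᵥ A.mulVec v +
        u' ⬝ᵥ A.mulVec (v - v') := by
      rw [Matrix.mulVec_sub, sub_dotProduct, dotProduct_sub]
      ring
    have hg0 : 0 ≤ g := nrm_nonneg _
    have b1 : ((u - u') ⬝ᵥ A.mulVec v).re ≤ 1 / 4 * g :=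
      ((Complex.re_le_norm _).trans (norm_dotProduct_le _ _)).trans
        (mul_le_mul_of_nonneg_right hu' hg0)
    have b2 : (u' ⬝ᵥ A.mulVec (v - v')).re ≤ 1 / 4 * g := by
      refine ((Complex.re_le_norm _).trans (norm_dotProduct_le _ _)).trans ?_
      have h1 := hop (v - v')
      have h2 := hN1 u' hu'N
      have h3 := nrm_nonneg (A.mulVec (v - v'))
      calc nrm u' * nrm (A.mulVec (v - v')) ≤ 1 * (g * (1 / 4)) := by
            gcongr
            exact h1.trans (mul_le_mul_of_nonneg_left hv' hg0)
        _ = _ := by ring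
    have e2 := congrArg Complex.re e1
    rw [hug, Complex.add_re, Complex.add_re] at e2
    simp only [Set.mem_ofPred_eq]
    linarith
  refine (measureReal_mono hsub (measure_ne_top _ _)).trans ((measureReal_biUnion_finset_le _ _).trans ?_)
  -- With l = √n/a the exponent is n - 12n. It beats the at most 9^(4n) ≤ e^(10n) pairs of net
  -- points.
  have hterm : ∀ q ∈ N ×ˢ N, (coins J).real
      {e | 12 * a * √n ≤ (q.1 ⬝ᵥ (signMat idx d e).mulVec q.2).re} ≤ Real.exp (-(11 * n)) := by
    intro q hq
    obtain ⟨h1, h2⟩ := Finset.mem_product.1 hq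
    refine (coins_re_bilin_signMat_ge hidx d ha hd hdiag _ _ (hN1 _ h1) (hN1 _ h2)
      (l := √n / a) (by positivity)).trans (Real.exp_le_exp.2 (le_of_eq ?_))
    have := Real.sq_sqrt hnpos.le
    field_simp
    rw [this]
    ring
  refine (Finset.sum_le_sum hterm).trans ?_
  rw [Finset.sum_const, nsmul_eq_mul, Finset.card_product]
  push_cast
  have h9 : (N.card : ℝ) ≤ Real.exp (5 * n) := by
    refine hNc.trans ?_
    rw [pow_mul, hn, mul_comm (5 : ℝ), Real.exp_nat_mul]
    gcongr
    have := Real.exp_one_gt_d9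
    calc (1 + 2 / (1 / 4) : ℝ) ^ 2 ≤ 2.7 ^ 5 := by norm_num
      _ ≤ Real.exp 1 ^ 5 := by gcongr; linarith
      _ = Real.exp 5 := by rw [← Real.exp_nat_mul]; norm_num
  calc (N.card : ℝ) * N.card * Real.exp (-(11 * n))
      ≤ Real.exp (5 * n) * Real.exp (5 * n) * Real.exp (-(11 * n)) := by gcongr
    _ = Real.exp (-n) := by rw [← Real.exp_add, ← Real.exp_add]; ring_nf

end OperatorNorm


/-! ### Sign matrices are invertible on sparse vectors. -/

section SparseVectors

variable {ι J : Type*} [Fintype ι] [DecidableEq ι] [Fintype J] [DecidableEq J]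

/-- `A` is bounded below by `r` on vectors with at most `m` nonzero coordinates, even if the
corresponding rows are discarded. -/
def Good (A : Matrix ι ι ℂ) (m : ℕ) (r : ℝ) : Prop :=
  ∀ T : Finset ι, T.card ≤ m → ∀ x : ι → ℂ, (∀ i ∉ T, x i = 0) →
    r * nrm x ≤ nrmOn Tᶜ (A.mulVec x)

/-- Weight every set by u to its cardinality: the total weight is (1+u)^n, and small sets weigh at
least u^m. -/
lemma card_finset_card_le {u : ℝ} (hu : 0 < u) (hu1 : u ≤ 1) (m : ℕ) :
    ((Finset.univ.filter fun T : Finset ι => T.card ≤ m).card : ℝ) ≤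
      (1 / u) ^ m * (1 + u) ^ Fintype.card ι := by
  have h := Fintype.sum_pow_mul_eq_add_pow ι u 1
  simp only [one_pow, mul_one] at h
  rw [add_comm 1 u, ← h, Finset.mul_sum, Finset.card_eq_sum_ones, Nat.cast_sum]
  push_cast
  refine (Finset.sum_le_sum fun T hT => ?_).trans
    (Finset.sum_le_sum_of_subset_of_nonneg (Finset.subset_univ _) fun T _ _ => by positivity)
  have hT' : T.card ≤ m := (Finset.mem_filter.1 hT).2
  rw [one_div, inv_pow, ← div_eq_inv_mul, one_le_div (by positivity)]
  exact pow_le_pow_of_le_one hu.le hu1 hT'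

/-- `M` is arbitrary, so a net of the sphere would not control `M.mulVec`. The net is taken instead
for the graph norm of x ↦ n^(-1/2) Mx off `T`; its cardinality depends only on the real dimension
2|T|. -/
lemma coins_not_bounded_below_le {idx : ι → ι → J} (hidx : IsPairIndex idx)
    (d : ι → ι → ℂ) (M : Matrix ι ι ℂ) {a c₀ n r₀ K ε : ℝ} (ha : 0 < a) (hc₀ : 0 < c₀) (hn : 0 < n)
    (hd : ∀ i j, ‖d i j‖ ≤ a) (T : Finset ι) (hcol : ∀ j, c₀ * n ≤ ∑ i ∈ Tᶜ, ‖d i j‖ ^ 2)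
    (hr₀ : 0 < r₀) (hr₀c : (2 * r₀) ^ 2 ≤ c₀ / 16) (hK : 0 ≤ K) (hε : 0 < ε) (hε2 : ε ≤ 1 / 2)
    (hεr : (K + 1) * ε ≤ r₀) :
    (coins J).real {e | OpLe (signMat idx d e) (K * √n) ∧ ∃ x : ι → ℂ, (∀ i ∉ T, x i = 0) ∧
        nrmOn Tᶜ ((M + signMat idx d e).mulVec x) < r₀ * √n * nrm x} ≤
      (1 + 2 * (1 + r₀ + K) / ε) ^ (2 * T.card) * Real.exp (-(c₀ * n / (192 * a ^ 2))) := by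
  have hsn : 0 < √n := Real.sqrt_pos.2 hn
  let ext : (T → ℂ) →ₗ[ℝ] (ι → ℂ) :=
    { toFun := fun x i => if h : i ∈ T then x ⟨i, h⟩ else 0
      map_add' := fun x y => by funext i; by_cases h : i ∈ T <;> simp [h]
      map_smul' := fun c x => by funext i; by_cases h : i ∈ T <;> simp [h] }
  let L2 : (ι → ℂ) →ₗ[ℝ] (ι → ℂ) :=
    { toFun := fun x => Tᶜ.piecewise (((√n)⁻¹ : ℂ) • M.mulVec x) 0
      map_add' := fun x y => by
        funext i
        by_cases h : i ∈ Tᶜ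
        · simp only [Finset.piecewise_eq_of_mem _ _ _ h, Matrix.mulVec_add, smul_add, Pi.add_apply]
        · simp only [Finset.piecewise_eq_of_notMem _ _ _ h, Pi.add_apply, Pi.zero_apply, add_zero]
      map_smul' := fun c x => by
        funext i
        by_cases h : i ∈ Tᶜ
        · simp only [Finset.piecewise_eq_of_mem _ _ _ h, Matrix.mulVec_smul, Pi.smul_apply,
            RingHom.id_apply]
          rw [smul_comm]
        · simp only [Finset.piecewise_eq_of_notMem _ _ _ h, Pi.smul_apply, Pi.zero_apply,
            smul_zero] }
  let toE : (ι → ℂ) →ₗ[ℝ] EuclideanSpace ℂ ι :=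
    (WithLp.linearEquiv 2 ℝ (ι → ℂ)).symm.toLinearMap
  let L : (T → ℂ) →ₗ[ℝ] EuclideanSpace ℂ ι × EuclideanSpace ℂ ι :=
    (toE.prod (toE ∘ₗ L2)) ∘ₗ ext
  have hL : ∀ y, ‖L y‖ = max (nrm (ext y)) ((√n)⁻¹ * nrmOn Tᶜ (M.mulVec (ext y))) := by
    intro y
    have h1 : L y = (WithLp.toLp 2 (ext y), WithLp.toLp 2 (L2 (ext y))) := rfl
    have h2 : L2 (ext y) = ((√n)⁻¹ : ℂ) • Tᶜ.piecewise (M.mulVec (ext y)) 0 := by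
      funext i
      simp only [L2, LinearMap.coe_mk, AddHom.coe_mk, Finset.piecewise, Pi.smul_apply]
      split_ifs <;> simp
    have h3 : nrm (L2 (ext y)) = (√n)⁻¹ * nrmOn Tᶜ (M.mulVec (ext y)) := by
      rw [h2, nrm_smul, nrmOn, norm_inv, Complex.norm_real, Real.norm_eq_abs, abs_of_pos hsn]
    rw [← h3, h1, Prod.norm_def]
    rfl
  obtain ⟨N, hNc, -, hN⟩ := exists_net L (R := 1 + r₀ + K) (by positivity) hε
  have hfr : Module.finrank ℝ (T → ℂ) = 2 * T.card := by
    rw [Module.finrank_pi_fintype]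
    simp [Complex.finrank_real_complex, mul_comm]
  rw [hfr] at hNc
  have hext0 : ∀ y : T → ℂ, ∀ i ∉ T, ext y i = 0 := fun y i hi => by simp [ext, hi]
  let N' := N.filter fun y => 1 / 2 ≤ nrm (ext y) ∧ nrm (ext y) ≤ 2
  have hsub : {e | OpLe (signMat idx d e) (K * √n) ∧ ∃ x : ι → ℂ, (∀ i ∉ T, x i = 0) ∧
        nrmOn Tᶜ ((M + signMat idx d e).mulVec x) < r₀ * √n * nrm x} ⊆
      ⋃ y ∈ N', {e | nrmOn Tᶜ ((signMat idx d e).mulVec (ext y) + M.mulVec (ext y)) ^ 2 ≤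
        c₀ * n / 16} := by
    rintro e ⟨hop, x₀, hx₀, hlt₀⟩
    set S := signMat idx d e
    have hx₀pos : 0 < nrm x₀ := by
      have h1 := (nrmOn_nonneg _ _).trans_lt hlt₀
      by_contra! h
      have : nrm x₀ = 0 := le_antisymm h (nrm_nonneg _)
      simp [this] at h1
    let x : ι → ℂ := ((nrm x₀)⁻¹ : ℂ) • x₀
    have hx1 : nrm x = 1 := by
      rw [nrm_smul, norm_inv, Complex.norm_real, Real.norm_eq_abs, abs_of_pos hx₀pos,
        inv_mul_cancel₀ hx₀pos.ne']
    have hlt : nrmOn Tᶜ ((M + S).mulVec x) < r₀ * √n := by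
      have : nrmOn Tᶜ ((M + S).mulVec x) = (nrm x₀)⁻¹ * nrmOn Tᶜ ((M + S).mulVec x₀) := by
        have h2 : Tᶜ.piecewise ((M + S).mulVec x) 0 =
            ((nrm x₀)⁻¹ : ℂ) • Tᶜ.piecewise ((M + S).mulVec x₀) 0 := by
          funext i
          simp only [x, Matrix.mulVec_smul, Finset.piecewise, Pi.smul_apply]
          split_ifs <;> simp
        rw [nrmOn, h2, nrm_smul, nrmOn, norm_inv, Complex.norm_real, Real.norm_eq_abs,
          abs_of_pos hx₀pos]
      rw [this, inv_mul_lt_iff₀ hx₀pos]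
      linarith
    let xT : T → ℂ := fun i => x i
    have hxT : ext xT = x := by
      funext i
      by_cases h : i ∈ T
      · simp [ext, h, xT]
      · simp [ext, h, x, hx₀ i h]
    -- A vector violating the lower bound has Mx of order √n off `T`, because the sign part does. It
    -- therefore lies in the graph-norm ball that the net covers.
    have hMx : nrmOn Tᶜ (M.mulVec x) ≤ (r₀ + K) * √n := by
      have h1 : M.mulVec x = (M + S).mulVec x - S.mulVec x := by
        rw [Matrix.add_mulVec]; simp
      rw [h1]
      refine (nrmOn_sub_le _ _ _).trans ?_
      have h2 := (nrmOn_le_nrm Tᶜ (S.mulVec x)).trans (hop x)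
      rw [hx1] at h2
      nlinarith
    have hLx : ‖L xT‖ ≤ 1 + r₀ + K := by
      rw [hL, hxT, hx1]
      refine max_le (by linarith) ?_
      rw [inv_mul_le_iff₀ hsn]
      nlinarith
    obtain ⟨y, hyN, hy⟩ := hN xT hLx
    rw [hL, map_sub, hxT] at hy
    have hy1 : nrm (x - ext y) ≤ ε := (le_max_left _ _).trans hy
    have hy2 : nrmOn Tᶜ (M.mulVec (x - ext y)) ≤ ε * √n := by
      have := (le_max_right _ _).trans hy
      rw [inv_mul_le_iff₀ hsn] at this
      linarith
    simp only [Set.mem_iUnion]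
    have hyn1 : 1 / 2 ≤ nrm (ext y) := by
      have h1 := nrm_add_le (x - ext y) (ext y)
      rw [sub_add_cancel, hx1] at h1
      linarith
    have hyn2 : nrm (ext y) ≤ 2 := by
      have h1 := nrm_sub_le x (x - ext y)
      rw [sub_sub_cancel, hx1] at h1
      linarith
    refine ⟨y, Finset.mem_filter.2 ⟨hyN, hyn1, hyn2⟩, ?_⟩
    have h1 : S.mulVec (ext y) + M.mulVec (ext y) =
        ((M + S).mulVec x - S.mulVec (x - ext y)) - M.mulVec (x - ext y) := by
      rw [Matrix.add_mulVec, Matrix.mulVec_sub, Matrix.mulVec_sub]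
      abel
    -- The three contributions are r₀ for x, Kε from the sign part and ε from `M`; the last two add
    -- up to at most r₀.
    have h2 : nrmOn Tᶜ (S.mulVec (ext y) + M.mulVec (ext y)) ≤ 2 * r₀ * √n := by
      rw [h1]
      have h3 := nrmOn_sub_le Tᶜ ((M + S).mulVec x - S.mulVec (x - ext y)) (M.mulVec (x - ext y))
      have h4 := nrmOn_sub_le Tᶜ ((M + S).mulVec x) (S.mulVec (x - ext y))
      have h5 := (nrmOn_le_nrm Tᶜ (S.mulVec (x - ext y))).trans (hop (x - ext y))
      have h6 : K * √n * nrm (x - ext y) ≤ K * √n * ε := by gcongr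
      nlinarith
    simp only [Set.mem_ofPred_eq]
    calc nrmOn Tᶜ (S.mulVec (ext y) + M.mulVec (ext y)) ^ 2 ≤ (2 * r₀ * √n) ^ 2 := by
          gcongr
          exact nrmOn_nonneg _ _
      _ = (2 * r₀) ^ 2 * n := by rw [mul_pow _ √n, Real.sq_sqrt hn.le]
      _ ≤ c₀ / 16 * n := by gcongr
      _ = _ := by ring
  refine (measureReal_mono hsub (measure_ne_top _ _)).trans
    ((measureReal_biUnion_finset_le _ _).trans ?_)
  refine (Finset.sum_le_sum fun y hy => coins_nrmOn_signMat_le hidx d ha hd T hcol (by positivity)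
    (ext y) (hext0 y) (Finset.mem_filter.1 hy).2.1 (Finset.mem_filter.1 hy).2.2 _).trans ?_
  rw [Finset.sum_const, nsmul_eq_mul]
  refine mul_le_mul_of_nonneg_right (le_trans ?_ hNc) (by positivity)
  exact_mod_cast Finset.card_filter_le _ _

/-- Random sign matrices, shifted by an arbitrary deterministic matrix, are well invertible on
sparse vectors with overwhelming probability. -/
theorem exists_coins_not_good_le {a c₀ : ℝ} (ha : 0 < a) (hc₀ : 0 < c₀) :
    ∃ δ r₀ c : ℝ, 0 < δ ∧ 0 < r₀ ∧ 0 < c ∧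
      ∀ {ι J : Type} [Fintype ι] [DecidableEq ι] [Nonempty ι] [Fintype J] [DecidableEq J]
        {idx : ι → ι → J}, IsPairIndex idx → ∀ (d : ι → ι → ℂ) (M : Matrix ι ι ℂ),
        (∀ i j, ‖d i j‖ ≤ a) → (∀ i, d i i = 0) →
        (∀ j, 2 * c₀ * Fintype.card ι ≤ ∑ i, ‖d i j‖ ^ 2) →
        ∀ m : ℕ, (m : ℝ) ≤ δ * Fintype.card ι →
        (coins J).real {e | ¬ Good (M + signMat idx d e) m (r₀ * √(Fintype.card ι))} ≤
          2 * Real.exp (-(c * Fintype.card ι)) := by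
  set c₁ : ℝ := c₀ / (192 * a ^ 2) with hc₁
  have hc₁pos : 0 < c₁ := by positivity
  -- Chosen so that (2r₀)² = c₀/16, the threshold of the single-vector estimate.
  set r₀ : ℝ := √c₀ / 8 with hr₀
  have hr₀pos : 0 < r₀ := by positivity
  set K : ℝ := 24 * a with hK
  have hKpos : 0 < K := by positivity
  set ε : ℝ := min (1 / 2) (r₀ / (K + 1)) with hε
  have hεpos : 0 < ε := by positivity
  set B : ℝ := (1 + 2 * (1 + r₀ + K) / ε) ^ 2 with hB
  have hB1 : 1 ≤ B := by
    refine one_le_pow₀ ?_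
    have : 0 ≤ 2 * (1 + r₀ + K) / ε := by positivity
    linarith
  -- The single-vector rate is c₁. Choosing `T` and a net point on it costs (1/u)^m (1+u)^n B^m. The
  -- choice of `u`, and then m ≤ c₁n/(4Λ), keep this below e^(c₁n/2). The condition m ≤ c₀n/a²
  -- ensures that discarding `m` rows leaves half of each column.
  set u : ℝ := min 1 (c₁ / 4) with hu
  have hupos : 0 < u := by positivity
  have hu1 : u ≤ 1 := min_le_left _ _
  set Λ : ℝ := Real.log (1 / u) + Real.log B + 1 with hΛ
  have hlogu : 0 ≤ Real.log (1 / u) := Real.log_nonneg (by rw [le_div_iff₀ hupos]; linarith)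
  have hlogB : 0 ≤ Real.log B := Real.log_nonneg hB1
  have hΛpos : 0 < Λ := by positivity
  refine ⟨min (c₀ / a ^ 2) (c₁ / (4 * Λ)), r₀, min 1 (c₁ / 2), by positivity, hr₀pos,
    by positivity, ?_⟩
  intro ι J _ _ _ _ _ idx hidx d M hd hdiag hcol m hm
  set n : ℝ := (Fintype.card ι : ℝ) with hn
  have hnpos : 0 < n := by rw [hn]; exact_mod_cast Fintype.card_pos
  have hm1 : (m : ℝ) * a ^ 2 ≤ c₀ * n := by
    have : (m : ℝ) ≤ c₀ / a ^ 2 * n := hm.trans (by gcongr; exact min_le_left _ _)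
    rw [div_mul_eq_mul_div, le_div_iff₀ (by positivity)] at this
    exact this
  have hm2 : (m : ℝ) * Λ ≤ c₁ * n / 4 := by
    have : (m : ℝ) ≤ c₁ / (4 * Λ) * n := hm.trans (by gcongr; exact min_le_right _ _)
    rw [div_mul_eq_mul_div, le_div_iff₀ (by positivity)] at this
    linarith
  set 𝒯 := Finset.univ.filter fun T : Finset ι => T.card ≤ m
  let bad : Finset ι → Set (J → Bool) := fun T =>
    {e | OpLe (signMat idx d e) (K * √n) ∧ ∃ x : ι → ℂ, (∀ i ∉ T, x i = 0) ∧
      nrmOn Tᶜ ((M + signMat idx d e).mulVec x) < r₀ * √n * nrm x}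
  have hsub : {e | ¬ Good (M + signMat idx d e) m (r₀ * √n)} ⊆
      {e | ¬ OpLe (signMat idx d e) (K * √n)} ∪ ⋃ T ∈ 𝒯, bad T := by
    intro e he
    by_cases hop : OpLe (signMat idx d e) (K * √n)
    · right
      simp only [Set.mem_ofPred_eq, Good, not_forall, not_le] at he
      obtain ⟨T, hT, x, hx, hlt⟩ := he
      simp only [Set.mem_iUnion]
      exact ⟨T, Finset.mem_filter.2 ⟨Finset.mem_univ _, hT⟩, hop, x, hx, hlt⟩
    · left
      exact hop
  have hbad : ∀ T ∈ 𝒯, (coins J).real (bad T) ≤ B ^ m * Real.exp (-(c₁ * n)) := by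
    intro T hT
    have hTm : T.card ≤ m := (Finset.mem_filter.1 hT).2
    have h := coins_not_bounded_below_le hidx d M (n := n) (r₀ := r₀) (K := K) (ε := ε) ha hc₀ hnpos
      hd T (fun j => ?_) hr₀pos ?_ hKpos.le hεpos (min_le_left _ _) ?_
    · refine h.trans ?_
      rw [pow_mul, ← hB, show c₀ * n / (192 * a ^ 2) = c₁ * n by rw [hc₁]; ring]
      gcongr
    · have h1 := hcol j
      rw [← Finset.sum_add_sum_compl T] at h1
      have h2 : ∑ i ∈ T, ‖d i j‖ ^ 2 ≤ m * a ^ 2 := by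
        calc ∑ i ∈ T, ‖d i j‖ ^ 2 ≤ ∑ i ∈ T, a ^ 2 := by
              gcongr with i _
              exact hd i j
          _ = T.card * a ^ 2 := by simp
          _ ≤ m * a ^ 2 := by gcongr
      linarith
    · rw [hr₀]
      have := Real.sq_sqrt hc₀.le
      nlinarith
    · have : ε ≤ r₀ / (K + 1) := min_le_right _ _
      rw [le_div_iff₀ (by positivity)] at this
      linarith
  have hcard := card_finset_card_le (ι := ι) hupos hu1 m
  have hexp1 : (1 / u) ^ m * B ^ m ≤ Real.exp (c₁ * n / 4) := by
    rw [← Real.exp_log (show 0 < (1 / u) ^ m * B ^ m by positivity), Real.log_mul (by positivity)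
      (by positivity), Real.log_pow, Real.log_pow]
    refine Real.exp_le_exp.2 ?_
    have : (0 : ℝ) ≤ m := by positivity
    nlinarith
  have hexp2 : (1 + u) ^ Fintype.card ι ≤ Real.exp (c₁ * n / 4) := by
    calc (1 + u) ^ Fintype.card ι ≤ Real.exp u ^ Fintype.card ι := by
          gcongr
          linarith [Real.add_one_le_exp u]
      _ = Real.exp (n * u) := by rw [← Real.exp_nat_mul]
      _ ≤ _ := by
          refine Real.exp_le_exp.2 ?_
          have : u ≤ c₁ / 4 := min_le_right _ _
          nlinarith
  have hop := coins_not_opLe_signMat_le hidx d ha hd hdiag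
  have hop' : (coins J).real {e | ¬ OpLe (signMat idx d e) (K * √n)} ≤
      Real.exp (-(min 1 (c₁ / 2) * n)) := by
    refine hop.trans (Real.exp_le_exp.2 ?_)
    have : min 1 (c₁ / 2) ≤ 1 := min_le_left _ _
    nlinarith
  have hsum : (coins J).real (⋃ T ∈ 𝒯, bad T) ≤ Real.exp (-(min 1 (c₁ / 2) * n)) := by
    refine (measureReal_biUnion_finset_le _ _).trans ((Finset.sum_le_sum hbad).trans ?_)
    rw [Finset.sum_const, nsmul_eq_mul]
    calc (𝒯.card : ℝ) * (B ^ m * Real.exp (-(c₁ * n)))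
        ≤ ((1 / u) ^ m * (1 + u) ^ Fintype.card ι) * (B ^ m * Real.exp (-(c₁ * n))) := by gcongr
      _ = ((1 / u) ^ m * B ^ m) * (1 + u) ^ Fintype.card ι * Real.exp (-(c₁ * n)) := by ring
      _ ≤ Real.exp (c₁ * n / 4) * Real.exp (c₁ * n / 4) * Real.exp (-(c₁ * n)) := by gcongr
      _ = Real.exp (-(c₁ / 2 * n)) := by rw [← Real.exp_add, ← Real.exp_add]; ring_nf
      _ ≤ _ := by
        refine Real.exp_le_exp.2 ?_
        have : min 1 (c₁ / 2) ≤ c₁ / 2 := min_le_right _ _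
        nlinarith
  refine (measureReal_mono hsub (measure_ne_top _ _)).trans ((measureReal_union_le _ _).trans ?_)
  linarith

end SparseVectors


/-! ### Matrices built from independent pairs. -/

section PairMatrices

/-- The pairs of values of modulus at most `a`. -/
def box (a : ℝ) : Set (ℂ × ℂ) := {y | ‖y.1‖ ≤ a ∧ ‖y.2‖ ≤ a}

lemma measurableSet_box (a : ℝ) : MeasurableSet (box a) :=
  (measurableSet_le measurable_fst.norm measurable_const).inter
    (measurableSet_le measurable_snd.norm measurable_const)

lemma measurableSet_box_and_le (a τ : ℝ) {f : ℂ × ℂ → ℂ} (hf : Measurable f) :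
    MeasurableSet {x : (ℂ × ℂ) × (ℂ × ℂ) |
      (x.1 ∈ box a ∧ x.2 ∈ box a) ∧ 2 * τ ≤ ‖f x.1 - f x.2‖} :=
  ((measurable_fst (measurableSet_box a)).inter (measurable_snd (measurableSet_box a))).inter
    (measurableSet_le measurable_const
      ((hf.comp measurable_fst).sub (hf.comp measurable_snd)).norm)

/-- Quantitative non-degeneracy of the law of a pair of symmetric entries. -/
structure PairLaw (ν : Measure (ℂ × ℂ)) (a τ₁ p₁ τ₂ p₂ : ℝ) : Prop where
  fst : p₂ ≤ (ν.prod ν).real {x | (x.1 ∈ box a ∧ x.2 ∈ box a) ∧ 2 * τ₂ ≤ ‖x.1.1 - x.2.1‖}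
  snd : p₂ ≤ (ν.prod ν).real {x | (x.1 ∈ box a ∧ x.2 ∈ box a) ∧ 2 * τ₂ ≤ ‖x.1.2 - x.2.2‖}
  lin : ∀ α β : ℂ, p₁ ≤ (ν.prod ν).real
    {x | 2 * (τ₁ * max ‖α‖ ‖β‖) ≤ ‖α * (x.1.1 - x.2.1) + β * (x.1.2 - x.2.2)‖}

/-- Needed to pass to the transpose, and to orient the pairs along a row whichever index is the
smaller. -/
lemma PairLaw.map_swap {ν : Measure (ℂ × ℂ)} [IsProbabilityMeasure ν] {a τ₁ p₁ τ₂ p₂ : ℝ}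
    (h : PairLaw ν a τ₁ p₁ τ₂ p₂) : PairLaw (ν.map Prod.swap) a τ₁ p₁ τ₂ p₂ := by
  have hm : (ν.map Prod.swap).prod (ν.map Prod.swap) =
      (ν.prod ν).map (Prod.map Prod.swap Prod.swap) :=
    Measure.map_prod_map _ _ measurable_swap measurable_swap
  have hmeas : Measurable (Prod.map (Prod.swap : ℂ × ℂ → ℂ × ℂ) (Prod.swap : ℂ × ℂ → ℂ × ℂ)) :=
    measurable_swap.prodMap measurable_swap
  have hbox : ∀ y : ℂ × ℂ, y.swap ∈ box a ↔ y ∈ box a := fun y => and_comm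
  refine ⟨?_, ?_, fun α β => ?_⟩
  · rw [hm, map_measureReal_apply hmeas (measurableSet_box_and_le a τ₂ measurable_fst)]
    refine h.snd.trans (le_of_eq ?_)
    congr 1
    ext x
    simp [hbox]
  · rw [hm, map_measureReal_apply hmeas (measurableSet_box_and_le a τ₂ measurable_snd)]
    refine h.fst.trans (le_of_eq ?_)
    congr 1
    ext x
    simp [hbox]
  · rw [hm, map_measureReal_apply hmeas (measurableSet_le measurable_const (by fun_prop))]
    refine (h.lin β α).trans (le_of_eq ?_)
    congr 1
    ext x
    simp [add_comm, max_comm]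

/-- The pairs `i < j`. -/
abbrev PairIdx (n : ℕ) : Type := {p : Fin n × Fin n // p.1 < p.2}

variable {n : ℕ} [Nonempty (PairIdx n)]

/-- The label of the unordered pair `{i, j}`. -/
noncomputable def pidx (i j : Fin n) : PairIdx n :=
  -- The arbitrary label on the diagonal is harmless: `pairMat` vanishes there, and `IsPairIndex`
  -- concerns distinct indices only.
  if h : i < j then ⟨(i, j), h⟩ else if h : j < i then ⟨(j, i), h⟩ else Classical.arbitrary _

lemma pidx_of_lt {i j : Fin n} (h : i < j) : pidx i j = ⟨(i, j), h⟩ := by simp [pidx, h]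

lemma pidx_of_gt {i j : Fin n} (h : j < i) : pidx i j = ⟨(j, i), h⟩ := by
  simp [pidx, h, h.le.not_gt]

lemma isPairIndex_pidx : IsPairIndex (pidx : Fin n → Fin n → PairIdx n) := by
  intro i j k l hij hkl h
  rcases lt_or_gt_of_ne hij with h1 | h1 <;> rcases lt_or_gt_of_ne hkl with h2 | h2
  · rw [pidx_of_lt h1, pidx_of_lt h2] at h
    simp at h
    exact Or.inl h
  · rw [pidx_of_lt h1, pidx_of_gt h2] at h
    simp at h
    exact Or.inr h
  · rw [pidx_of_gt h1, pidx_of_lt h2] at h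
    simp at h
    exact Or.inr ⟨h.2, h.1⟩
  · rw [pidx_of_gt h1, pidx_of_gt h2] at h
    simp at h
    exact Or.inl ⟨h.2, h.1⟩

/-- The matrix with zero diagonal and given pairs of symmetric entries. -/
noncomputable def pairMat (w : PairIdx n → ℂ × ℂ) : Matrix (Fin n) (Fin n) ℂ :=
  Matrix.of fun i j => if i < j then (w (pidx i j)).1 else if j < i then (w (pidx i j)).2 else 0

lemma continuous_pairMat : Continuous (pairMat : (PairIdx n → ℂ × ℂ) → Matrix (Fin n) (Fin n) ℂ) := by
  refine continuous_matrix fun i j => ?_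
  simp only [pairMat, Matrix.of_apply]
  split_ifs <;> fun_prop

/-- An intersection of closed conditions, one per vector; this supplies the measurability of an
event quantified over uncountably many vectors. -/
lemma isClosed_good {X : Type*} [TopologicalSpace X] {ι : Type*} [Fintype ι] [DecidableEq ι]
    {f : X → Matrix ι ι ℂ} (hf : Continuous f) (m : ℕ) (r : ℝ) :
    IsClosed {x | Good (f x) m r} := by
  have : {x | Good (f x) m r} = ⋂ (T : Finset ι) (_ : T.card ≤ m) (y : ι → ℂ)
      (_ : ∀ i ∉ T, y i = 0), {x | r * nrm y ≤ nrmOn Tᶜ ((f x).mulVec y)} := by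
    ext x
    simp [Good]
  rw [this]
  refine isClosed_iInter fun T => isClosed_iInter fun _ => isClosed_iInter fun y =>
    isClosed_iInter fun _ => isClosed_le continuous_const ?_
  refine continuous_nrm.comp (continuous_pi fun i => ?_)
  by_cases hi : i ∈ Tᶜ
  · simp only [Finset.piecewise_eq_of_mem _ _ _ hi]
    exact (continuous_apply i).comp (hf.matrix_mulVec continuous_const)
  · simp only [Finset.piecewise_eq_of_notMem _ _ _ hi]
    exact continuous_const

open Classical in
/-- Half of the difference of two values, if both are truncated. -/
noncomputable def halfDiff (a : ℝ) (x : (ℂ × ℂ) × (ℂ × ℂ)) : ℂ × ℂ :=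
  if x.1 ∈ box a ∧ x.2 ∈ box a then ((2 : ℂ)⁻¹) • (x.2 - x.1) else 0

open Classical in
/-- The middle of two values, if both are truncated. -/
noncomputable def midPoint (a : ℝ) (x : (ℂ × ℂ) × (ℂ × ℂ)) : ℂ × ℂ :=
  if x.1 ∈ box a ∧ x.2 ∈ box a then ((2 : ℂ)⁻¹) • (x.1 + x.2) else x.1

open Classical in
lemma exch_box (a : ℝ) (b : Bool) (x : (ℂ × ℂ) × (ℂ × ℂ)) :
    exch (box a) b x = midPoint a x + (sg b : ℂ) • halfDiff a x := by
  by_cases h : x.1 ∈ box a ∧ x.2 ∈ box a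
  · cases b <;> simp only [exch, midPoint, halfDiff, h, and_self, if_true, and_true, sg_true,
      sg_false, Bool.false_eq_true, if_false] <;> ext <;> simp <;> ring
  · simp [exch, midPoint, halfDiff, h]

-- The entries may be unbounded, but given the two copies the randomness that remains is a sign
-- matrix with entries at most `a` plus a deterministic matrix.
open Classical in
lemma pairMat_exch (a : ℝ) (e : PairIdx n → Bool) (w : PairIdx n → (ℂ × ℂ) × (ℂ × ℂ)) :
    pairMat (fun p => exch (box a) (e p) (w p)) = pairMat (fun p => midPoint a (w p)) +
      signMat pidx (pairMat fun p => halfDiff a (w p)) e := by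
  ext i j
  simp only [pairMat, signMat, Matrix.add_apply, Matrix.of_apply, exch_box]
  split_ifs <;> simp

lemma norm_halfDiff_le {a : ℝ} (ha : 0 < a) (x : (ℂ × ℂ) × (ℂ × ℂ)) :
    ‖(halfDiff a x).1‖ ≤ a ∧ ‖(halfDiff a x).2‖ ≤ a := by
  by_cases h : x.1 ∈ box a ∧ x.2 ∈ box a
  · obtain ⟨⟨h1, h2⟩, h3, h4⟩ := h
    have h5 := norm_sub_le x.2.1 x.1.1
    have h6 := norm_sub_le x.2.2 x.1.2
    rw [halfDiff, if_pos ⟨⟨h1, h2⟩, h3, h4⟩]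
    simp only [Prod.smul_fst, Prod.smul_snd, Prod.fst_sub, Prod.snd_sub, smul_eq_mul, norm_mul,
      norm_inv, Complex.norm_ofNat]
    constructor <;> linarith
  · simp [halfDiff, h, ha.le]

lemma norm_pairMat_halfDiff_le {a : ℝ} (ha : 0 < a) (w : PairIdx n → (ℂ × ℂ) × (ℂ × ℂ))
    (i j : Fin n) : ‖pairMat (fun p => halfDiff a (w p)) i j‖ ≤ a := by
  simp only [pairMat, Matrix.of_apply]
  split_ifs
  · exact (norm_halfDiff_le ha _).1
  · exact (norm_halfDiff_le ha _).2
  · simpa using ha.le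

/-- The columns of the symmetrized matrix are not small. -/
lemma pi_column_small_le (ν : PairIdx n → Measure (ℂ × ℂ)) [∀ p, IsProbabilityMeasure (ν p)]
    {a τ₁ p₁ τ₂ p₂ : ℝ} (hτ₂ : 0 < τ₂) (hν : ∀ p, PairLaw (ν p) a τ₁ p₁ τ₂ p₂) (j : Fin n) :
    (Measure.pi fun p => (ν p).prod (ν p)).real
      {w | ∑ i, ‖pairMat (fun p => halfDiff a (w p)) i j‖ ^ 2 ≤ τ₂ ^ 2 * ((n - 1) * p₂ / 4)} ≤
      Real.exp (-((n - 1) * p₂ / 4)) := by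
  classical
  -- Column `j` contains the first member of a pair when `j` is its larger index, and the second
  -- member otherwise.
  let S : PairIdx n → Set ((ℂ × ℂ) × (ℂ × ℂ)) := fun p => if p.1.2 = j then
    {x | (x.1 ∈ box a ∧ x.2 ∈ box a) ∧ 2 * τ₂ ≤ ‖x.1.1 - x.2.1‖} else
    {x | (x.1 ∈ box a ∧ x.2 ∈ box a) ∧ 2 * τ₂ ≤ ‖x.1.2 - x.2.2‖}
  have hS : ∀ p, MeasurableSet (S p) := fun p => by
    simp only [S]
    split_ifs
    · exact measurableSet_box_and_le a τ₂ measurable_fst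
    · exact measurableSet_box_and_le a τ₂ measurable_snd
  have hinj : Set.InjOn (fun i => pidx i j) (Finset.univ.erase j : Finset (Fin n)) := by
    intro i hi k hk h
    have hi' : i ≠ j := by simpa using hi
    have hk' : k ≠ j := by simpa using hk
    rcases isPairIndex_pidx i j k j hi' hk' h with h | h
    · exact h.1
    · exact absurd h.1 hi'
  set K : Finset (PairIdx n) := (Finset.univ.erase j).image fun i => pidx i j
  have hn : 1 ≤ n := by
    have := j.2
    omega
  have hK : (K.card : ℝ) = n - 1 := by
    rw [Finset.card_image_of_injOn hinj, Finset.card_erase_of_mem (Finset.mem_univ _)]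
    simp [Nat.cast_sub hn]
  have h := pi_card_hits_le (fun p => (ν p).prod (ν p)) K S hS (p := p₂) fun p _ => by
    simp only [S]
    split_ifs
    · exact (hν p).fst
    · exact (hν p).snd
  rw [hK] at h
  refine (measureReal_mono ?_).trans h
  intro w hw
  simp only [Set.mem_ofPred_eq] at hw ⊢
  have hhit : ∀ i ≠ j, w (pidx i j) ∈ S (pidx i j) →
      τ₂ ^ 2 ≤ ‖pairMat (fun p => halfDiff a (w p)) i j‖ ^ 2 := by
    intro i hij hS'
    have key : ∀ y z : ℂ, 2 * τ₂ ≤ ‖y - z‖ → τ₂ ^ 2 ≤ ‖(2 : ℂ)⁻¹ * (z - y)‖ ^ 2 := by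
      intro y z h
      rw [norm_mul, norm_inv, Complex.norm_ofNat, norm_sub_rev]
      gcongr
      linarith
    rcases lt_or_gt_of_ne hij with hlt | hlt
    · have h1 : (pidx i j).1.2 = j := by rw [pidx_of_lt hlt]
      simp only [S, h1, if_true] at hS'
      simp only [pairMat, Matrix.of_apply, hlt, if_true, halfDiff, hS'.1, and_self]
      exact key _ _ hS'.2
    · have h1 : (pidx i j).1.2 ≠ j := by rw [pidx_of_gt hlt]; exact hij
      simp only [S, h1, if_false] at hS'
      simp only [pairMat, Matrix.of_apply, hlt, hlt.le.not_gt, if_true, if_false, halfDiff, hS'.1,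
        and_self]
      exact key _ _ hS'.2
  have hcount : ((K.filter fun p => w p ∈ S p).card : ℝ) * τ₂ ^ 2 ≤
      ∑ i, ‖pairMat (fun p => halfDiff a (w p)) i j‖ ^ 2 := by
    rw [Finset.filter_image, Finset.card_image_of_injOn (hinj.mono
      (Finset.coe_subset.2 (Finset.filter_subset _ _))), ← nsmul_eq_mul,
      ← Finset.sum_const]
    refine (Finset.sum_le_sum fun i hi => ?_).trans
      (Finset.sum_le_sum_of_subset_of_nonneg (Finset.subset_univ _) fun _ _ _ => by positivity)
    obtain ⟨hi1, hi2⟩ := Finset.mem_filter.1 hi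
    exact hhit i (Finset.ne_of_mem_erase hi1) hi2
  have h2 := hcount.trans hw
  rw [mul_comm] at h2
  exact le_of_mul_le_mul_left h2 (by positivity)

end PairMatrices

/-- Matrices with independent pairs of entries, shifted by an arbitrary deterministic matrix, are
well invertible on sparse vectors with overwhelming probability. -/
theorem exists_pi_not_good_le {a τ₂ p₂ : ℝ} (ha : 0 < a) (hτ₂ : 0 < τ₂) (hp₂ : 0 < p₂) :
    ∃ δ r₀ c : ℝ, 0 < δ ∧ 0 < r₀ ∧ 0 < c ∧
      ∀ {n : ℕ} [Nonempty (PairIdx n)] (ν : PairIdx n → Measure (ℂ × ℂ))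
        [∀ p, IsProbabilityMeasure (ν p)] {τ₁ p₁ : ℝ}, (∀ p, PairLaw (ν p) a τ₁ p₁ τ₂ p₂) →
        ∀ (M : Matrix (Fin n) (Fin n) ℂ) (m : ℕ), (m : ℝ) ≤ δ * n →
        (Measure.pi ν).real {w | ¬ Good (M + pairMat w) m (r₀ * √n)} ≤
          (n + 2) * Real.exp (-(c * n)) := by
  classical
  -- The columns are at least τ₂²(n-1)p₂/4 ≥ 2c₀n because n - 1 ≥ n/2. The same factor explains the
  -- rate p₂/8 below.
  obtain ⟨δ, r₀, c, hδ, hr₀, hc, H⟩ := exists_coins_not_good_le ha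
    (c₀ := τ₂ ^ 2 * p₂ / 16) (by positivity)
  refine ⟨δ, r₀, min c (p₂ / 8), hδ, hr₀, by positivity, ?_⟩
  intro n _ ν _ τ₁ p₁ hν M m hm
  have hn2 : 2 ≤ n := by
    obtain ⟨⟨⟨i, j⟩, hij⟩⟩ := ‹Nonempty (PairIdx n)›
    have h1 := Fin.lt_def.1 hij
    have h2 := j.2
    simp only at h1
    omega
  have hn2' : (2 : ℝ) ≤ n := by exact_mod_cast hn2
  have : Nonempty (Fin n) := ⟨⟨0, by omega⟩⟩
  set F : Set (PairIdx n → ℂ × ℂ) := {w | ¬ Good (M + pairMat w) m (r₀ * √n)}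
  have hF : MeasurableSet F :=
    (isClosed_good (continuous_const.add continuous_pairMat) m _).measurableSet.compl
  set T : Set (PairIdx n → (ℂ × ℂ) × (ℂ × ℂ)) := ⋃ j ∈ (Finset.univ : Finset (Fin n)),
    {w | ∑ i, ‖pairMat (fun p => halfDiff a (w p)) i j‖ ^ 2 ≤ τ₂ ^ 2 * ((n - 1) * p₂ / 4)}
  have hT : (Measure.pi fun p => (ν p).prod (ν p)).real T ≤
      n * Real.exp (-(min c (p₂ / 8) * n)) := by
    refine (measureReal_biUnion_finset_le _ _).trans
      ((Finset.sum_le_sum fun j _ => pi_column_small_le ν hτ₂ hν j).trans ?_)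
    rw [Finset.sum_const, nsmul_eq_mul, Finset.card_univ, Fintype.card_fin]
    gcongr
    have : min c (p₂ / 8) ≤ p₂ / 8 := min_le_right _ _
    nlinarith
  have key : ∀ w ∉ T, coins (PairIdx n) {e | (fun p => exch (box a) (e p) (w p)) ∈ F} ≤
      ENNReal.ofReal (2 * Real.exp (-(min c (p₂ / 8) * n))) := by
    intro w hw
    have hw' : ∀ j, τ₂ ^ 2 * ((n - 1) * p₂ / 4) <
        ∑ i, ‖pairMat (fun p => halfDiff a (w p)) i j‖ ^ 2 := by
      intro j
      by_contra! h
      exact hw (Set.mem_biUnion (Finset.mem_coe.2 (Finset.mem_univ j)) h)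
    have h1 := H isPairIndex_pidx (pairMat fun p => halfDiff a (w p))
      (M + pairMat fun p => midPoint a (w p)) (norm_pairMat_halfDiff_le ha w)
      (fun i => by simp [pairMat]) (fun j => ?_) m (by simpa using hm)
    · rw [← ofReal_measureReal]
      refine ENNReal.ofReal_le_ofReal (le_trans (le_of_eq ?_) (h1.trans ?_))
      · congr 1
        ext e
        simp only [F, Set.mem_ofPred_eq, pairMat_exch, add_assoc, Fintype.card_fin]
      · rw [Fintype.card_fin]
        gcongr
        exact min_le_left _ _
    · refine le_trans ?_ (hw' j).le
      rw [Fintype.card_fin]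
      have : 0 < τ₂ ^ 2 * p₂ := by positivity
      nlinarith
  have hmain : Measure.pi ν F ≤ ENNReal.ofReal (n * Real.exp (-(min c (p₂ / 8) * n)) +
      2 * Real.exp (-(min c (p₂ / 8) * n))) := by
    rw [pi_apply_eq_lintegral_coins ν (fun _ => box a) (fun _ => measurableSet_box a) hF]
    calc _ ≤ ∫⁻ w, (T.indicator 1 w + ENNReal.ofReal (2 * Real.exp (-(min c (p₂ / 8) * n))))
          ∂Measure.pi fun j => (ν j).prod (ν j) := by
          refine lintegral_mono fun w => ?_
          by_cases hw : w ∈ T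
          · simp only [hw, Set.indicator_of_mem, Pi.one_apply]
            exact prob_le_one.trans le_self_add
          · exact (key w hw).trans le_add_self
      _ ≤ _ := by
          rw [lintegral_add_right _ measurable_const, ENNReal.ofReal_add (by positivity)
            (by positivity)]
          gcongr
          · refine (lintegral_indicator_one_le T).trans ?_
            rw [← ofReal_measureReal (measure_ne_top _ _)]
            exact ENNReal.ofReal_le_ofReal hT
          · simp
  refine (ENNReal.toReal_le_of_le_ofReal (by positivity) hmain).trans (le_of_eq ?_)
  ring


/-! ### Spread vectors and decoupling of a bilinear form. -/

section Row

variable {ι : Type*} [Fintype ι] [DecidableEq ι]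

/-- The large coordinates of a vector. -/
noncomputable def spread (θ : ℝ) (x : ι → ℂ) : Finset ι := Finset.univ.filter fun i => θ ≤ ‖x i‖

lemma mem_spread {θ : ℝ} {x : ι → ℂ} {i : ι} : i ∈ spread θ x ↔ θ ≤ ‖x i‖ := by simp [spread]

/-- Unit vectors with a small image have many large coordinates. -/
lemma two_mul_le_card_spread {A : Matrix ι ι ℂ} {h : ℕ} {r s θ : ℝ} (hG : Good A (3 * h) r)
    (hop : OpLe A s) (hr : 0 < r) (hrs : r ≤ s) (hθ : 0 ≤ θ)
    (hθr : √(Fintype.card ι) * θ * s ≤ r / 8) {x : ι → ℂ} (hx : nrm x = 1) (U : Finset ι)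
    (hU : U.card ≤ h) (hsmall : nrmOn Uᶜ (A.mulVec x) ≤ r / 4) :
    2 * h ≤ (spread θ x).card := by
  by_contra! hlt
  set S := spread θ x
  set q := √(Fintype.card ι) * θ with hq
  let xS := S.piecewise x 0
  let xR := x - xS
  have hs : 0 < s := hr.trans_le hrs
  have hR : nrm xR ≤ q := by
    refine abs_le_of_sq_le_sq' ?_ (by positivity) |>.2
    rw [nrm_sq, hq, mul_pow, Real.sq_sqrt (by positivity), ← nsmul_eq_mul, ← Finset.card_univ,
      ← Finset.sum_const]
    refine Finset.sum_le_sum fun i _ => ?_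
    by_cases hi : i ∈ S
    · simp [xR, xS, hi]; positivity
    · have : ‖x i‖ < θ := not_le.1 fun h => hi (mem_spread.2 h)
      simp only [xR, xS, Pi.sub_apply, Finset.piecewise_eq_of_notMem _ _ _ hi, Pi.zero_apply,
        sub_zero]
      gcongr
  have hq8 : q ≤ 1 / 8 := by
    by_contra! h'
    nlinarith
  have hS : 1 - q ≤ nrm xS := by
    have h1 := nrm_add_le xR xS
    rw [sub_add_cancel, hx] at h1
    linarith
  -- With fewer than 2h large coordinates, the union with the rows `U` where the image is not
  -- controlled has at most 3h elements. The small coordinates contribute at most r/8 to the image,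
  -- so (7/8)r ≤ r/4 + r/8, a contradiction.
  set T := S ∪ U
  have hT : T.card ≤ 3 * h := (Finset.card_union_le _ _).trans (by omega)
  have h1 := hG T hT xS fun i hi => by
    have : i ∉ S := fun h => hi (Finset.mem_union_left _ h)
    simp [xS, this]
  have h2 : A.mulVec xS = A.mulVec x - A.mulVec xR := by
    rw [← Matrix.mulVec_sub]; simp [xR]
  have h3 : nrmOn Tᶜ (A.mulVec xS) ≤ r / 4 + s * q := by
    rw [h2]
    refine (nrmOn_sub_le _ _ _).trans (add_le_add ?_ ?_)
    · exact (nrmOn_mono (Finset.compl_subset_compl.2 Finset.subset_union_right) _).trans hsmall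
    · exact ((nrmOn_le_nrm _ _).trans (hop _)).trans (by gcongr)
  nlinarith

lemma opLe_transpose {A : Matrix ι ι ℂ} {s : ℝ} (hs : 0 ≤ s) (h : OpLe A s) : OpLe A.transpose s := by
  intro x
  obtain ⟨u, hu, hux⟩ := exists_dotProduct_eq_nrm (A.transpose.mulVec x)
  rw [← hux]
  have h1 : u ⬝ᵥ A.transpose.mulVec x = A.mulVec u ⬝ᵥ x := by
    rw [Matrix.dotProduct_mulVec, Matrix.vecMul_transpose]
  rw [h1]
  refine (Complex.re_le_norm _).trans ((norm_dotProduct_le _ _).trans ?_)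
  refine mul_le_mul_of_nonneg_right ((h u).trans ?_) (nrm_nonneg x)
  nlinarith [nrm_nonneg u]

variable (ν : ι → Measure (ℂ × ℂ)) [∀ i, IsProbabilityMeasure (ν i)]

lemma pi_smallBall_snd_le {a τ₁ p₁ τ₂ p₂ : ℝ} (hp₂ : 0 < p₂) (hτ₂ : 0 < τ₂)
    (hν : ∀ i, PairLaw (ν i) a τ₁ p₁ τ₂ p₂) {h : ℕ} (hh : 1 ≤ h) {K : Finset ι} (hK : h ≤ K.card)
    {θ : ℝ} (hθ : 0 < θ) (c : ι → ℂ) (hc : ∀ i ∈ K, θ ≤ ‖c i‖) (x : ℂ) :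
    (Measure.pi ν).real {w | ‖∑ i, c i * (w i).2 - x‖ < θ * τ₂ / 2} ≤ 5 / √(h * p₂) := by
  refine (pi_smallBall_le ν (fun i y => c i * y.2) (fun i => measurable_snd.const_mul _) K hp₂
    (Finset.card_pos.1 (by omega)) (fun i hi => ((hν i).snd).trans (measureReal_mono ?_)) x).trans ?_
  · rintro y ⟨-, hy⟩
    simp only [Set.mem_ofPred_eq]
    rw [← mul_sub, norm_mul]
    have := hc i hi
    nlinarith
  · have : (0 : ℝ) < h := by exact_mod_cast hh
    gcongr

/-- Only `α` is bounded below. The coefficients `β` are arbitrary and may correlate with `α` in any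
way, which is why `PairLaw.lin` is uniform in both. -/
lemma pi_smallBall_lin_le {a τ₁ p₁ τ₂ p₂ : ℝ} (hp₁ : 0 < p₁) (hτ₁ : 0 ≤ τ₁)
    (hν : ∀ i, PairLaw (ν i) a τ₁ p₁ τ₂ p₂) {h : ℕ} (hh : 1 ≤ h) {K : Finset ι} (hK : h ≤ K.card)
    {t : ℝ} (α β : ι → ℂ) (hα : ∀ i ∈ K, t ≤ ‖α i‖) (x : ℂ) :
    (Measure.pi ν).real {w | ‖∑ i, (α i * (w i).1 + β i * (w i).2) - x‖ < τ₁ * t / 2} ≤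
      5 / √(h * p₁) := by
  refine (pi_smallBall_le ν (fun i y => α i * y.1 + β i * y.2)
    (fun i => (measurable_fst.const_mul _).add (measurable_snd.const_mul _)) K hp₁
    (Finset.card_pos.1 (by omega))
    (fun i hi => ((hν i).lin (α i) (β i)).trans (measureReal_mono ?_)) x).trans ?_
  · intro y hy
    simp only [Set.mem_ofPred_eq] at hy ⊢
    have h1 : t ≤ max ‖α i‖ ‖β i‖ := (hα i hi).trans (le_max_left _ _)
    have h2 : α i * y.1.1 + β i * y.1.2 - (α i * y.2.1 + β i * y.2.2) =
      α i * (y.1.1 - y.2.1) + β i * (y.1.2 - y.2.2) := by ring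
    rw [h2]
    refine le_trans ?_ hy
    gcongr
  · have : (0 : ℝ) < h := by exact_mod_cast hh
    gcongr

/-- Anti-concentration of a bilinear form in a random row and a random column, by decoupling. -/
lemma pi_bilinear_smallBall_le {a τ₁ p₁ τ₂ p₂ : ℝ} (hp₁ : 0 < p₁) (hτ₁ : 0 < τ₁) (hp₂ : 0 < p₂)
    (hτ₂ : 0 < τ₂) (hν : ∀ i, PairLaw (ν i) a τ₁ p₁ τ₂ p₂) {h : ℕ} (hh : 1 ≤ h)
    {B G : Matrix ι ι ℂ} (hBG : B * G = 1) {r s θ γ R : ℝ} (hG : Good B (3 * h) r) (hop : OpLe B s)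
    (hr : 0 < r) (hrs : r ≤ s) (hθ : 0 < θ) (hθr : √(Fintype.card ι) * θ * s ≤ r / 8)
    (v : ι → ℂ) (hv : 2 * h ≤ (spread θ v).card) (hγ : 0 < γ)
    (hγv : ∀ z, γ * ‖v ⬝ᵥ z‖ ≤ nrm (G.mulVec z))
    (hR : 2 * R < τ₁ * (θ * (γ * (θ * τ₂ / 2))) / 2) (y₀ z₀ : ι → ℂ) (a₀ : ℂ) :
    (Measure.pi ν).real {w | ‖a₀ - (fun i => y₀ i + (w i).1) ⬝ᵥ
        G.mulVec (fun i => z₀ i + (w i).2)‖ ≤ R} ≤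
      √(5 / √(h * p₂) + 5 / √(h * p₁)) := by
  set F : Set (ι → ℂ × ℂ) := {w | ‖a₀ - (fun i => y₀ i + (w i).1) ⬝ᵥ
        G.mulVec (fun i => z₀ i + (w i).2)‖ ≤ R} with hFdef
  have hF : MeasurableSet F := by
    have hc : Continuous fun w : ι → ℂ × ℂ => ‖a₀ - (fun i => y₀ i + (w i).1) ⬝ᵥ
        G.mulVec (fun i => z₀ i + (w i).2)‖ := by
      have h1 : Continuous fun w : ι → ℂ × ℂ => (fun i => y₀ i + (w i).1) := by fun_prop
      have h2 : Continuous fun w : ι → ℂ × ℂ => (fun i => z₀ i + (w i).2) := by fun_prop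
      exact (continuous_const.sub
        (h1.dotProduct (continuous_const.matrix_mulVec h2))).norm
    exact (isClosed_le hc continuous_const).measurableSet
  obtain ⟨Ic, hIcv, hIc⟩ := Finset.exists_subset_card_eq (show h ≤ (spread θ v).card by omega)
  set η := θ * τ₂ / 2 with hη
  have hηpos : 0 < η := by positivity
  let vI : ι → ℂ := Ic.piecewise v 0
  -- The rare event that v·z is small, where z is the difference of the two resamplings of the
  -- second coordinates on `Ic`.
  let T : Set ((ι → ℂ × ℂ) × (ι → ℂ × ℂ)) :=
    {p | ‖∑ i, vI i * (p.1 i).2 - ∑ i, vI i * (p.2 i).2‖ < η}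
  have hT : MeasurableSet T := by
    refine measurableSet_lt (Measurable.norm ?_) measurable_const
    fun_prop
  have hTm : ((Measure.pi ν).prod (Measure.pi ν)) T ≤ ENNReal.ofReal (5 / √(h * p₂)) := by
    rw [Measure.prod_apply_symm hT]
    refine (lintegral_mono (g := fun _ => ENNReal.ofReal (5 / √(h * p₂))) fun w'' => ?_).trans
      (by simp)
    have h1 := pi_smallBall_snd_le ν hp₂ hτ₂ hν hh hIc.ge hθ vI
      (fun i hi => by simpa [vI, hi] using mem_spread.1 (hIcv hi)) (∑ i, vI i * (w'' i).2)
    exact ENNReal.le_ofReal_iff_toReal_le (measure_ne_top _ _) (by positivity) |>.2 h1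
  have key : ∀ p ∉ T, Measure.pi ν {w | Icᶜ.piecewise w p.1 ∈ F ∧ Icᶜ.piecewise w p.2 ∈ F} ≤
      ENNReal.ofReal (5 / √(h * p₁)) := by
    rintro ⟨w', w''⟩ hp
    let z : ι → ℂ := Ic.piecewise (fun i => (w' i).2 - (w'' i).2) 0
    let y : ι → ℂ := Ic.piecewise (fun i => (w' i).1 - (w'' i).1) 0
    set α := G.mulVec z with hα
    set β := G.transpose.mulVec y with hβ
    have hvz : v ⬝ᵥ z = ∑ i, vI i * (w' i).2 - ∑ i, vI i * (w'' i).2 := by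
      rw [dotProduct, ← Finset.sum_sub_distrib]
      refine Finset.sum_congr rfl fun i _ => ?_
      by_cases hi : i ∈ Ic <;> simp [z, vI, hi]
      ring
    have hvη : η ≤ ‖v ⬝ᵥ z‖ := by
      rw [hvz]
      exact not_lt.1 hp
    have hαη : γ * η ≤ nrm α := (mul_le_mul_of_nonneg_left hvη hγ.le).trans (hγv z)
    have hαpos : 0 < nrm α := lt_of_lt_of_le (by positivity) hαη
    have hBα : B.mulVec α = z := by rw [hα, Matrix.mulVec_mulVec, hBG, Matrix.one_mulVec]
    let x : ι → ℂ := ((nrm α)⁻¹ : ℂ) • α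
    have hx : nrm x = 1 := by
      rw [nrm_smul, norm_inv, Complex.norm_real, Real.norm_eq_abs, abs_of_pos hαpos,
        inv_mul_cancel₀ hαpos.ne']
    -- `B` maps α to z, which vanishes off `Ic`, so discarding the rows `Ic` makes α/‖α‖ a null
    -- vector. Of its 2h large coordinates, at least h lie outside `Ic`, where the pairs are shared.
    have hsp := two_mul_le_card_spread hG hop hr hrs hθ.le hθr hx Ic hIc.le (by
      have h0 : Icᶜ.piecewise (B.mulVec x) 0 = 0 := by
        funext i
        by_cases hi : i ∈ Ic
        · have : i ∉ Icᶜ := by simpa using hi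
          simp [this]
        · rw [Finset.piecewise_eq_of_mem _ _ _ (by simpa using hi), Matrix.mulVec_smul, hBα]
          simp [z, hi]
      rw [nrmOn, h0, nrm_zero]
      positivity)
    have hK : h ≤ (spread θ x \ Ic).card := by
      have := Finset.le_card_sdiff Ic (spread θ x)
      omega
    let α' : ι → ℂ := Ic.piecewise 0 α
    let β' : ι → ℂ := Ic.piecewise 0 β
    let x₀ : ℂ := -(∑ i, (α i * (y₀ i + Ic.piecewise (fun i => (w' i).1) 0 i) +
      β i * (z₀ i + Ic.piecewise (fun i => (w'' i).2) 0 i)))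
    have hlin := pi_smallBall_lin_le ν hp₁ hτ₁.le hν hh hK (t := θ * nrm α) α' β' (fun i hi => by
      obtain ⟨h1, h2⟩ := Finset.mem_sdiff.1 hi
      have h3 : θ ≤ ‖x i‖ := mem_spread.1 h1
      simp only [x, Pi.smul_apply, smul_eq_mul, norm_mul, norm_inv, Complex.norm_real,
        Real.norm_eq_abs, abs_of_pos hαpos] at h3
      rw [le_inv_mul_iff₀ hαpos] at h3
      simp only [α', Finset.piecewise_eq_of_notMem _ _ _ h2]
      linarith) x₀
    refine (measure_mono ?_).trans
      ((ENNReal.le_ofReal_iff_toReal_le (measure_ne_top _ _) (by positivity)).2 hlin)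
    rintro w ⟨h1, h2⟩
    simp only [Set.mem_ofPred_eq, hFdef] at h1 h2 ⊢
    set Y' : ι → ℂ := fun i => y₀ i + (Icᶜ.piecewise w w' i).1
    set Z' : ι → ℂ := fun i => z₀ i + (Icᶜ.piecewise w w' i).2
    set Y'' : ι → ℂ := fun i => y₀ i + (Icᶜ.piecewise w w'' i).1
    set Z'' : ι → ℂ := fun i => z₀ i + (Icᶜ.piecewise w w'' i).2
    have hy : Y' - Y'' = y := by
      funext i
      by_cases hi : i ∈ Ic <;> simp [Y', Y'', y, hi]
    have hz : Z' - Z'' = z := by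
      funext i
      by_cases hi : i ∈ Ic <;> simp [Z', Z'', z, hi]
    -- The difference of the two bilinear values is affine in the shared pairs, since α and β depend
    -- only on the resampled ones.
    have e1 : Y' ⬝ᵥ G.mulVec Z' - Y'' ⬝ᵥ G.mulVec Z'' = Y' ⬝ᵥ α + β ⬝ᵥ Z'' := by
      have e2 : β ⬝ᵥ Z'' = y ⬝ᵥ G.mulVec Z'' := by
        rw [hβ, Matrix.mulVec_transpose, Matrix.dotProduct_mulVec]
      rw [e2, hα, ← hy, ← hz, Matrix.mulVec_sub, dotProduct_sub, sub_dotProduct]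
      ring
    have e3 : Y' ⬝ᵥ α + β ⬝ᵥ Z'' = ∑ i, (α' i * (w i).1 + β' i * (w i).2) - x₀ := by
      simp only [x₀, sub_neg_eq_add, dotProduct, ← Finset.sum_add_distrib]
      refine Finset.sum_congr rfl fun i _ => ?_
      by_cases hi : i ∈ Ic
      · simp [Y', Z'', α', β', hi]
        ring
      · simp [Y', Z'', α', β', hi]
        ring
    rw [← e3, ← e1]
    have e4 : Y' ⬝ᵥ G.mulVec Z' - Y'' ⬝ᵥ G.mulVec Z'' =
        (a₀ - Y'' ⬝ᵥ G.mulVec Z'') - (a₀ - Y' ⬝ᵥ G.mulVec Z') := by ring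
    rw [e4]
    refine lt_of_le_of_lt (norm_sub_le _ _) ?_
    have e5 : τ₁ * (θ * (γ * η)) ≤ τ₁ * (θ * nrm α) := by gcongr
    linarith
  have hsq : (Measure.pi ν F) ^ 2 ≤ ENNReal.ofReal (5 / √(h * p₂) + 5 / √(h * p₁)) := by
    refine (sq_pi_le_of_decoupling ν Icᶜ hF).trans ?_
    calc _ ≤ ∫⁻ p, (T.indicator 1 p + ENNReal.ofReal (5 / √(h * p₁)))
          ∂(Measure.pi ν).prod (Measure.pi ν) := by
          refine lintegral_mono fun p => ?_
          by_cases hp : p ∈ T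
          · simp only [hp, Set.indicator_of_mem, Pi.one_apply]
            exact prob_le_one.trans le_self_add
          · exact (key p hp).trans le_add_self
      _ ≤ _ := by
          rw [lintegral_add_right _ measurable_const, ENNReal.ofReal_add (by positivity)
            (by positivity)]
          gcongr
          · exact (lintegral_indicator_one_le T).trans hTm
          · simp
  refine Real.le_sqrt_of_sq_le ?_
  rw [measureReal_def, ← ENNReal.toReal_pow]
  exact ENNReal.toReal_le_of_le_ofReal (by positivity) hsq

end Row


/-! ### Bordering a regular minor by a random row and column. -/

section RowColumn

variable {ι : Type*} [Fintype ι] [DecidableEq ι] (ν : ι → Measure (ℂ × ℂ))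
  [∀ i, IsProbabilityMeasure (ν i)]

/-- Given a good submatrix, a random row and column are unlikely to make the bordered matrix nearly
singular. -/
theorem pi_border_le [Nonempty ι] {a τ₁ p₁ τ₂ p₂ : ℝ} (hp₁ : 0 < p₁) (hτ₁ : 0 < τ₁)
    (hτ₁' : τ₁ ≤ 1) (hp₂ : 0 < p₂) (hτ₂ : 0 < τ₂) (hν : ∀ i, PairLaw (ν i) a τ₁ p₁ τ₂ p₂) {h : ℕ}
    (hh : 1 ≤ h) (hcard : 2 * h ≤ Fintype.card ι) {B : Matrix ι ι ℂ} {r s θ ε : ℝ}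
    (hG : Good B (3 * h) r) (hGt : Good B.transpose (3 * h) r) (hop : OpLe B s)
    (hr : 1 ≤ r) (hrs : r ≤ s) (hθ : 0 < θ) (hθr : √(Fintype.card ι) * θ * s ≤ r / 8)
    (hε : 0 < ε) (hεs : 20 * ε * s ^ 2 < θ * (θ * τ₂ / 2) * τ₁) (y₀ z₀ : ι → ℂ) (a₀ : ℂ) :
    (Measure.pi ν).real {w | nrm (fun i => y₀ i + (w i).1) ≤ s ∧ ∃ x : ι → ℂ,
        nrm (B.mulVec x + fun i => z₀ i + (w i).2) ≤ ε ∧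
        ‖a₀ + (fun i => y₀ i + (w i).1) ⬝ᵥ x‖ ≤ ε} ≤
      √(5 / √(h * p₂) + 5 / √(h * p₁)) := by
  have hs : 1 ≤ s := hr.trans hrs
  have hopt := opLe_transpose (by linarith) hop
  have hcpos : (0 : ℝ) < Fintype.card ι := by exact_mod_cast Fintype.card_pos
  have hhpos : (0 : ℝ) < h := by exact_mod_cast hh
  have hcθ : √(Fintype.card ι) * θ ≤ 1 / 8 := by
    by_contra! h'
    nlinarith
  have hc1 : 1 ≤ √(Fintype.card ι : ℝ) :=
    Real.one_le_sqrt.2 (by exact_mod_cast Fintype.card_pos)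
  have hθ1 : θ ≤ 1 / 8 := by nlinarith
  set η := θ * τ₂ / 2 with hη
  have hηpos : 0 < η := by positivity
  -- If `B` is singular, a unit null vector v of its transpose is spread and v·(Bx + Z) = v·Z. A
  -- single linear small ball estimate suffices, without decoupling.
  by_cases hdet : B.det = 0
  · obtain ⟨v₀, hv₀, hv₀B⟩ := Matrix.exists_mulVec_eq_zero_iff.2
      (show B.transpose.det = 0 by rwa [Matrix.det_transpose])
    have hv₀pos : 0 < nrm v₀ := lt_of_le_of_ne (nrm_nonneg _) fun h => hv₀ (nrm_eq_zero.1 h.symm)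
    let v : ι → ℂ := ((nrm v₀)⁻¹ : ℂ) • v₀
    have hv : nrm v = 1 := by
      rw [nrm_smul, norm_inv, Complex.norm_real, Real.norm_eq_abs, abs_of_pos hv₀pos,
        inv_mul_cancel₀ hv₀pos.ne']
    have hvB : B.transpose.mulVec v = 0 := by rw [Matrix.mulVec_smul, hv₀B, smul_zero]
    have hsp := two_mul_le_card_spread hGt hopt (by linarith) hrs hθ.le hθr hv ∅ (by simp)
      (by
        rw [hvB]
        refine (nrmOn_le_nrm _ _).trans ?_
        rw [nrm_zero]
        linarith)
    have hball := pi_smallBall_snd_le ν hp₂ hτ₂ hν hh (show h ≤ (spread θ v).card by omega) hθ v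
      (fun i hi => mem_spread.1 hi) (-(v ⬝ᵥ z₀))
    have hεη : ε < η := by
      have h1 : θ * η * τ₁ ≤ 1 * η * 1 := by gcongr; linarith
      have h2 : ε ≤ ε * s ^ 2 := le_mul_of_one_le_right hε.le (one_le_pow₀ hs)
      linarith
    have hsub : {w : ι → ℂ × ℂ | nrm (fun i => y₀ i + (w i).1) ≤ s ∧ ∃ x : ι → ℂ,
        nrm (B.mulVec x + fun i => z₀ i + (w i).2) ≤ ε ∧
        ‖a₀ + (fun i => y₀ i + (w i).1) ⬝ᵥ x‖ ≤ ε} ⊆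
        {w | ‖∑ i, v i * (w i).2 - -(v ⬝ᵥ z₀)‖ < θ * τ₂ / 2} := by
      rintro w ⟨-, x, hx, -⟩
      simp only [Set.mem_ofPred_eq]
      have e1 : ∑ i, v i * (w i).2 - -(v ⬝ᵥ z₀) =
          v ⬝ᵥ (B.mulVec x + fun i => z₀ i + (w i).2) := by
        rw [dotProduct_add, Matrix.dotProduct_mulVec, ← Matrix.mulVec_transpose, hvB,
          zero_dotProduct]
        simp only [dotProduct, mul_add, Finset.sum_add_distrib]
        ring
      rw [e1]
      refine (norm_dotProduct_le _ _).trans_lt ?_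
      rw [hv, one_mul]
      exact hx.trans_lt hεη
    have hle := (measureReal_mono (μ := Measure.pi ν) hsub (measure_ne_top _ _)).trans hball
    set P := (Measure.pi ν).real {w : ι → ℂ × ℂ | nrm (fun i => y₀ i + (w i).1) ≤ s ∧ ∃ x : ι → ℂ,
        nrm (B.mulVec x + fun i => z₀ i + (w i).2) ≤ ε ∧
        ‖a₀ + (fun i => y₀ i + (w i).1) ⬝ᵥ x‖ ≤ ε}
    have hP0 : 0 ≤ P := measureReal_nonneg
    have hP1 : P ≤ 1 := measureReal_le_one
    -- The linear estimate has no square root; P ≤ 1 gives P² ≤ P.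
    refine Real.le_sqrt_of_sq_le ?_
    have : 0 ≤ 5 / √(h * p₁) := by positivity
    nlinarith
  · set G := B⁻¹ with hGdef
    have hunit : IsUnit B.det := isUnit_iff_ne_zero.2 hdet
    have hBG : B * G = 1 := Matrix.mul_nonsing_inv B hunit
    have hGB : G * B = 1 := Matrix.nonsing_inv_mul B hunit
    obtain ⟨u, hu, hGop⟩ := exists_nrm_eq_one_maximizer G.transpose
    set g := nrm (G.transpose.mulVec u) with hg
    have hBtG : B.transpose.mulVec (G.transpose.mulVec u) = u := by
      rw [Matrix.mulVec_mulVec, ← Matrix.transpose_mul, hGB, Matrix.transpose_one,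
        Matrix.one_mulVec]
    have hgpos : 0 < g := by
      refine lt_of_le_of_ne (nrm_nonneg _) fun h => ?_
      rw [nrm_eq_zero.1 h.symm, Matrix.mulVec_zero] at hBtG
      rw [← hBtG, nrm_zero] at hu
      exact zero_ne_one hu
    set R := ε * (1 + s * g) with hR
    have hsub : {w : ι → ℂ × ℂ | nrm (fun i => y₀ i + (w i).1) ≤ s ∧ ∃ x : ι → ℂ,
        nrm (B.mulVec x + fun i => z₀ i + (w i).2) ≤ ε ∧
        ‖a₀ + (fun i => y₀ i + (w i).1) ⬝ᵥ x‖ ≤ ε} ⊆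
        {w | ‖a₀ - (fun i => y₀ i + (w i).1) ⬝ᵥ G.mulVec (fun i => z₀ i + (w i).2)‖ ≤ R} := by
      rintro w ⟨hY, x, hx1, hx2⟩
      simp only [Set.mem_ofPred_eq]
      set Y : ι → ℂ := fun i => y₀ i + (w i).1
      set Z : ι → ℂ := fun i => z₀ i + (w i).2
      set q := B.mulVec x + Z
      -- Eliminating x leaves the error ε + ‖GᵀY‖ε ≤ ε(1 + gs), by ‖Y‖ ≤ s.
      have e1 : a₀ - Y ⬝ᵥ G.mulVec Z = (a₀ + Y ⬝ᵥ x) - G.transpose.mulVec Y ⬝ᵥ q := by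
        rw [Matrix.mulVec_transpose, ← Matrix.dotProduct_mulVec, Matrix.mulVec_add,
          Matrix.mulVec_mulVec, hGB, Matrix.one_mulVec, dotProduct_add]
        ring
      rw [e1]
      refine (norm_sub_le _ _).trans ?_
      have e2 : ‖G.transpose.mulVec Y ⬝ᵥ q‖ ≤ (g * s) * ε := by
        refine (norm_dotProduct_le _ _).trans ?_
        gcongr
        · exact nrm_nonneg _
        · exact (hGop Y).trans (by gcongr)
      rw [hR]
      linarith
    refine (measureReal_mono (μ := Measure.pi ν) hsub (measure_ne_top _ _)).trans ?_
    have hεs1 : ε * s ≤ ε * s ^ 2 :=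
      mul_le_mul_of_nonneg_left (le_self_pow₀ hs (by norm_num)) hε.le
    have hεs0 : 0 < ε * s := by positivity
    -- If g is large, the normalized image Gᵀu/g is nearly null for Bᵀ, hence spread, and ‖Gz‖ ≥
    -- g|v·z|. The lower bound γ = g then scales like the error R ≤ 2εsg.
    rcases le_or_gt (1 / g) (r / 4) with hgr | hgr
    · let v : ι → ℂ := ((g⁻¹ : ℝ) : ℂ) • G.transpose.mulVec u
      have hv : nrm v = 1 := by
        rw [nrm_smul, Complex.norm_real, norm_inv, Real.norm_eq_abs, abs_of_pos hgpos, ← hg,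
          inv_mul_cancel₀ hgpos.ne']
      have hvB : nrm (B.transpose.mulVec v) = 1 / g := by
        rw [Matrix.mulVec_smul, hBtG, nrm_smul, hu, Complex.norm_real, norm_inv, Real.norm_eq_abs,
          abs_of_pos hgpos, mul_one, one_div]
      have hsp := two_mul_le_card_spread hGt hopt (by linarith) hrs hθ.le hθr hv ∅ (by simp)
        ((nrmOn_le_nrm _ _).trans (hvB.trans_le hgr))
      refine pi_bilinear_smallBall_le ν hp₁ hτ₁ hp₂ hτ₂ hν hh hBG hG hop (by linarith) hrs hθ hθr v
        hsp hgpos (fun z => ?_) ?_ y₀ z₀ a₀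
      · have e1 : v ⬝ᵥ z = ((g⁻¹ : ℝ) : ℂ) * (u ⬝ᵥ G.mulVec z) := by
          rw [smul_dotProduct, Matrix.mulVec_transpose, ← Matrix.dotProduct_mulVec, smul_eq_mul]
        rw [e1, norm_mul, Complex.norm_real, norm_inv, Real.norm_eq_abs, abs_of_pos hgpos,
          mul_inv_cancel_left₀ hgpos.ne']
        refine (norm_dotProduct_le _ _).trans ?_
        rw [hu, one_mul]
      · have h1 : 1 ≤ s * g := by
          rw [div_le_iff₀ hgpos] at hgr
          nlinarith
        have h2 : R ≤ 2 * (ε * s) * g := by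
          calc R ≤ ε * (2 * (s * g)) := mul_le_mul_of_nonneg_left (by linarith) hε.le
            _ = _ := by ring
        have h3 : 20 * (ε * s) * g < θ * η * τ₁ * g := by
          refine mul_lt_mul_of_pos_right ?_ hgpos
          linarith
        have h4 : τ₁ * (θ * (g * η)) = θ * η * τ₁ * g := by ring
        have h5 : 0 < ε * s * g := by positivity
        rw [h4]
        linarith
    -- If g is small, then R ≤ 5εs. The bound ‖B‖ ≤ s gives ‖Gz‖ ≥ ‖z‖/s, so γ = 1/s works for any
    -- spread unit vector, here the constant one.
    · let v : ι → ℂ := fun _ => (((√(Fintype.card ι))⁻¹ : ℝ) : ℂ)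
      have hcs : 0 < √(Fintype.card ι : ℝ) := by positivity
      have hvn : ∀ i, ‖v i‖ = (√(Fintype.card ι))⁻¹ := fun i => by
        simp only [v, Complex.norm_real, norm_inv, Real.norm_eq_abs, abs_of_pos hcs]
      have hv : nrm v = 1 := by
        have : nrm v ^ 2 = 1 := by
          rw [nrm_sq]
          simp only [hvn, Finset.sum_const, Finset.card_univ, nsmul_eq_mul, inv_pow,
            Real.sq_sqrt hcpos.le]
          field_simp
        nlinarith [nrm_nonneg v]
      have hsp : 2 * h ≤ (spread θ v).card := by
        have : spread θ v = Finset.univ := by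
          ext i
          simp only [mem_spread, hvn, Finset.mem_univ, iff_true]
          rw [le_inv_comm₀ hθ hcs, le_inv_comm₀ hcs hθ, ← one_div, le_div_iff₀ hcs]
          linarith
        rw [this, Finset.card_univ]
        exact hcard
      refine pi_bilinear_smallBall_le ν hp₁ hτ₁ hp₂ hτ₂ hν hh hBG hG hop (by linarith) hrs hθ hθr v
        hsp (γ := s⁻¹) (by positivity) (fun z => ?_) ?_ y₀ z₀ a₀
      · rw [inv_mul_le_iff₀ (by positivity)]
        refine (norm_dotProduct_le _ _).trans ?_
        rw [hv, one_mul]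
        have e1 := hop (G.mulVec z)
        rwa [Matrix.mulVec_mulVec, hBG, Matrix.one_mulVec] at e1
      · have h1 : g < 4 := by
          rw [lt_div_iff₀ hgpos] at hgr
          nlinarith
        have h2 : R ≤ 5 * (ε * s) := by
          have h5 : 1 + s * g ≤ 5 * s := by nlinarith
          calc R ≤ ε * (5 * s) := mul_le_mul_of_nonneg_left h5 hε.le
            _ = _ := by ring
        have h3 : 20 * (ε * s) < θ * η * τ₁ * s⁻¹ := by
          rw [← div_eq_mul_inv, lt_div_iff₀ (by positivity)]
          calc 20 * (ε * s) * s = 20 * ε * s ^ 2 := by ring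
            _ < _ := hεs
        have h4 : τ₁ * (θ * (s⁻¹ * η)) = θ * η * τ₁ * s⁻¹ := by ring
        rw [h4]
        linarith

end RowColumn


/-! ### From truncated moments to spread of the pairs. -/

section Truncation

variable {Ω : Type*} [MeasurableSpace Ω]

/-- The mean minimizes the quadratic error; applied below with `c` coming from an independent copy.
-/
lemma cvar_le_integral (κ : Measure Ω) [IsProbabilityMeasure κ] {ξ : Ω → ℂ} (hξ : Measurable ξ)
    {R : ℝ} (hR : ∀ᵐ ω ∂κ, ‖ξ ω‖ ≤ R) (c : ℂ) : cvar κ ξ ≤ ∫ ω, ‖ξ ω - c‖ ^ 2 ∂κ := by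
  set m := ∫ ω', ξ ω' ∂κ with hm
  have hi : Integrable ξ κ := .of_bound hξ.aestronglyMeasurable R hR
  have hi2 : ∀ c : ℂ, Integrable (fun ω => ‖ξ ω - c‖ ^ 2) κ := fun c => by
    refine .of_bound (C := (R + ‖c‖) ^ 2) ((hξ.sub_const c).norm.pow_const 2).aestronglyMeasurable ?_
    filter_upwards [hR] with ω hω
    rw [norm_pow, norm_norm]
    gcongr
    exact (norm_sub_le _ _).trans (by gcongr)
  have hexp : ∀ ω, ‖ξ ω - c‖ ^ 2 = ‖ξ ω - m‖ ^ 2 + 2 * ((starRingEnd ℂ (m - c)) * (ξ ω - m)).re +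
      ‖m - c‖ ^ 2 := by
    intro ω
    simp only [← Complex.normSq_eq_norm_sq, Complex.normSq_apply, Complex.mul_re, Complex.conj_re,
      Complex.conj_im, Complex.sub_re, Complex.sub_im]
    ring
  have hz : ∫ ω, ((starRingEnd ℂ (m - c)) * (ξ ω - m)).re ∂κ = 0 := by
    have h1 : ∫ ω, (starRingEnd ℂ (m - c)) * (ξ ω - m) ∂κ = 0 := by
      rw [integral_const_mul, integral_sub hi (integrable_const _)]
      simp [hm]
    have h2 := integral_re (𝕜 := ℂ) ((hi.sub (integrable_const m)).const_mul (starRingEnd ℂ (m - c)))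
    simp only [Pi.sub_apply, RCLike.re_to_complex] at h2
    rw [h2, h1]
    simp
  have hre : Integrable (fun ω => ((starRingEnd ℂ (m - c)) * (ξ ω - m)).re) κ :=
    ((hi.sub (integrable_const m)).const_mul (starRingEnd ℂ (m - c))).re
  have hadd : Integrable (fun ω => ‖ξ ω - m‖ ^ 2 +
      2 * ((starRingEnd ℂ (m - c)) * (ξ ω - m)).re) κ := (hi2 m).add (hre.const_mul 2)
  simp only [hexp]
  rw [integral_add hadd (integrable_const _),
    integral_add (hi2 m) (hre.const_mul 2), integral_const_mul, hz]
  simp only [cvar, integral_const, probReal_univ, smul_eq_mul, one_mul, mul_zero, add_zero]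
  rw [← hm]
  nlinarith [sq_nonneg ‖m - c‖]

/-- The cross term is at most 2ρ|α||β|√(Var Y Var Z) ≤ ρ(|α|² Var Y + |β|² Var Z). This is where the
factor 1-ρ arises. -/
lemma cvar_lin_ge (κ : Measure Ω) [IsProbabilityMeasure κ] {Y Z : Ω → ℂ} (hY : Measurable Y)
    (hZ : Measurable Z) {R ρ σ : ℝ} (hYR : ∀ᵐ ω ∂κ, ‖Y ω‖ ≤ R) (hZR : ∀ᵐ ω ∂κ, ‖Z ω‖ ≤ R)
    (hσ : 0 < σ) (hVY : σ ^ 2 ≤ cvar κ Y) (hVZ : σ ^ 2 ≤ cvar κ Z) (hρ : ρ < 1)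
    (hcorr : ‖ccorr κ Y Z‖ ≤ ρ) (α β : ℂ) :
    (1 - ρ) * σ ^ 2 * (‖α‖ ^ 2 + ‖β‖ ^ 2) ≤ cvar κ (fun ω => α * Y ω + β * Z ω) := by
  have hiY : Integrable Y κ := .of_bound hY.aestronglyMeasurable R hYR
  have hiZ : Integrable Z κ := .of_bound hZ.aestronglyMeasurable R hZR
  set m := ∫ ω', Y ω' ∂κ with hm
  set k := ∫ ω', Z ω' ∂κ with hk
  have hi2 : ∀ (X : Ω → ℂ), Measurable X → (∀ᵐ ω ∂κ, ‖X ω‖ ≤ R) → ∀ c : ℂ,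
      Integrable (fun ω => ‖X ω - c‖ ^ 2) κ := fun X hX hXR c => by
    refine .of_bound (C := (R + ‖c‖) ^ 2) ((hX.sub_const c).norm.pow_const 2).aestronglyMeasurable ?_
    filter_upwards [hXR] with ω hω
    rw [norm_pow, norm_norm]
    gcongr
    exact (norm_sub_le _ _).trans (by gcongr)
  have hprod : Integrable (fun ω => (Y ω - m) * (starRingEnd ℂ) (Z ω - k)) κ := by
    refine .of_bound (C := (R + ‖m‖) * (R + ‖k‖)) ((hY.sub_const m).mul
      (Complex.continuous_conj.measurable.comp (hZ.sub_const k))).aestronglyMeasurable ?_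
    filter_upwards [hYR, hZR] with ω h1 h2
    rw [norm_mul, RCLike.norm_conj]
    have h3 := (norm_sub_le (Y ω) m)
    have h4 := (norm_sub_le (Z ω) k)
    gcongr
    · exact add_nonneg ((norm_nonneg _).trans h1) (norm_nonneg _)
    · linarith
    · linarith
  have hmean : ∫ ω, (α * Y ω + β * Z ω) ∂κ = α * m + β * k := by
    rw [integral_add (hiY.const_mul _) (hiZ.const_mul _), integral_const_mul, integral_const_mul]
  have hexp : ∀ ω, ‖α * Y ω + β * Z ω - (α * m + β * k)‖ ^ 2 = ‖α‖ ^ 2 * ‖Y ω - m‖ ^ 2 +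
      ‖β‖ ^ 2 * ‖Z ω - k‖ ^ 2 +
      2 * (α * (starRingEnd ℂ) β * ((Y ω - m) * (starRingEnd ℂ) (Z ω - k))).re := by
    intro ω
    simp only [← Complex.normSq_eq_norm_sq, Complex.normSq_apply, Complex.mul_re, Complex.mul_im,
      Complex.conj_re, Complex.conj_im, Complex.sub_re, Complex.sub_im, Complex.add_re,
      Complex.add_im]
    ring
  have hcov : cvar κ (fun ω => α * Y ω + β * Z ω) = ‖α‖ ^ 2 * cvar κ Y + ‖β‖ ^ 2 * cvar κ Z +
      2 * (α * (starRingEnd ℂ) β * ccov κ Y Z).re := by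
    have hre := integral_re (𝕜 := ℂ) (hprod.const_mul (α * (starRingEnd ℂ) β))
    simp only [RCLike.re_to_complex] at hre
    have hire : Integrable (fun ω => (α * (starRingEnd ℂ) β *
        ((Y ω - m) * (starRingEnd ℂ) (Z ω - k))).re) κ :=
      (hprod.const_mul (α * (starRingEnd ℂ) β)).re
    rw [cvar, hmean]
    simp only [hexp]
    have hadd : Integrable (fun ω => ‖α‖ ^ 2 * ‖Y ω - m‖ ^ 2 + ‖β‖ ^ 2 * ‖Z ω - k‖ ^ 2) κ :=
      ((hi2 Y hY hYR m).const_mul _).add ((hi2 Z hZ hZR k).const_mul _)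
    rw [integral_add hadd (hire.const_mul 2), integral_add ((hi2 Y hY hYR m).const_mul _)
      ((hi2 Z hZ hZR k).const_mul _), integral_const_mul, integral_const_mul, integral_const_mul,
      hre, integral_const_mul]
    rfl
  have hσ2 : 0 < σ ^ 2 := by positivity
  have hVYp : 0 < cvar κ Y := hσ2.trans_le hVY
  have hVZp : 0 < cvar κ Z := hσ2.trans_le hVZ
  have hρ0 : 0 ≤ ρ := (norm_nonneg _).trans hcorr
  have hcc : ‖ccov κ Y Z‖ ≤ ρ * (√(cvar κ Y) * √(cvar κ Z)) := by
    rw [ccorr, norm_div, Complex.norm_real, Real.norm_eq_abs, abs_of_nonneg (Real.sqrt_nonneg _),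
      div_le_iff₀ (Real.sqrt_pos.2 (mul_pos hVYp hVZp)), Real.sqrt_mul hVYp.le] at hcorr
    exact hcorr
  have hcross : -(ρ * (‖α‖ ^ 2 * cvar κ Y + ‖β‖ ^ 2 * cvar κ Z)) ≤
      2 * (α * (starRingEnd ℂ) β * ccov κ Y Z).re := by
    have h1 := (abs_le.1 (Complex.abs_re_le_norm (α * (starRingEnd ℂ) β * ccov κ Y Z))).1
    rw [norm_mul, norm_mul, RCLike.norm_conj] at h1
    have h2 : ‖α‖ * ‖β‖ * ‖ccov κ Y Z‖ ≤ ‖α‖ * ‖β‖ * (ρ * (√(cvar κ Y) * √(cvar κ Z))) := by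
      gcongr
    have h3 := two_mul_le_add_sq (‖α‖ * √(cvar κ Y)) (‖β‖ * √(cvar κ Z))
    rw [mul_pow, mul_pow, Real.sq_sqrt hVYp.le, Real.sq_sqrt hVZp.le] at h3
    have h4 := mul_le_mul_of_nonneg_left h3 hρ0
    nlinarith
  rw [hcov]
  have h5 : ‖α‖ ^ 2 * σ ^ 2 ≤ ‖α‖ ^ 2 * cvar κ Y := by gcongr
  have h6 : ‖β‖ ^ 2 * σ ^ 2 ≤ ‖β‖ ^ 2 * cvar κ Z := by gcongr
  have h7 := mul_le_mul_of_nonneg_left (add_le_add h5 h6) (sub_nonneg.2 hρ.le)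
  nlinarith

/-- A lower bound on the conditional variance yields a lower bound on the probability that two
independent copies are far apart. -/
lemma le_prod_real_far (μ : Measure Ω) [IsProbabilityMeasure μ] {Y Z : Ω → ℂ} (hY : Measurable Y)
    (hZ : Measurable Z) {a b V S : ℝ} (hb : 0 < b)
    (hE : b ≤ μ.real {ω | ‖Y ω‖ ≤ a ∧ ‖Z ω‖ ≤ a}) {f : ℂ × ℂ → ℂ} (hf : Measurable f)
    (hV : V ≤ cvar μ[|{ω | ‖Y ω‖ ≤ a ∧ ‖Z ω‖ ≤ a}] fun ω => f (Y ω, Z ω)) (hV0 : 0 ≤ V)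
    (hS : 0 < S) {R : ℝ} (hR : ∀ x ∈ box a, ‖f x‖ ≤ R)
    (hfS : ∀ x ∈ box a, ∀ x' ∈ box a, ‖f x - f x'‖ ^ 2 ≤ S) {τ : ℝ} (hτ : 8 * τ ^ 2 ≤ b * V) :
    b ^ 2 * V / (2 * S) ≤ ((μ.map fun ω => (Y ω, Z ω)).prod (μ.map fun ω => (Y ω, Z ω))).real
      {x | (x.1 ∈ box a ∧ x.2 ∈ box a) ∧ 2 * τ ≤ ‖f x.1 - f x.2‖} := by
  set E : Set Ω := {ω | ‖Y ω‖ ≤ a ∧ ‖Z ω‖ ≤ a} with hEdef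
  have hW : Measurable fun ω => (Y ω, Z ω) := hY.prodMk hZ
  set ν := μ.map fun ω => (Y ω, Z ω) with hν
  have : IsProbabilityMeasure ν := Measure.isProbabilityMeasure_map hW.aemeasurable
  have hEm : MeasurableSet E := hW (measurableSet_box a)
  have hEpos : 0 < μ.real E := hb.trans_le hE
  have hE0 : μ E ≠ 0 := fun h => by simp [measureReal_def, h] at hEpos
  have : IsProbabilityMeasure μ[|E] := cond_isProbabilityMeasure hE0
  have hmem : ∀ᵐ ω ∂μ[|E], ω ∈ E := ae_cond_mem hEm
  have hbox : ν.real (box a) = μ.real E := map_measureReal_apply hW (measurableSet_box a)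
  -- Freeze the second copy at x'. The conditional mean of |f - f(x')|² is at least V, near points
  -- contribute at most 4τ² and far points at most S times their probability; since 8τ² ≤ bV, half
  -- of the mass remains.
  have hsec : ∀ x' ∈ box a, b * V / (2 * S) ≤
      ν.real {x | x ∈ box a ∧ 2 * τ ≤ ‖f x - f x'‖} := by
    intro x' hx'
    have hmS : MeasurableSet {x | x ∈ box a ∧ 2 * τ ≤ ‖f x - f x'‖} :=
      (measurableSet_box a).inter (measurableSet_le measurable_const (hf.sub_const _).norm)
    set D : Set Ω := {ω | 2 * τ ≤ ‖f (Y ω, Z ω) - f x'‖} with hD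
    have hDm : MeasurableSet D := measurableSet_le measurable_const ((hf.comp hW).sub_const _).norm
    have e1 : ν.real {x | x ∈ box a ∧ 2 * τ ≤ ‖f x - f x'‖} = μ.real (E ∩ D) :=
      map_measureReal_apply hW hmS
    have e2 : cvar μ[|E] (fun ω => f (Y ω, Z ω)) ≤ ∫ ω, ‖f (Y ω, Z ω) - f x'‖ ^ 2 ∂μ[|E] :=
      cvar_le_integral _ (hf.comp hW) (hmem.mono fun ω hω => hR _ hω) _
    have hDi : Integrable (D.indicator fun _ => S) μ[|E] :=
      (integrable_const S).indicator hDm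
    have e3 : ∫ ω, ‖f (Y ω, Z ω) - f x'‖ ^ 2 ∂μ[|E] ≤
        ∫ ω, (4 * τ ^ 2 + D.indicator (fun _ => S) ω) ∂μ[|E] := by
      refine integral_mono_of_nonneg (Filter.Eventually.of_forall fun ω => by positivity)
        ((integrable_const _).add hDi) ?_
      filter_upwards [hmem] with ω hω
      by_cases hωD : ω ∈ D
      · rw [Set.indicator_of_mem hωD]
        have := hfS _ (show (Y ω, Z ω) ∈ box a from hω) x' hx'
        nlinarith [sq_nonneg τ]
      · rw [Set.indicator_of_notMem hωD, add_zero]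
        have h1 : ‖f (Y ω, Z ω) - f x'‖ < 2 * τ := not_le.1 hωD
        have h2 := norm_nonneg (f (Y ω, Z ω) - f x')
        nlinarith
    rw [integral_add (integrable_const _) hDi, integral_indicator_const _ hDm] at e3
    simp only [integral_const, probReal_univ, smul_eq_mul, one_mul] at e3
    have e4 : (μ[|E]).real D = (μ.real E)⁻¹ * μ.real (E ∩ D) := by
      simp only [measureReal_def]
      rw [cond_apply hEm, ENNReal.toReal_mul, ENNReal.toReal_inv]
    rw [e4] at e3
    have e5 : V ≤ 4 * τ ^ 2 + (μ.real E)⁻¹ * μ.real (E ∩ D) * S := hV.trans (e2.trans e3)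
    have e6 : μ.real E * V ≤ μ.real E * (4 * τ ^ 2) + μ.real (E ∩ D) * S := by
      have := mul_le_mul_of_nonneg_left e5 hEpos.le
      rw [mul_add, ← mul_assoc (μ.real E) (_ * _) S, mul_inv_cancel_left₀ hEpos.ne'] at this
      exact this
    have e7 : μ.real E ≤ 1 := measureReal_le_one
    rw [e1, div_le_iff₀ (by positivity)]
    have e8 : b * V ≤ μ.real E * V := by gcongr
    have e9 : μ.real E * (4 * τ ^ 2) ≤ 1 * (4 * τ ^ 2) := by gcongr
    linarith
  have hA := measurableSet_box_and_le a τ hf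
  have hlow : ENNReal.ofReal (b * V / (2 * S)) * ν (box a) ≤ (ν.prod ν)
      {x | (x.1 ∈ box a ∧ x.2 ∈ box a) ∧ 2 * τ ≤ ‖f x.1 - f x.2‖} := by
    rw [Measure.prod_apply_symm hA, ← lintegral_indicator_const (measurableSet_box a)]
    refine lintegral_mono fun x' => ?_
    by_cases hx' : x' ∈ box a
    · rw [Set.indicator_of_mem hx']
      refine ENNReal.ofReal_le_of_le_toReal ((hsec x' hx').trans (le_of_eq ?_))
      rw [measureReal_def]
      congr 2
      ext x
      simp [hx']
    · rw [Set.indicator_of_notMem hx']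
      exact zero_le
  have h1 := ENNReal.toReal_mono (measure_ne_top _ _) hlow
  rw [ENNReal.toReal_mul, ENNReal.toReal_ofReal (by positivity)] at h1
  refine le_trans ?_ h1
  rw [← measureReal_def, hbox]
  calc b ^ 2 * V / (2 * S) = b * V / (2 * S) * b := by ring
    _ ≤ _ := by gcongr

/-- The hypotheses on the truncated moments make the law of a pair of entries non-degenerate. -/
lemma pairLaw_map (μ : Measure Ω) [IsProbabilityMeasure μ] {Y Z : Ω → ℂ} (hY : Measurable Y)
    (hZ : Measurable Z) {a b σ ρ τ : ℝ} (ha : 0 < a) (hb : 0 < b) (hσ : 0 < σ) (hρ : ρ < 1)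
    (hE : b ≤ μ.real {ω | ‖Y ω‖ ≤ a ∧ ‖Z ω‖ ≤ a})
    (hVY : σ ^ 2 ≤ cvar μ[|{ω | ‖Y ω‖ ≤ a ∧ ‖Z ω‖ ≤ a}] Y)
    (hVZ : σ ^ 2 ≤ cvar μ[|{ω | ‖Y ω‖ ≤ a ∧ ‖Z ω‖ ≤ a}] Z)
    (hcorr : ‖ccorr μ[|{ω | ‖Y ω‖ ≤ a ∧ ‖Z ω‖ ≤ a}] Y Z‖ ≤ ρ) (hτ : 8 * τ ^ 2 ≤ b * σ ^ 2) :
    PairLaw (μ.map fun ω => (Y ω, Z ω)) a (√(1 - ρ) * τ) (b ^ 2 * ((1 - ρ) * σ ^ 2) / (16 * a ^ 2))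
      τ (b ^ 2 * σ ^ 2 / (8 * a ^ 2)) := by
  set E : Set Ω := {ω | ‖Y ω‖ ≤ a ∧ ‖Z ω‖ ≤ a} with hEdef
  have hW : Measurable fun ω => (Y ω, Z ω) := hY.prodMk hZ
  set ν := μ.map fun ω => (Y ω, Z ω) with hν
  have : IsProbabilityMeasure ν := Measure.isProbabilityMeasure_map hW.aemeasurable
  have hEm : MeasurableSet E := hW (measurableSet_box a)
  have hEpos : 0 < μ.real E := hb.trans_le hE
  have hE0 : μ E ≠ 0 := fun h => by simp [measureReal_def, h] at hEpos
  have : IsProbabilityMeasure μ[|E] := cond_isProbabilityMeasure hE0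
  have hmem : ∀ᵐ ω ∂μ[|E], ω ∈ E := ae_cond_mem hEm
  have hsq4 : ∀ y z : ℂ, ‖y‖ ≤ a → ‖z‖ ≤ a → ‖y - z‖ ^ 2 ≤ 4 * a ^ 2 := by
    intro y z hy hz
    have h1 := norm_sub_le y z
    have h2 := norm_nonneg (y - z)
    nlinarith
  have hlin : ∀ α β : ℂ, 0 < ‖α‖ ^ 2 + ‖β‖ ^ 2 →
      b ^ 2 * ((1 - ρ) * σ ^ 2) / (16 * a ^ 2) ≤ (ν.prod ν).real
      {x | 2 * (√(1 - ρ) * τ * max ‖α‖ ‖β‖) ≤ ‖α * (x.1.1 - x.2.1) + β * (x.1.2 - x.2.2)‖} := by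
    intro α β hαβ
    have hV := cvar_lin_ge μ[|E] hY hZ (hmem.mono fun ω hω => hω.1) (hmem.mono fun ω hω => hω.2) hσ
      hVY hVZ hρ hcorr α β
    -- V and S both scale like |α|² + |β|², so the resulting probability does not depend on α and β.
    have h := le_prod_real_far μ hY hZ hb hE (f := fun x => α * x.1 + β * x.2)
      (V := (1 - ρ) * σ ^ 2 * (‖α‖ ^ 2 + ‖β‖ ^ 2)) (S := 8 * a ^ 2 * (‖α‖ ^ 2 + ‖β‖ ^ 2))
      ((measurable_fst.const_mul _).add (measurable_snd.const_mul _)) hV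
      (by have := sub_pos.2 hρ; positivity) (by positivity) (R := ‖α‖ * a + ‖β‖ * a) ?_ ?_
      (τ := √(1 - ρ) * τ * max ‖α‖ ‖β‖) ?_
    · refine le_trans (le_of_eq ?_) (h.trans (measureReal_mono ?_))
      · field_simp
        ring
      · rintro x ⟨-, hx⟩
        simp only [Set.mem_ofPred_eq] at hx ⊢
        convert hx using 2
        ring
    · rintro x ⟨h1, h2⟩
      refine (norm_add_le _ _).trans ?_
      rw [norm_mul, norm_mul]
      gcongr
    · rintro x ⟨h1, h2⟩ x' ⟨h3, h4⟩
      have e1 : α * x.1 + β * x.2 - (α * x'.1 + β * x'.2) =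
        α * (x.1 - x'.1) + β * (x.2 - x'.2) := by ring
      rw [e1]
      have e2 : ‖α * (x.1 - x'.1) + β * (x.2 - x'.2)‖ ≤ ‖α‖ * (2 * a) + ‖β‖ * (2 * a) := by
        refine (norm_add_le _ _).trans ?_
        rw [norm_mul, norm_mul]
        gcongr
        · exact (norm_sub_le _ _).trans (by linarith)
        · exact (norm_sub_le _ _).trans (by linarith)
      calc ‖α * (x.1 - x'.1) + β * (x.2 - x'.2)‖ ^ 2 ≤ (‖α‖ * (2 * a) + ‖β‖ * (2 * a)) ^ 2 := by
            gcongr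
        _ = 4 * a ^ 2 * (‖α‖ + ‖β‖) ^ 2 := by ring
        _ ≤ 4 * a ^ 2 * (2 * (‖α‖ ^ 2 + ‖β‖ ^ 2)) := by
            gcongr
            nlinarith [sq_nonneg (‖α‖ - ‖β‖)]
        _ = _ := by ring
    · have hmax : (max ‖α‖ ‖β‖) ^ 2 ≤ ‖α‖ ^ 2 + ‖β‖ ^ 2 := by
        rcases max_choice ‖α‖ ‖β‖ with h | h <;> rw [h] <;> nlinarith [sq_nonneg ‖α‖, sq_nonneg ‖β‖]
      calc 8 * (√(1 - ρ) * τ * max ‖α‖ ‖β‖) ^ 2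
          = (1 - ρ) * (8 * τ ^ 2) * (max ‖α‖ ‖β‖) ^ 2 := by
            rw [mul_pow, mul_pow, Real.sq_sqrt (by linarith)]; ring
        _ ≤ (1 - ρ) * (b * σ ^ 2) * (‖α‖ ^ 2 + ‖β‖ ^ 2) := by
            have := sub_pos.2 hρ
            gcongr
        _ = _ := by ring
  refine ⟨?_, ?_, fun α β => ?_⟩
  · have h := le_prod_real_far μ hY hZ hb hE (f := Prod.fst) measurable_fst (V := σ ^ 2) hVY
      (by positivity) (S := 4 * a ^ 2) (by positivity) (R := a) (fun x hx => hx.1)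
      (fun x hx x' hx' => hsq4 _ _ hx.1 hx'.1) hτ
    refine le_trans (le_of_eq ?_) h
    ring
  · have h := le_prod_real_far μ hY hZ hb hE (f := Prod.snd) measurable_snd (V := σ ^ 2) hVZ
      (by positivity) (S := 4 * a ^ 2) (by positivity) (R := a) (fun x hx => hx.2)
      (fun x hx x' hx' => hsq4 _ _ hx.2 hx'.2) hτ
    refine le_trans (le_of_eq ?_) h
    ring
  · rcases (show 0 ≤ ‖α‖ ^ 2 + ‖β‖ ^ 2 by positivity).lt_or_eq with hpos | hzero
    · exact hlin α β hpos
    · have hα : α = 0 := norm_eq_zero.1 (by nlinarith [sq_nonneg ‖α‖, sq_nonneg ‖β‖])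
      have hβ : β = 0 := norm_eq_zero.1 (by nlinarith [sq_nonneg ‖α‖, sq_nonneg ‖β‖])
      -- For α = β = 0 the event is everything; the case (1, 0) serves only to show that the
      -- constant is at most 1.
      refine ((hlin 1 0 (by simp)).trans measureReal_le_one).trans (le_of_eq ?_)
      simp [hα, hβ]

end Truncation


/-! ### Extreme singular values as norms on unit vectors. -/

section SingularValues

/-- The eigenvector of A*A for its last eigenvalue; the index is n - 1 because eigenvalues are
numbered from 0. -/
lemma exists_nrm_mulVec_le_singVal {n : ℕ} (hn : 1 ≤ n) (A : Matrix (Fin n) (Fin n) ℂ) :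
    ∃ x, nrm x = 1 ∧ nrm (A.mulVec x) ≤ singVal A n := by
  set T := Matrix.toEuclideanLin A with hT
  have hfin : Module.finrank ℂ (EuclideanSpace ℂ (Fin n)) = n := by simp
  have hlt : n - 1 < n := by omega
  set b := T.isSymmetric_adjoint_comp_self.eigenvectorBasis hfin with hb
  set v := b ⟨n - 1, hlt⟩ with hv
  have hv1 : ‖v‖ = 1 := b.orthonormal.1 _
  have hev := T.isSymmetric_adjoint_comp_self.apply_eigenvectorBasis hfin ⟨n - 1, hlt⟩
  have hsq : ‖T v‖ ^ 2 = singVal A n ^ 2 := by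
    rw [singVal, T.sq_singularValues_of_lt hfin hlt]
    have h1 : inner ℂ v ((LinearMap.adjoint T ∘ₗ T) v) = inner ℂ (T v) (T v) := by
      rw [LinearMap.comp_apply, LinearMap.adjoint_inner_right]
    rw [hv, hb, hev, inner_smul_right, ← hb, ← hv, inner_self_eq_norm_sq_to_K,
      inner_self_eq_norm_sq_to_K, hv1] at h1
    simp only [RCLike.ofReal_one, one_pow, mul_one] at h1
    exact_mod_cast h1.symm
  refine ⟨v.ofLp, hv1, le_of_eq ?_⟩
  have h2 : nrm (A.mulVec v.ofLp) = ‖T v‖ := rfl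
  rw [h2]
  exact (sq_eq_sq₀ (norm_nonneg _) (T.singularValues_nonneg _)).1 hsq

lemma opLe_singVal_one {n : ℕ} (A : Matrix (Fin n) (Fin n) ℂ) : OpLe A (singVal A 1) := by
  intro x
  set T := Matrix.toEuclideanLin A with hT
  have hfin : Module.finrank ℂ (EuclideanSpace ℂ (Fin n)) = n := by simp
  set b := T.isSymmetric_adjoint_comp_self.eigenvectorBasis hfin with hb
  set v : EuclideanSpace ℂ (Fin n) := WithLp.toLp 2 x with hv
  have h0 : 0 ≤ singVal A 1 := T.singularValues_nonneg _
  have h1 : inner ℂ v ((LinearMap.adjoint T ∘ₗ T) v) = inner ℂ (T v) (T v) := by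
    rw [LinearMap.comp_apply, LinearMap.adjoint_inner_right]
  rw [← b.repr.inner_map_map, inner_self_eq_norm_sq_to_K, PiLp.inner_apply] at h1
  simp only [hb, T.isSymmetric_adjoint_comp_self.eigenvectorBasis_apply_self_apply hfin] at h1
  rw [← hb] at h1
  have h2 : ‖T v‖ ^ 2 = ∑ i : Fin n, T.singularValues i ^ 2 * ‖b.repr v i‖ ^ 2 := by
    have h3 : ((‖T v‖ ^ 2 : ℝ) : ℂ) =
        ((∑ i : Fin n, T.singularValues i ^ 2 * ‖b.repr v i‖ ^ 2 : ℝ) : ℂ) := by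
      push_cast
      refine Eq.trans h1.symm (Finset.sum_congr rfl fun i _ => ?_)
      rw [← Complex.ofReal_pow (T.singularValues i), T.sq_singularValues_fin hfin i,
        RCLike.inner_apply, mul_assoc, RCLike.mul_conj]
      rfl
    exact_mod_cast h3
  have h4 : ‖v‖ ^ 2 = ∑ i, ‖b.repr v i‖ ^ 2 := by
    rw [← b.repr.norm_map v, EuclideanSpace.norm_sq_eq]
  have h5 : ‖T v‖ ^ 2 ≤ (singVal A 1 * ‖v‖) ^ 2 := by
    rw [h2, mul_pow, h4, Finset.mul_sum]
    refine Finset.sum_le_sum fun i _ => ?_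
    have := T.singularValues_antitone (Nat.zero_le i)
    have h6 := T.singularValues_nonneg i
    change _ ≤ T.singularValues 0 ^ 2 * _
    gcongr
  exact abs_le_of_sq_le_sq' h5 (by positivity) |>.2

end SingularValues

/-! ### Closedness, for measurability of the events. -/

section Topology

variable {ι : Type*} [Fintype ι]

lemma OpLe.mono {A : Matrix ι ι ℂ} {s s' : ℝ} (h : OpLe A s) (hs : s ≤ s') : OpLe A s' :=
  fun x => (h x).trans (mul_le_mul_of_nonneg_right hs (nrm_nonneg x))

lemma Good.mono [DecidableEq ι] {A : Matrix ι ι ℂ} {m m' : ℕ} {r : ℝ} (h : Good A m r)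
    (hm : m' ≤ m) : Good A m' r :=
  fun T hT x hx => h T (hT.trans hm) x hx

lemma isClosed_opLe {Y : Type*} [TopologicalSpace Y] {f : Y → Matrix ι ι ℂ} (hf : Continuous f)
    (s : ℝ) : IsClosed {y | OpLe (f y) s} := by
  simp only [OpLe, Set.ofPred_forall]
  exact isClosed_iInter fun x => isClosed_le
    (continuous_nrm.comp (hf.matrix_mulVec continuous_const)) continuous_const

lemma isCompact_nrm_eq_one : IsCompact {x : ι → ℂ | nrm x = 1} := by
  refine Metric.isCompact_of_isClosed_isBounded (isClosed_eq continuous_nrm continuous_const) ?_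
  refine (Metric.isBounded_closedBall (x := (0 : ι → ℂ)) (r := 1)).subset fun x hx => ?_
  rw [mem_closedBall_zero_iff, pi_norm_le_iff_of_nonneg zero_le_one]
  exact fun i => (norm_le_nrm x i).trans hx.le

/-- Projection along the compact unit sphere is a closed map. -/
lemma isClosed_exists_nrm_eq_one {Y : Type*} [TopologicalSpace Y] {P : Set ((ι → ℂ) × Y)}
    (hP : IsClosed P) : IsClosed {y | ∃ x, nrm x = 1 ∧ (x, y) ∈ P} := by
  have : CompactSpace {x : ι → ℂ | nrm x = 1} := isCompact_iff_compactSpace.1 isCompact_nrm_eq_one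
  have hQ : IsClosed {q : {x : ι → ℂ | nrm x = 1} × Y | ((q.1 : ι → ℂ), q.2) ∈ P} :=
    hP.preimage ((continuous_subtype_val.comp continuous_fst).prodMk continuous_snd)
  convert isClosedMap_snd_of_compactSpace _ hQ using 1
  ext y
  constructor
  · rintro ⟨x, hx, hxy⟩
    exact ⟨(⟨x, hx⟩, y), hxy, rfl⟩
  · rintro ⟨⟨⟨x, hx⟩, y'⟩, hxy, rfl⟩
    exact ⟨x, hx, hxy⟩

lemma nrm_single [DecidableEq ι] (i : ι) : nrm (Pi.single i (1 : ℂ) : ι → ℂ) = 1 := by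
  have : nrm (Pi.single i (1 : ℂ) : ι → ℂ) ^ 2 = 1 := by
    rw [nrm_sq, Finset.sum_eq_single i] <;> simp +contextual
  exact (pow_eq_one_iff_of_nonneg (nrm_nonneg _) two_ne_zero).1 this

lemma le_of_good_of_opLe [DecidableEq ι] {A : Matrix ι ι ℂ} {m : ℕ} {r s : ℝ} (hm : 1 ≤ m)
    (hG : Good A m r) (hop : OpLe A s) (i : ι) : r ≤ s := by
  have h2 := hG {i} (by simpa using hm) (Pi.single i 1) fun j hj => by
    rw [Pi.single_eq_of_ne (by simpa using hj)]
  have h3 := h2.trans ((nrmOn_le_nrm _ _).trans (hop _))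
  rwa [nrm_single, mul_one, mul_one] at h3

end Topology

/-! ### Deleting a row and a column. -/

section Minor

variable {ι : Type*} [Fintype ι] [DecidableEq ι]

/-- Extension of a vector by a zero coordinate. -/
noncomputable def extendZero (k : ι) (x : {i // i ≠ k} → ℂ) : ι → ℂ :=
  fun i => if h : i ≠ k then x ⟨i, h⟩ else 0

@[simp] lemma extendZero_self (k : ι) (x : {i // i ≠ k} → ℂ) : extendZero k x k = 0 := by
  simp [extendZero]

@[simp] lemma extendZero_val (k : ι) (x : {i // i ≠ k} → ℂ) (i : {i // i ≠ k}) :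
    extendZero k x i = x i := dif_pos i.2

lemma sum_eq_add_sum_ne {E : Type*} [AddCommMonoid E] (k : ι) (f : ι → E) :
    ∑ i, f i = f k + ∑ i : {i // i ≠ k}, f i := by
  rw [← Finset.add_sum_erase _ _ (Finset.mem_univ k)]
  congr 1
  exact (Finset.sum_subtype _ (by simp) f)

lemma nrm_extendZero (k : ι) (x : {i // i ≠ k} → ℂ) : nrm (extendZero k x) = nrm x := by
  rw [← sq_eq_sq₀ (nrm_nonneg _) (nrm_nonneg _), nrm_sq, nrm_sq, sum_eq_add_sum_ne k]
  simp

lemma nrm_comp_val_le (k : ι) (x : ι → ℂ) : nrm (fun i : {i // i ≠ k} => x i) ≤ nrm x := by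
  refine abs_le_of_sq_le_sq' ?_ (nrm_nonneg _) |>.2
  rw [nrm_sq, nrm_sq, sum_eq_add_sum_ne k]
  exact le_add_of_nonneg_left (by positivity)

lemma mulVec_extendZero (A : Matrix ι ι ℂ) (k : ι) (x : {i // i ≠ k} → ℂ) (i : {i // i ≠ k}) :
    A.mulVec (extendZero k x) i =
      (A.submatrix (Subtype.val : {i // i ≠ k} → ι) Subtype.val).mulVec x i := by
  simp only [Matrix.mulVec, dotProduct, Matrix.submatrix_apply]
  rw [sum_eq_add_sum_ne k]
  simp

lemma OpLe.submatrix {A : Matrix ι ι ℂ} {s : ℝ} (h : OpLe A s) (k : ι) :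
    OpLe (A.submatrix (Subtype.val : {i // i ≠ k} → ι) Subtype.val) s := by
  intro x
  rw [← nrm_extendZero k x]
  refine le_trans (le_of_eq ?_) ((nrm_comp_val_le k _).trans (h _))
  congr 1
  funext i
  exact (mulVec_extendZero A k x i).symm

/-- Pad the vector by zero at `k` and add `k` to the support: row `k` is then discarded as well, at
the cost of one unit of sparsity. -/
lemma Good.submatrix {A : Matrix ι ι ℂ} {m : ℕ} {r : ℝ} (h : Good A (m + 1) r) (k : ι) :
    Good (A.submatrix (Subtype.val : {i // i ≠ k} → ι) Subtype.val) m r := by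
  intro T hT x hx
  have h1 := h (insert k (T.map (Function.Embedding.subtype _)))
    ((Finset.card_insert_le _ _).trans (by simpa using hT)) (extendZero k x) (by
      intro i hi
      simp only [Finset.mem_insert, Finset.mem_map, not_or, not_exists, not_and] at hi
      simp only [extendZero]
      split_ifs with hik
      · exact hx _ fun hmem => hi.2 _ hmem rfl
      · rfl)
  rw [nrm_extendZero] at h1
  refine h1.trans (le_of_eq ?_)
  rw [← sq_eq_sq₀ (nrmOn_nonneg _ _) (nrmOn_nonneg _ _), nrmOn_sq, nrmOn_sq]
  have h2 : (insert k (T.map (Function.Embedding.subtype (· ≠ k))))ᶜ =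
      Tᶜ.map (Function.Embedding.subtype _) := by
    ext i
    simp only [Finset.mem_compl, Finset.mem_insert, Finset.mem_map, not_or, not_exists, not_and,
      Function.Embedding.coe_subtype]
    constructor
    · rintro ⟨h3, h4⟩
      exact ⟨⟨i, h3⟩, fun hmem => h4 _ hmem rfl, rfl⟩
    · rintro ⟨j, hj, rfl⟩
      exact ⟨j.2, fun j' hj' he => hj (Subtype.ext he ▸ hj')⟩
  rw [h2, Finset.sum_map]
  exact Finset.sum_congr rfl fun i _ => by
    rw [Function.Embedding.coe_subtype, mulVec_extendZero]

end Minor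


/-! ### Nearly null vectors with one prescribed large coordinate. -/

section Columns

variable {n : ℕ} [Nonempty (PairIdx n)]

lemma pidx_comm {i j : Fin n} (h : i ≠ j) : pidx i j = pidx j i := by
  rcases lt_or_gt_of_ne h with h | h
  · rw [pidx_of_lt h, pidx_of_gt h]
  · rw [pidx_of_gt h, pidx_of_lt h]

/-- The pairs `(w_{ki}, w_{ik})` of entries in the `k`-th row and column. -/
noncomputable def crossPairs (k : Fin n) (w : PairIdx n → ℂ × ℂ) (i : {i // i ≠ k}) : ℂ × ℂ :=
  (if k < (i : Fin n) then id else Prod.swap) (w (pidx k i))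

lemma pairMat_row (k : Fin n) (w : PairIdx n → ℂ × ℂ) (i : {i // i ≠ k}) :
    pairMat w k i = (crossPairs k w i).1 := by
  rcases lt_or_gt_of_ne i.2 with h | h
  · simp [pairMat, crossPairs, h, h.not_gt]
  · simp [pairMat, crossPairs, h]

lemma pairMat_col (k : Fin n) (w : PairIdx n → ℂ × ℂ) (i : {i // i ≠ k}) :
    pairMat w i k = (crossPairs k w i).2 := by
  rcases lt_or_gt_of_ne i.2 with h | h
  · simp [pairMat, crossPairs, h, h.not_gt, pidx_comm i.2]
  · simp [pairMat, crossPairs, h, h.not_gt, pidx_comm i.2]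

lemma pairMat_diag (k : Fin n) (w : PairIdx n → ℂ × ℂ) : pairMat w k k = 0 := by
  simp [pairMat]

lemma transpose_pairMat (w : PairIdx n → ℂ × ℂ) :
    (pairMat w).transpose = pairMat fun p => (w p).swap := by
  ext i j
  rcases lt_trichotomy i j with h | rfl | h
  · simp [pairMat, h, h.not_gt, pidx_comm h.ne']
  · simp [pairMat]
  · simp [pairMat, h, h.not_gt, pidx_comm h.ne]

lemma measurable_crossPairs (k : Fin n) :
    Measurable (crossPairs k : (PairIdx n → ℂ × ℂ) → {i // i ≠ k} → ℂ × ℂ) := by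
  refine measurable_pi_lambda _ fun i => ?_
  simp only [crossPairs]
  split_ifs
  · exact measurable_pi_apply _
  · exact measurable_swap.comp (measurable_pi_apply _)

/-- Distinct `i` give distinct pairs `{k, i}`, so independence survives the reorientation that puts
the row entry first. -/
lemma map_crossPairs (ν : PairIdx n → Measure (ℂ × ℂ)) [∀ p, IsProbabilityMeasure (ν p)]
    (k : Fin n) : (Measure.pi ν).map (crossPairs k) = Measure.pi fun i : {i // i ≠ k} =>
      (ν (pidx k i)).map (if k < (i : Fin n) then id else Prod.swap) := by
  have hm : ∀ i : {i // i ≠ k},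
      Measurable (if k < (i : Fin n) then id else Prod.swap : ℂ × ℂ → ℂ × ℂ) := fun i => by
    split_ifs
    · exact measurable_id
    · exact measurable_swap
  have hinj : Function.Injective fun i : {i // i ≠ k} => pidx k i := fun i j h => by
    rcases isPairIndex_pidx _ _ _ _ i.2.symm j.2.symm h with h | h
    · exact Subtype.ext h.2
    · exact absurd h.1.symm j.2
  have : ∀ i : {i // i ≠ k}, IsProbabilityMeasure
      ((ν (pidx k i)).map (if k < (i : Fin n) then id else Prod.swap)) := fun i =>
    Measure.isProbabilityMeasure_map (hm i).aemeasurable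
  rw [← Measure.pi_map_pi fun i => (hm i).aemeasurable,
    ← map_pi_comp_injective ν _ hinj, Measure.map_map]
  · rfl
  · exact measurable_pi_lambda _ fun i => (hm i).comp (measurable_pi_apply i)
  · exact measurable_pi_lambda _ fun i => measurable_pi_apply _

/-- The event that the shifted matrix has a nearly null unit vector with a large `k`-th
coordinate, while being regular on sparse vectors. -/
def columnEvent (M : Matrix (Fin n) (Fin n) ℂ) (k : Fin n) (m : ℕ) (r s θ η : ℝ) :
    Set (PairIdx n → ℂ × ℂ) :=
  {w | (∃ x, nrm x = 1 ∧ θ ≤ ‖x k‖ ∧ nrm ((M + pairMat w).mulVec x) ≤ η) ∧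
    OpLe (M + pairMat w) s ∧ Good (M + pairMat w) m r ∧ Good (M + pairMat w).transpose m r}

lemma continuous_add_pairMat (M : Matrix (Fin n) (Fin n) ℂ) :
    Continuous fun w : PairIdx n → ℂ × ℂ => M + pairMat w :=
  continuous_const.add continuous_pairMat

lemma isClosed_columnEvent (M : Matrix (Fin n) (Fin n) ℂ) (k : Fin n) (m : ℕ) (r s θ η : ℝ) :
    IsClosed (columnEvent M k m r s θ η) := by
  have hc := continuous_add_pairMat M
  have h1 : IsClosed {q : (Fin n → ℂ) × (PairIdx n → ℂ × ℂ) |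
      θ ≤ ‖q.1 k‖ ∧ nrm ((M + pairMat q.2).mulVec q.1) ≤ η} := by
    refine IsClosed.and (isClosed_le continuous_const ?_) (isClosed_le ?_ continuous_const)
    · exact ((continuous_apply k).comp continuous_fst).norm
    · exact continuous_nrm.comp ((hc.comp continuous_snd).matrix_mulVec continuous_fst)
  exact (isClosed_exists_nrm_eq_one h1).and ((isClosed_opLe hc s).and
    ((isClosed_good hc m r).and (isClosed_good hc.matrix_transpose m r)))

/-- Condition on all pairs avoiding `k`. Dividing a nearly null x by x k turns it into a near
solution of the system bordered by the random row and column, with error η/θ. -/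
theorem pi_columnEvent_le (ν : PairIdx n → Measure (ℂ × ℂ)) [∀ p, IsProbabilityMeasure (ν p)]
    {a τ₁ p₁ τ₂ p₂ : ℝ} (hp₁ : 0 < p₁) (hτ₁ : 0 < τ₁) (hτ₁' : τ₁ ≤ 1) (hp₂ : 0 < p₂) (hτ₂ : 0 < τ₂)
    (hν : ∀ p, PairLaw (ν p) a τ₁ p₁ τ₂ p₂) {h : ℕ} (hh : 1 ≤ h) (hcard : 2 * h + 1 ≤ n)
    {r s θ η : ℝ} (hr : 1 ≤ r) (hrs : r ≤ s) (hθ : 0 < θ) (hθr : √n * θ * s ≤ r / 8) (hη : 0 < η)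
    (hηs : 20 * (η / θ) * s ^ 2 < θ * (θ * τ₂ / 2) * τ₁) (M : Matrix (Fin n) (Fin n) ℂ)
    (k : Fin n) :
    (Measure.pi ν).real (columnEvent M k (4 * h) r s θ η) ≤ √(5 / √(h * p₂) + 5 / √(h * p₁)) := by
  classical
  set I : Finset (PairIdx n) := Finset.univ.filter fun p => p.1.1 = k ∨ p.1.2 = k with hI
  have hbound : 0 ≤ √(5 / √(h * p₂) + 5 / √(h * p₁)) := Real.sqrt_nonneg _
  refine ENNReal.toReal_le_of_le_ofReal hbound (pi_le_of_forall_piecewise ν I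
    (isClosed_columnEvent M k (4 * h) r s θ η).measurableSet fun w' => ?_)
  -- Regularity is part of the event and concerns the full matrix. The minor does not depend on the
  -- free pairs, so one realization of the event makes it regular for all; without any, there is
  -- nothing to bound.
  by_cases hne : ∃ w₀, I.piecewise w₀ w' ∈ columnEvent M k (4 * h) r s θ η
  swap
  · have : {w | I.piecewise w w' ∈ columnEvent M k (4 * h) r s θ η} = ∅ :=
      Set.eq_empty_of_forall_notMem fun w hw => hne ⟨w, hw⟩
    rw [this, measure_empty]
    exact zero_le
  have hmemI : ∀ i : {i // i ≠ k}, pidx k i ∈ I := fun i => by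
    rcases lt_or_gt_of_ne i.2 with h | h
    · simp [hI, pidx_of_gt h]
    · simp [hI, pidx_of_lt h]
  have hnotI : ∀ i j : {i // i ≠ k}, i ≠ j → pidx (i : Fin n) j ∉ I := fun i j hij => by
    have hi := i.2
    have hj := j.2
    rcases lt_or_gt_of_ne (fun h => hij (Subtype.ext h) : (i : Fin n) ≠ j) with h | h
    · simp [hI, pidx_of_lt h, hi, hj]
    · simp [hI, pidx_of_gt h, hi, hj]
  set B := (M + pairMat w').submatrix (Subtype.val : {i // i ≠ k} → Fin n) Subtype.val with hB
  have hBw : ∀ w, (M + pairMat (I.piecewise w w')).submatrix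
      (Subtype.val : {i // i ≠ k} → Fin n) Subtype.val = B := fun w => by
    ext i j
    by_cases hij : i = j
    · simp [hB, hij, pairMat_diag]
    · simp [hB, pairMat, Finset.piecewise_eq_of_notMem _ _ _ (hnotI i j hij)]
  have hcross : ∀ w, crossPairs k (I.piecewise w w') = crossPairs k w := fun w => by
    funext i
    simp [crossPairs, Finset.piecewise_eq_of_mem _ _ _ (hmemI i)]
  obtain ⟨w₀, -, hop₀, hG₀, hGt₀⟩ := hne
  have hop := hop₀.submatrix k
  rw [hBw] at hop
  -- Sparsity 4h leaves room for the 3h needed on the minor and one more for the index `k`.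
  have hG := (hG₀.mono (show 3 * h + 1 ≤ 4 * h by omega)).submatrix k
  rw [hBw] at hG
  have hGt := (hGt₀.mono (show 3 * h + 1 ≤ 4 * h by omega)).submatrix k
  rw [← Matrix.transpose_submatrix, hBw] at hGt
  have hm : ∀ i : {i // i ≠ k},
      Measurable (if k < (i : Fin n) then id else Prod.swap : ℂ × ℂ → ℂ × ℂ) := fun i => by
    split_ifs
    · exact measurable_id
    · exact measurable_swap
  have : ∀ i : {i // i ≠ k}, IsProbabilityMeasure
      ((ν (pidx k i)).map (if k < (i : Fin n) then id else Prod.swap)) := fun i =>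
    Measure.isProbabilityMeasure_map (hm i).aemeasurable
  have hcard' : Fintype.card {i // i ≠ k} = n - 1 := by simp [Fintype.card_subtype_compl]
  have : Nonempty {i // i ≠ k} := Fintype.card_pos_iff.1 (by omega)
  have hs : 0 < s := by linarith
  have hb := pi_border_le (fun i : {i // i ≠ k} =>
      (ν (pidx k i)).map (if k < (i : Fin n) then id else Prod.swap)) hp₁ hτ₁ hτ₁' hp₂ hτ₂
    (fun i => by
      split_ifs
      · rw [Measure.map_id]
        exact hν _
      · exact (hν _).map_swap) hh (by omega) hG hGt hop hr hrs hθ (by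
      refine le_trans ?_ hθr
      gcongr
      omega) (div_pos hη hθ) hηs (fun i => M k i) (fun i => M i k) (M k k)
  rw [← map_crossPairs] at hb
  refine le_trans (le_trans (measure_mono ?_) (Measure.le_map_apply
    (measurable_crossPairs k).aemeasurable _)) (ENNReal.le_ofReal_iff_toReal_le
    (measure_ne_top _ _) hbound |>.2 hb)
  rintro w ⟨⟨x, hx, hxk, hxη⟩, hopw, -, -⟩
  set A := M + pairMat (I.piecewise w w') with hA
  have hrow : ∀ i : {i // i ≠ k}, A k i = M k i + (crossPairs k w i).1 := fun i => by
    rw [hA, Matrix.add_apply, pairMat_row, hcross]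
  have hcol : ∀ i : {i // i ≠ k}, A i k = M i k + (crossPairs k w i).2 := fun i => by
    rw [hA, Matrix.add_apply, pairMat_col, hcross]
  have hkk : A k k = M k k := by rw [hA, Matrix.add_apply, pairMat_diag, add_zero]
  have hxk0 : x k ≠ 0 := fun h0 => by simp [h0] at hxk; linarith
  have hxkpos : 0 < ‖x k‖ := norm_pos_iff.2 hxk0
  have hy : nrm (A.mulVec ((x k)⁻¹ • x)) ≤ η / θ := by
    rw [Matrix.mulVec_smul, nrm_smul, norm_inv, inv_mul_eq_div]
    gcongr
  have hval : ∀ i, A.mulVec ((x k)⁻¹ • x) i = A i k + ∑ j : {j // j ≠ k}, A i j * ((x k)⁻¹ * x j) := by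
    intro i
    simp only [Matrix.mulVec, dotProduct, Pi.smul_apply, smul_eq_mul]
    rw [sum_eq_add_sum_ne k, inv_mul_cancel₀ hxk0, mul_one]
  refine ⟨?_, fun j => (x k)⁻¹ * x j, ?_, ?_⟩
  -- The `k`-th row is the image of a basis vector under the transpose, so its norm is at most `s`.
  · have h1 := opLe_transpose hs.le hopw (Pi.single k 1)
    have h2 : nrm (Pi.single k (1 : ℂ) : Fin n → ℂ) = 1 := nrm_single k
    rw [h2, mul_one] at h1
    refine le_trans (le_of_eq ?_) ((nrm_comp_val_le k _).trans h1)
    congr 1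
    funext i
    rw [Matrix.mulVec_single_one, Matrix.col_apply, Matrix.transpose_apply, hrow]
  · refine le_trans (le_of_eq ?_) ((nrm_comp_val_le k _).trans hy)
    congr 1
    funext i
    rw [hval, Pi.add_apply, hcol, add_comm, ← hBw w]
    rfl
  · refine le_trans (le_of_eq ?_) ((norm_le_nrm _ k).trans hy)
    rw [hval, hkk]
    congr 2
    exact Finset.sum_congr rfl fun i _ => by rw [hrow]

end Columns


/-- If every point of `G` lies in at least `m` of the sets `E k`, then
`m * μ G ≤ ∑ k, μ (E k)`. -/
lemma mul_measureReal_le_sum {α κ : Type*} [MeasurableSpace α] [Fintype κ] (μ : Measure α)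
    [IsFiniteMeasure μ] {E : κ → Set α} (hE : ∀ k, MeasurableSet (E k)) {G : Set α} {m : ℕ}
    (hG : ∀ x ∈ G, ∃ S : Finset κ, m ≤ S.card ∧ ∀ k ∈ S, x ∈ E k) :
    m * μ.real G ≤ ∑ k, μ.real (E k) := by
  have hmeas : ∀ k, Measurable ((E k).indicator (1 : α → ENNReal)) := fun k =>
    measurable_one.indicator (hE k)
  have h1 : (m : ENNReal) * μ G ≤ ∑ k, μ (E k) := by
    calc (m : ENNReal) * μ G
        ≤ m * μ {x | (m : ENNReal) ≤ ∑ k, (E k).indicator (1 : α → ENNReal) x} := by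
          gcongr
          intro x hx
          obtain ⟨S, hS, hSE⟩ := hG x hx
          calc (m : ENNReal) ≤ ∑ k ∈ S, 1 := by simpa using hS
            _ = ∑ k ∈ S, (E k).indicator (1 : α → ENNReal) x :=
                Finset.sum_congr rfl fun k hk => by simp [hSE k hk]
            _ ≤ _ := Finset.sum_le_sum_of_subset (Finset.subset_univ S)
      _ ≤ ∫⁻ x, ∑ k, (E k).indicator (1 : α → ENNReal) x ∂μ :=
          mul_meas_ge_le_lintegral (Finset.measurable_sum _ fun k _ => hmeas k) _
      _ = ∑ k, μ (E k) := by
          rw [lintegral_finsetSum _ fun k _ => hmeas k]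
          exact Finset.sum_congr rfl fun k _ => lintegral_indicator_one (hE k)
  have h2 := ENNReal.toReal_mono (by simp) h1
  rw [ENNReal.toReal_mul, ENNReal.toReal_sum (by simp)] at h2
  exact h2

/-! ### Summing over the coordinates. -/

section Union

variable {n : ℕ} [Nonempty (PairIdx n)]

/-- The event that the shifted matrix has operator norm at most `s` and a unit vector with image of
norm at most `η`. -/
def nullEvent (M : Matrix (Fin n) (Fin n) ℂ) (s η : ℝ) : Set (PairIdx n → ℂ × ℂ) :=
  {w | (∃ x, nrm x = 1 ∧ nrm ((M + pairMat w).mulVec x) ≤ η) ∧ OpLe (M + pairMat w) s}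

/-- On the regular event a nearly null vector is large at 2h coordinates, so each point lies in 2h
column events. The loss is n/(2h), where a union bound would lose n. -/
lemma pi_nullEvent_le (ν : PairIdx n → Measure (ℂ × ℂ)) [∀ p, IsProbabilityMeasure (ν p)]
    {a τ₁ p₁ τ₂ p₂ : ℝ} (hp₁ : 0 < p₁) (hτ₁ : 0 < τ₁) (hτ₁' : τ₁ ≤ 1) (hp₂ : 0 < p₂) (hτ₂ : 0 < τ₂)
    (hν : ∀ p, PairLaw (ν p) a τ₁ p₁ τ₂ p₂) {h : ℕ} (hh : 1 ≤ h) (hcard : 2 * h + 1 ≤ n)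
    {r s θ η : ℝ} (hr : 1 ≤ r) (hθ : 0 < θ) (hθr : √n * θ * s ≤ r / 8) (hη : 0 < η)
    (hηr : η ≤ r / 4)
    (hηs : 20 * (η / θ) * s ^ 2 < θ * (θ * τ₂ / 2) * τ₁) (M : Matrix (Fin n) (Fin n) ℂ) :
    (Measure.pi ν).real (nullEvent M s η) ≤
      (Measure.pi ν).real {w | ¬ Good (M + pairMat w) (4 * h) r} +
      (Measure.pi ν).real {w | ¬ Good (M + pairMat w).transpose (4 * h) r} +
      n / (2 * h) * √(5 / √(h * p₂) + 5 / √(h * p₁)) := by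
  set P := Measure.pi ν
  set G : Set (PairIdx n → ℂ × ℂ) := {w | w ∈ nullEvent M s η ∧ Good (M + pairMat w) (4 * h) r ∧
    Good (M + pairMat w).transpose (4 * h) r} with hGdef
  have hsub : nullEvent M s η ⊆ ({w | ¬ Good (M + pairMat w) (4 * h) r} ∪
      {w | ¬ Good (M + pairMat w).transpose (4 * h) r}) ∪ G := by
    intro w hw
    by_cases h1 : Good (M + pairMat w) (4 * h) r
    · by_cases h2 : Good (M + pairMat w).transpose (4 * h) r
      · exact Or.inr ⟨hw, h1, h2⟩
      · exact Or.inl (Or.inr h2)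
    · exact Or.inl (Or.inl h1)
  refine (measureReal_mono hsub (measure_ne_top _ _)).trans ((measureReal_union_le _ _).trans
    (add_le_add (measureReal_union_le _ _) ?_))
  have hhpos : (0 : ℝ) < h := by exact_mod_cast hh
  -- If s < r, regularity and the norm bound contradict each other on a basis vector.
  by_cases hrs : r ≤ s
  swap
  · have hG : G = ∅ := by
      refine Set.eq_empty_of_forall_notMem fun w hw => hrs ?_
      exact le_of_good_of_opLe (by omega) hw.2.1 hw.1.2 (⟨0, by omega⟩ : Fin n)
    rw [hG, measureReal_empty]
    positivity
  have hmark := mul_measureReal_le_sum P (E := fun k => columnEvent M k (4 * h) r s θ η)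
    (fun k => (isClosed_columnEvent M k (4 * h) r s θ η).measurableSet) (G := G) (m := 2 * h) (by
      rintro w ⟨⟨⟨x, hx, hxη⟩, hop⟩, hg, hgt⟩
      refine ⟨spread θ x, two_mul_le_card_spread (hg.mono (by omega)) hop (by linarith) hrs hθ.le
        (by simpa using hθr) hx ∅ (by simp) ((nrmOn_le_nrm _ _).trans (hxη.trans hηr)),
        fun k hk => ⟨⟨x, hx, mem_spread.1 hk, hxη⟩, hop, hg, hgt⟩⟩)
  have hsum : ∑ k, P.real (columnEvent M k (4 * h) r s θ η) ≤
      n * √(5 / √(h * p₂) + 5 / √(h * p₁)) := by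
    refine (Finset.sum_le_card_nsmul _ _ _ fun k _ => pi_columnEvent_le ν hp₁ hτ₁ hτ₁' hp₂ hτ₂ hν hh
      hcard hr hrs hθ hθr hη hηs M k).trans ?_
    simp
  rw [div_mul_eq_mul_div, le_div_iff₀ (by positivity), mul_comm]
  push_cast at hmark
  exact hmark.trans hsum

end Union

/-! ### Choice of parameters. -/

lemma inv_le_sqrt_inv_sqrt {x y : ℝ} (hx : 1 ≤ x) (hy : 0 < y) (hyx : y ≤ x) :
    1 / x ≤ √(1 / √y) := by
  refine Real.le_sqrt_of_sq_le ?_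
  rw [div_pow, one_pow]
  refine one_div_le_one_div_of_le (Real.sqrt_pos.2 hy) ?_
  calc √y ≤ x := Real.sqrt_le_iff.2 ⟨by linarith, by nlinarith⟩
    _ ≤ x ^ 2 := by nlinarith

lemma add_two_mul_exp_neg_le {c x : ℝ} (hc : 0 < c) (hx : 1 ≤ x) :
    (x + 2) * Real.exp (-(c * x)) ≤ 6 / c ^ 2 * (1 / x) := by
  have h1 := Real.quadratic_le_exp_of_nonneg (show 0 ≤ c * x by positivity)
  have h2 : (c * x) ^ 2 / 2 ≤ Real.exp (c * x) := by
    have : 0 ≤ c * x := by positivity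
    linarith
  rw [Real.exp_neg]
  calc (x + 2) * (Real.exp (c * x))⁻¹ ≤ (3 * x) * ((c * x) ^ 2 / 2)⁻¹ := by
        gcongr
        linarith
    _ = 6 / c ^ 2 * (1 / x) := by
        field_simp
        ring

/-- Take h proportional to n, r = r₀√n, θ = r₀/(8s) and η = t/√n. The smallness condition of
`pi_nullEvent_le` then follows from s⁵t ≤ cτ₁, with a factor √n to spare. -/
theorem exists_pi_nullEvent_le {a τ₂ p₂ : ℝ} (ha : 0 < a) (hτ₂ : 0 < τ₂) (hp₂ : 0 < p₂) :
    ∃ c K N : ℝ, 0 < c ∧ 0 < K ∧ 1 ≤ N ∧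
      ∀ {n : ℕ} [Nonempty (PairIdx n)] (ν : PairIdx n → Measure (ℂ × ℂ))
        [∀ p, IsProbabilityMeasure (ν p)] {τ₁ p₁ : ℝ}, 0 < τ₁ → τ₁ ≤ 1 → 0 < p₁ → p₁ ≤ p₂ →
        (∀ p, PairLaw (ν p) a τ₁ p₁ τ₂ p₂) → N ≤ n →
        ∀ (M : Matrix (Fin n) (Fin n) ℂ) (s t : ℝ), 1 ≤ s → 0 < t → t ≤ 1 → s ^ 5 * t ≤ c * τ₁ →
        (Measure.pi ν).real (nullEvent M s (t / √n)) ≤ K * √(1 / √(n * p₁)) := by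
  obtain ⟨δ, r₀, c, hδ, hr₀, hc, hgood⟩ := exists_pi_not_good_le ha hτ₂ hp₂
  set d := min δ 1 with hd
  have hdpos : 0 < d := lt_min hδ one_pos
  -- Any denominator above 160·128 = 20480 would do in the first constant. In the last, n ≥ 8/d
  -- gives h ≥ 1 and h ≥ dn/8, while n ≥ 16/r₀² gives r₀√n ≥ 4, hence η ≤ 1 ≤ r/4.
  refine ⟨r₀ ^ 3 * τ₂ / 40961, 12 / c ^ 2 + 4 / d * √(10 / √(d / 8)),
    max 1 (max (8 / d) (16 / r₀ ^ 2)), by positivity, by positivity, le_max_left _ _, ?_⟩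
  intro n _ ν _ τ₁ p₁ hτ₁ hτ₁' hp₁ hp₁₂ hν hn M s t hs ht ht1 hst
  have hn1 : (1 : ℝ) ≤ n := (le_max_left _ _).trans hn
  have hn2 : 8 / d ≤ (n : ℝ) := (le_max_left _ _).trans ((le_max_right _ _).trans hn)
  have hn3 : 16 / r₀ ^ 2 ≤ (n : ℝ) := (le_max_right _ _).trans ((le_max_right _ _).trans hn)
  have hnpos : (0 : ℝ) < n := by linarith
  have hsq1 : 1 ≤ √(n : ℝ) := Real.one_le_sqrt.2 hn1
  rw [div_le_iff₀ hdpos] at hn2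
  set h := ⌊d * n / 4⌋₊ with hh
  have hle : (h : ℝ) ≤ d * n / 4 := Nat.floor_le (by positivity)
  have hge : d * n / 8 ≤ h := by
    have := Nat.lt_floor_add_one (d * n / 4)
    rw [← hh] at this
    linarith
  have hh1 : 1 ≤ h := Nat.le_floor (by push_cast; linarith)
  have hhpos : (0 : ℝ) < h := by exact_mod_cast hh1
  have h4n : 4 * h ≤ n := by
    have : (4 * h : ℝ) ≤ n := by
      have : d * n ≤ 1 * n := by gcongr; exact min_le_right _ _
      linarith
    exact_mod_cast this
  have h4δ : ((4 * h : ℕ) : ℝ) ≤ δ * n := by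
    have : d * n ≤ δ * n := by gcongr; exact min_le_left _ _
    push_cast
    linarith
  have hr4 : 4 ≤ r₀ * √n := by
    have h1 : 4 / r₀ ≤ √n := Real.le_sqrt_of_sq_le (by rw [div_pow]; norm_num; exact hn3)
    rwa [div_le_iff₀ hr₀, mul_comm] at h1
  -- A probability of at least `p₁` appears in `PairLaw.lin`, here for zero coefficients.
  have hp₁1 : p₁ ≤ 1 :=
    (hν (Classical.arbitrary _)).lin 0 0 |>.trans measureReal_le_one
  have hspos : 0 < s := by linarith
  have hgood2 : (Measure.pi ν).real {w | ¬ Good (M + pairMat w).transpose (4 * h) (r₀ * √n)} ≤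
      (n + 2) * Real.exp (-(c * n)) := by
    have : ∀ p, IsProbabilityMeasure ((ν p).map Prod.swap) := fun p =>
      Measure.isProbabilityMeasure_map measurable_swap.aemeasurable
    have h1 := hgood (fun p => (ν p).map Prod.swap) (fun p => (hν p).map_swap) M.transpose _ h4δ
    rw [← Measure.pi_map_pi fun p => measurable_swap.aemeasurable, map_measureReal_apply] at h1
    · refine le_trans (le_of_eq ?_) h1
      congr 1
      ext w
      simp [Matrix.transpose_add, transpose_pairMat]
    · exact measurable_pi_lambda _ fun p => measurable_swap.comp (measurable_pi_apply p)
    · exact (isClosed_good (continuous_add_pairMat _) _ _).measurableSet.compl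
  have key := pi_nullEvent_le ν hp₁ hτ₁ hτ₁' hp₂ hτ₂ hν hh1 (by omega) (r := r₀ * √n) (s := s)
    (θ := r₀ / (8 * s)) (η := t / √n) (by linarith) (by positivity)
    (le_of_eq (by field_simp)) (by positivity)
    ((div_le_one (by positivity)).2 (ht1.trans hsq1) |>.trans (by linarith)) (by
      have e1 : 20 * (t / √n / (r₀ / (8 * s))) * s ^ 2 = 160 * (s ^ 5 * t) / (r₀ * s ^ 2 * √n) := by
        field_simp
        ring
      have e2 : r₀ / (8 * s) * (r₀ / (8 * s) * τ₂ / 2) * τ₁ = r₀ ^ 2 * τ₂ * τ₁ / (128 * s ^ 2) := by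
        field_simp
        ring
      rw [e1, e2, div_lt_div_iff₀ (by positivity) (by positivity)]
      calc 160 * (s ^ 5 * t) * (128 * s ^ 2)
          ≤ 160 * (r₀ ^ 3 * τ₂ / 40961 * τ₁) * (128 * s ^ 2) := by gcongr
        _ < (r₀ ^ 3 * τ₂ * τ₁ * s ^ 2) * 1 := by
            have : 0 < r₀ ^ 3 * τ₂ * τ₁ * s ^ 2 := by positivity
            linarith
        _ ≤ (r₀ ^ 3 * τ₂ * τ₁ * s ^ 2) * √n := by gcongr
        _ = _ := by ring) M
  have hy : 0 < n * p₁ := by positivity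
  set q := √(1 / √(n * p₁)) with hq
  have hexp : (n + 2) * Real.exp (-(c * n)) ≤ 6 / c ^ 2 * q := by
    refine (add_two_mul_exp_neg_le hc hn1).trans ?_
    gcongr
    exact inv_le_sqrt_inv_sqrt hn1 hy (mul_le_of_le_one_right hnpos.le hp₁1)
  have hcol : √(5 / √(h * p₂) + 5 / √(h * p₁)) ≤ √(10 / √(d / 8)) * q := by
    rw [hq, ← Real.sqrt_mul (by positivity)]
    refine Real.sqrt_le_sqrt ?_
    have e1 : 10 / √(d / 8) * (1 / √(n * p₁)) = 10 / √(d * n / 8 * p₁) := by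
      rw [show d * n / 8 * p₁ = d / 8 * (n * p₁) by ring, Real.sqrt_mul (show 0 ≤ d / 8 by positivity),
        div_mul_div_comm, mul_one]
    have e2 : 5 / √(h * p₂) ≤ 5 / √(d * n / 8 * p₁) := by gcongr
    have e3 : 5 / √(h * p₁) ≤ 5 / √(d * n / 8 * p₁) := by gcongr
    rw [e1]
    calc _ ≤ 5 / √(d * n / 8 * p₁) + 5 / √(d * n / 8 * p₁) := add_le_add e2 e3
      _ = _ := by ring
  have hfrac : (n : ℝ) / (2 * h) ≤ 4 / d := by
    rw [div_le_div_iff₀ (by positivity) hdpos]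
    linarith
  calc (Measure.pi ν).real (nullEvent M s (t / √n)) ≤ _ := key
    _ ≤ 6 / c ^ 2 * q + 6 / c ^ 2 * q + 4 / d * (√(10 / √(d / 8)) * q) := by
        gcongr
        · exact (hgood ν hν M _ h4δ).trans hexp
        · exact hgood2.trans hexp
    _ = _ := by ring


/-! ### Law of the matrix and freezing of the diagonal. -/

section Law

variable {Ω : Type*} [MeasurableSpace Ω] {n : ℕ} [Nonempty (PairIdx n)] {μ : Measure Ω}
  [IsProbabilityMeasure μ] {X : Ω → Matrix (Fin n) (Fin n) ℂ} {a b σ ρ : ℝ}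

/-- The law of the pair of entries with label `p`. -/
noncomputable def pairMeasure (μ : Measure Ω) (X : Ω → Matrix (Fin n) (Fin n) ℂ) (p : PairIdx n) :
    Measure (ℂ × ℂ) :=
  μ.map fun ω => (X ω p.1.1 p.1.2, X ω p.1.2 p.1.1)

lemma eq_diagonal_add_pairMat (A : Matrix (Fin n) (Fin n) ℂ) :
    A = Matrix.diagonal (fun i => A i i) +
      pairMat fun p : PairIdx n => (A p.1.1 p.1.2, A p.1.2 p.1.1) := by
  ext i j
  rcases lt_trichotomy i j with h | rfl | h
  · simp [pairMat, h, h.ne, pidx_of_lt h]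
  · simp [pairMat]
  · simp [pairMat, h, h.ne', h.not_gt, pidx_of_gt h]

lemma isClosed_nullEvent_prod (M : Matrix (Fin n) (Fin n) ℂ) (s η : ℝ) :
    IsClosed {q : (Fin n → ℂ) × (PairIdx n → ℂ × ℂ) |
      q.2 ∈ nullEvent (M + Matrix.diagonal q.1) s η} := by
  have hc : Continuous fun q : (Fin n → ℂ) × (PairIdx n → ℂ × ℂ) =>
      M + Matrix.diagonal q.1 + pairMat q.2 :=
    (continuous_const.add continuous_fst.matrix_diagonal).add
      (continuous_pairMat.comp continuous_snd)
  have h1 : IsClosed {q : (Fin n → ℂ) × (Fin n → ℂ) × (PairIdx n → ℂ × ℂ) |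
      nrm ((M + Matrix.diagonal q.2.1 + pairMat q.2.2).mulVec q.1) ≤ η} :=
    isClosed_le (continuous_nrm.comp ((hc.comp continuous_snd).matrix_mulVec continuous_fst))
      continuous_const
  exact (isClosed_exists_nrm_eq_one h1).and (isClosed_opLe hc s)

namespace IsEllipticTruncated

lemma measurable_pair (hX : IsEllipticTruncated μ X a b σ ρ) (p : PairIdx n) :
    Measurable fun ω => (X ω p.1.1 p.1.2, X ω p.1.2 p.1.1) :=
  (hX.measurable _ _).prodMk (hX.measurable _ _)

lemma isProbabilityMeasure_pairMeasure (hX : IsEllipticTruncated μ X a b σ ρ)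
    (p : PairIdx n) : IsProbabilityMeasure (pairMeasure μ X p) :=
  Measure.isProbabilityMeasure_map (hX.measurable_pair p).aemeasurable

lemma map_diag_prod_pairs (hX : IsEllipticTruncated μ X a b σ ρ) :
    μ.map (fun ω => ((fun i => X ω i i),
        fun p : PairIdx n => (X ω p.1.1 p.1.2, X ω p.1.2 p.1.1))) =
      (μ.map fun ω i => X ω i i).prod (Measure.pi (pairMeasure μ X)) := by
  have hd : Measurable fun ω i => X ω i i := measurable_pi_lambda _ fun i => hX.measurable i i
  have hp : Measurable fun ω (p : PairIdx n) => (X ω p.1.1 p.1.2, X ω p.1.2 p.1.1) :=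
    measurable_pi_lambda _ fun p => hX.measurable_pair p
  have hind := hX.indep_diag.comp (φ := id)
    (ψ := fun (y : {p : Fin n × Fin n // p.1 ≠ p.2} → ℂ) (p : PairIdx n) =>
      (y ⟨(p.1.1, p.1.2), p.2.ne⟩, y ⟨(p.1.2, p.1.1), p.2.ne'⟩)) measurable_id
    (measurable_pi_lambda _ fun p => (measurable_pi_apply _).prodMk (measurable_pi_apply _))
  have h1 := (indepFun_iff_map_prod_eq_prod_map_map hd.aemeasurable hp.aemeasurable).1 hind
  rw [h1, hX.indep_pairs.map_fun_eq_pi_map fun p => (hX.measurable_pair p).aemeasurable]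
  rfl

/-- A bound for the singular value event, uniform over the shifts by deterministic matrices, in
the model where the diagonal is frozen. -/
lemma measureReal_singVal_le (hX : IsEllipticTruncated μ X a b σ ρ) (hn : 1 ≤ n)
    (M : Matrix (Fin n) (Fin n) ℂ) {s η q : ℝ} (hq : 0 ≤ q)
    (h : ∀ D, (Measure.pi (pairMeasure μ X)).real (nullEvent (M + Matrix.diagonal D) s η) ≤ q) :
    μ.real {ω | singVal (X ω + M) n ≤ η ∧ singVal (X ω + M) 1 ≤ s} ≤ q := by
  have := hX.isProbabilityMeasure_pairMeasure
  have hm : Measurable fun ω => ((fun i => X ω i i),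
      fun p : PairIdx n => (X ω p.1.1 p.1.2, X ω p.1.2 p.1.1)) :=
    (measurable_pi_lambda _ fun i => hX.measurable i i).prodMk
      (measurable_pi_lambda _ fun p => hX.measurable_pair p)
  have : IsProbabilityMeasure (μ.map fun ω i => X ω i i) :=
    Measure.isProbabilityMeasure_map
      (measurable_pi_lambda _ fun i => hX.measurable i i).aemeasurable
  have hF := (isClosed_nullEvent_prod M s η).measurableSet
  refine ENNReal.toReal_le_of_le_ofReal hq ?_
  calc μ {ω | singVal (X ω + M) n ≤ η ∧ singVal (X ω + M) 1 ≤ s}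
      ≤ μ ((fun ω => ((fun i => X ω i i),
        fun p : PairIdx n => (X ω p.1.1 p.1.2, X ω p.1.2 p.1.1))) ⁻¹'
          {q | q.2 ∈ nullEvent (M + Matrix.diagonal q.1) s η}) := by
        refine measure_mono fun ω hω => ?_
        -- The diagonal joins the shift, so dependence among diagonal entries is irrelevant: the
        -- bound holds for every frozen value `D`.
        have e : M + Matrix.diagonal (fun i => X ω i i) +
            pairMat (fun p : PairIdx n => (X ω p.1.1 p.1.2, X ω p.1.2 p.1.1)) = X ω + M := by
          rw [add_assoc, ← eq_diagonal_add_pairMat, add_comm]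
        obtain ⟨x, hx, hxs⟩ := exists_nrm_mulVec_le_singVal hn (X ω + M)
        refine ⟨⟨x, hx, ?_⟩, ?_⟩
        · rw [e]
          exact hxs.trans hω.1
        · rw [e]
          exact (opLe_singVal_one _).mono hω.2
    _ = _ := (Measure.map_apply hm hF).symm
    _ = ∫⁻ D, Measure.pi (pairMeasure μ X) (nullEvent (M + Matrix.diagonal D) s η)
          ∂(μ.map fun ω i => X ω i i) := by
        rw [hX.map_diag_prod_pairs, Measure.prod_apply hF]
        rfl
    _ ≤ ∫⁻ _, ENNReal.ofReal q ∂(μ.map fun ω i => X ω i i) :=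
        lintegral_mono fun D => (ENNReal.le_ofReal_iff_toReal_le (measure_ne_top _ _) hq).2 (h D)
    _ = _ := by simp

lemma pairLaw (hX : IsEllipticTruncated μ X a b σ ρ) (ha : 0 < a) (hb : 0 < b)
    (hσ : 0 < σ) (hρ : ρ < 1) {τ : ℝ}
    (hτ : 8 * τ ^ 2 ≤ b * σ ^ 2) (p : PairIdx n) :
    PairLaw (pairMeasure μ X p) a (√(1 - ρ) * τ) (b ^ 2 * ((1 - ρ) * σ ^ 2) / (16 * a ^ 2)) τ
      (b ^ 2 * σ ^ 2 / (8 * a ^ 2)) := by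
  have hVZ := hX.var_ge p.1.2 p.1.1 p.2.ne'
  have hcomm : truncEvent X a p.1.2 p.1.1 = truncEvent X a p.1.1 p.1.2 := Set.ext fun ω => and_comm
  rw [hcomm] at hVZ
  exact pairLaw_map μ (hX.measurable _ _) (hX.measurable _ _) ha hb hσ hρ
    (hX.prob_ge _ _ p.2) (hX.var_ge _ _ p.2.ne) hVZ (hX.corr_le _ _ p.2) hτ

end IsEllipticTruncated

end Law

/-- With Q the base of the power, Q ≥ 1 makes the claim trivial, and s⁵t > c√(1-ρ)τ forces Q ≥
√(cτ), which C compensates. Otherwise P is at most a constant times the square root of 1/(√x√(1-ρ))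
≤ Q < 1, and the exponent 1/2 is weakened to 1/4. -/
lemma le_mul_rpow_of_sqrt_bound {C K κ c τ ρ x s t L : ℝ} (hκ : 0 < κ) (hc : 0 < c)
    (hτ : 0 < τ) (hρ0 : 0 ≤ ρ) (hρ : ρ < 1) (hx : 1 ≤ x) (hL : 1 ≤ L)
    (hC1 : 1 ≤ C) (hC2 : K * √(1 / √κ) ≤ C) (hC3 : (1 / √(c * τ)) ^ (1 / 4 : ℝ) ≤ C) {P : ℝ}
    (hP : P ≤ 1) (h : s ^ 5 * t ≤ c * (√(1 - ρ) * τ) → P ≤ K * √(1 / √(x * (κ * (1 - ρ))))) :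
    P ≤ C * (L / √(1 - ρ) * (√(s ^ 5 * t) + 1 / √x)) ^ (1 / 4 : ℝ) := by
  set d := √(1 - ρ) with hd
  have hdpos : 0 < d := Real.sqrt_pos.2 (by linarith)
  have hd1 : d ≤ 1 := Real.sqrt_le_one.2 (by linarith)
  have hxpos : 0 < √x := Real.sqrt_pos.2 (by linarith)
  set Q := L / d * (√(s ^ 5 * t) + 1 / √x) with hQ
  have hL1 : 1 / d ≤ L / d := by gcongr
  have hQ1 : 1 / d * √(s ^ 5 * t) ≤ Q := by
    rw [hQ]
    gcongr
    exact le_add_of_nonneg_right (by positivity)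
  have hQ2 : 1 / (√x * d) ≤ Q := by
    calc 1 / (√x * d) = 1 / d * (1 / √x) := by rw [one_div_mul_one_div, mul_comm]
      _ ≤ Q := by
        rw [hQ]
        gcongr
        exact le_add_of_nonneg_left (by positivity)
  have hQpos : 0 < Q := lt_of_lt_of_le (by positivity) hQ2
  rcases le_or_gt 1 Q with hQ3 | hQ3
  · refine hP.trans (one_le_mul_of_one_le_of_one_le hC1 (Real.one_le_rpow hQ3 (by norm_num)))
  by_cases hst : s ^ 5 * t ≤ c * (d * τ)
  · have hu0 : 0 < 1 / (√x * d) := by positivity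
    have hu1 : 1 / (√x * d) ≤ 1 := hQ2.trans hQ3.le
    have e1 : √(1 / √(x * (κ * (1 - ρ)))) = √(1 / √κ) * √(1 / (√x * d)) := by
      rw [← Real.sqrt_mul (by positivity), hd, show x * (κ * (1 - ρ)) = κ * (x * (1 - ρ)) by ring,
        Real.sqrt_mul hκ.le, Real.sqrt_mul (by linarith), one_div_mul_one_div]
    calc P ≤ K * √(1 / √κ) * √(1 / (√x * d)) := by
          rw [mul_assoc, ← e1]
          exact h hst
      _ ≤ C * Q ^ (1 / 4 : ℝ) := by
          gcongr
          rw [Real.sqrt_eq_rpow]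
          calc (1 / (√x * d)) ^ (1 / 2 : ℝ) ≤ (1 / (√x * d)) ^ (1 / 4 : ℝ) :=
                Real.rpow_le_rpow_of_exponent_ge hu0 hu1 (by norm_num)
            _ ≤ Q ^ (1 / 4 : ℝ) := by gcongr
  · push Not at hst
    have e1 : √(c * τ) ≤ Q := by
      refine le_trans ?_ hQ1
      calc √(c * τ) ≤ √((1 / d) ^ 2 * (s ^ 5 * t)) := by
            refine Real.sqrt_le_sqrt ?_
            calc c * τ = (1 / d) ^ 2 * (c * (d * τ)) * d := by field_simp
              _ ≤ (1 / d) ^ 2 * (c * (d * τ)) * 1 := by gcongr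
              _ ≤ _ := by
                rw [mul_one]
                gcongr
        _ = 1 / d * √(s ^ 5 * t) := by
            rw [Real.sqrt_mul (by positivity), Real.sqrt_sq (by positivity)]
    have hct : 0 < √(c * τ) := by positivity
    refine hP.trans ?_
    calc (1 : ℝ) = (1 / √(c * τ)) ^ (1 / 4 : ℝ) * √(c * τ) ^ (1 / 4 : ℝ) := by
          rw [← Real.mul_rpow (by positivity) hct.le, one_div_mul_cancel hct.ne', Real.one_rpow]
      _ ≤ C * Q ^ (1 / 4 : ℝ) := by gcongr

end EllipticLSV

/-! ### Conclusion. -/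

theorem theorem4p1 (a b σ : ℝ) (ha : 0 < a) (hb : 0 < b) (hσ : 0 < σ) :
    ∃ C : ℝ, 0 < C ∧
      ∀ (n : ℕ), C ≤ (n : ℝ) →
      ∀ (Ω : Type*) [MeasurableSpace Ω] (μ : Measure Ω) [IsProbabilityMeasure μ]
        (X : Ω → Matrix (Fin n) (Fin n) ℂ) (ρ : ℝ), ρ < 1 →
        EllipticLSV.IsEllipticTruncated μ X a b σ ρ →
      ∀ (M : Matrix (Fin n) (Fin n) ℂ) (s t : ℝ), 1 ≤ s → 0 < t → t ≤ 1 →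
        μ.real {ω | EllipticLSV.singVal (X ω + M) n ≤ t / √(n : ℝ) ∧
            EllipticLSV.singVal (X ω + M) 1 ≤ s} ≤
          C * (Real.log (C * n * s) / √(1 - ρ) * (√(s ^ 5 * t) + 1 / √(n : ℝ))) ^ (1 / 4 : ℝ) := by
  -- The scale for two copies to be apart: 8τ² ≤ bσ² is what the variance argument needs, and τ ≤ 1
  -- keeps τ₁ ≤ 1.
  set τ := min 1 (σ * √(b / 8)) with hτdef
  have hτ : 0 < τ := lt_min one_pos (by positivity)
  have hτ8 : 8 * τ ^ 2 ≤ b * σ ^ 2 := by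
    calc 8 * τ ^ 2 ≤ 8 * (σ * √(b / 8)) ^ 2 := by
          gcongr
          exact min_le_right _ _
      _ = b * σ ^ 2 := by
          rw [mul_pow, Real.sq_sqrt (by positivity)]
          ring
  obtain ⟨c, K, N, hc, hK, hN, hmain⟩ := EllipticLSV.exists_pi_nullEvent_le ha hτ
    (show 0 < b ^ 2 * σ ^ 2 / (8 * a ^ 2) by positivity)
  set κ := b ^ 2 * σ ^ 2 / (16 * a ^ 2) with hκdef
  have hκ : 0 < κ := by positivity
  have hC2 : 0 ≤ K * √(1 / √κ) := by positivity
  have hC3 : 0 ≤ (1 / √(c * τ)) ^ (1 / 4 : ℝ) := by positivity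
  -- The summand 3 ensures n ≥ 3, so that a pair of indices exists (which also yields ρ ≥ 0), and
  -- makes the logarithm at least 1.
  set C := 3 + N + K * √(1 / √κ) + (1 / √(c * τ)) ^ (1 / 4 : ℝ) with hC
  refine ⟨C, by positivity, ?_⟩
  intro n hn Ω _ μ _ X ρ hρ hX M s t hs ht ht1
  have hn3 : (3 : ℝ) ≤ n := by linarith
  have hn3' : 3 ≤ n := by exact_mod_cast hn3
  have : Nonempty (EllipticLSV.PairIdx n) := ⟨⟨(⟨0, by omega⟩, ⟨1, by omega⟩), by simp⟩⟩
  have hρ0 : 0 ≤ ρ :=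
    (norm_nonneg _).trans (hX.corr_le ⟨0, by omega⟩ ⟨1, by omega⟩ (by simp))
  have := hX.isProbabilityMeasure_pairMeasure
  have hL : 1 ≤ Real.log (C * n * s) := by
    rw [Real.le_log_iff_exp_le (by positivity)]
    have e1 : (3 : ℝ) ≤ C := by linarith
    calc Real.exp 1 ≤ 3 * 1 * 1 := by linarith [Real.exp_one_lt_d9]
      _ ≤ C * n * s := by
          gcongr
          linarith
  have hd1 : √(1 - ρ) ≤ 1 := Real.sqrt_le_one.2 (by linarith)
  have hdpos : 0 < √(1 - ρ) := Real.sqrt_pos.2 (by linarith)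
  have hρ1 : 0 < 1 - ρ := by linarith
  refine EllipticLSV.le_mul_rpow_of_sqrt_bound (K := K) hκ hc hτ hρ0 hρ (by linarith) hL (by linarith)
    (by linarith) (by linarith) measureReal_le_one fun hst => ?_
  refine hX.measureReal_singVal_le (by omega) M (by positivity) fun D => ?_
  have hlaw := hX.pairLaw ha hb hσ hρ hτ8
  have hp : b ^ 2 * ((1 - ρ) * σ ^ 2) / (16 * a ^ 2) = κ * (1 - ρ) := by
    rw [hκdef]
    ring
  rw [hp] at hlaw
  refine hmain (EllipticLSV.pairMeasure μ X) (mul_pos hdpos hτ)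
    (mul_le_one₀ hd1 hτ.le (min_le_left _ _)) (mul_pos hκ hρ1) ?_ hlaw (by linarith)
    (M + Matrix.diagonal D) s t hs ht ht1 hst
  calc κ * (1 - ρ) ≤ κ * 1 := by
        gcongr
        linarith
    _ ≤ b ^ 2 * σ ^ 2 / (8 * a ^ 2) := by
        rw [mul_one, hκdef]
        gcongr
        norm_num
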